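/- **Setting.** Let $n\ge 1$ and let $H_{2n+1}$ be the Heisenberg group with coordinates $(q,z)=(x,y,z)$, $x,y\in\mathbb R^n$, and product $(x,y,z)(x',y',z')=(x+x',y+y',z+z'+\langle x,y'\rangle)$. Equip it with the left-invariant Riemannian metric which is the standard inner product at the identity, and with the right-invariant distribution $\mathcal D_R$ spanned by $\partial_{x_k}+y_k\partial_z$, $\partial_{y_k}$. On $T^*H_{2n+1}$ let $\lambda=(\bar\lambda,\lambda_{2n+1})$ be the canonical momenta and $\{f,g\}=\sum_i(\partial_{q_i}f\,\partial_{p_i}g-\partial_{p_i}f\,\partial_{q_i}g)$. Put $J=\begin{pmatrix}0&-E\\E&0\end{pmatrix}$, $\omega(q,p)=q^TJp$, $u=(y,0)\in\mathbb R^{2n}$. For a Lie algebra $\mathcal F$ of smooth first integrals, $\operatorname{ddim}\mathcal F$ and $\operatorname{dind}\mathcal F$ are the dimension of $F_s=\operatorname{span}\{df(s):f\in\mathcal F\}$ and the dimension of the kernel of the Poisson tensor restricted to $F_s$, for $s$ in an open dense set; $\mathcal F$ is complete if $\operatorname{ddim}\mathcal F+\operatorname{dind}\mathcal F$ is the dimension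 of the phase space, and the system is then called integrable in the non-commutative sense (Liouville integrable if $\mathcal F$ is moreover commutative). **(a)** The sub-Riemannian structure has a unique cometric, and the normal geodesic flow is the Hamiltonian flow on $T^*H_{2n+1}$ of its kinetic energy $$H=\tfrac12\Big(\bar\lambda^T\big(E-\tfrac{(Jq)(Jq)^T}{1+\langle q,q\rangle}\big)\bar\lambda+2\lambda_{2n+1}\bar\lambda^T\big(u+\tfrac{\langle u,u\rangle}{1+\langle q,q\rangle}Jq\big)+\lambda_{2n+1}^2\big(\langle u,u\rangle-\tfrac{\langle u,u\rangle^2}{1+\langle q,q\rangle}\big)\Big);$$ that is, the normal extremals of the energy-minimization problem are exactly the solutions of Hamilton's equations of $H$. The functions $$I_0=H,\qquad I_j=x_j\lambda_{n+j}-y_j\lambda_j+\tfrac12(x_j^2-y_j^2)\lambda_{2n+1}\ (1\le j\le n),\qquad I_{2n}=\lambda_{2n+1},$$ $$I_{n+k}=(y_{k+1}\lambda_1-x_1\lambda_{n+k+1}+x_{k+1}\lambda_{n+1}-y_1\lambda_{k+1})^2+\big(x_1\lambda_{k+1}-x_{k+1}\lambda_1-y_1\lambda_{n+k+1}+y_{k+1}\lambda_{n+1}+(x_1y_{k+1}-x_{k+1}y_1)\lambda_{2n+1}\big)^2\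 (1\le k\le n-1),$$ $$I_{2n+l}=\{I_{n+1},I_{n+l+1}\}\ (1\le l\le n-2)$$ are first integrals and are functionally independent almost everywhere. Let $\mathcal F$ be the Lie algebra they generate. If $n\in\{1,2\}$, then $\mathcal F$ is commutative and $\operatorname{ddim}\mathcal F=\operatorname{dind}\mathcal F=2n+1$, so the system is Liouville integrable. If $n>2$, the integrals do not all commute, and $\operatorname{ddim}\mathcal F=3n-1$, $\operatorname{dind}\mathcal F=n+3$, so the system is integrable in the non-commutative sense. **(b)** Let $C\in\mathbb R$. The map $(q,z,\lambda)\mapsto(q,p)$, $p_k=\lambda_k+Cy_k$, $p_{n+k}=\lambda_{n+k}$, identifies the quotient of the level $\{\lambda_{2n+1}=C\}$ by translations in $z$ with $T^*\mathbb R^{2n}$. It carries $H$ to $$H_C(q,p)=\tfrac12\Big(\langle p,p\rangle-\tfrac{\omega(q,p)^2}{1+\langle q,q\rangle}\Big),$$ the kinetic energy of the metric $E+(Jq)(Jq)^T$ on $\mathbb R^{2n}$, onto which the sub-Riemannian metric projects; it carries the canonical bracket to the one with $\{x_k,p_j\}=\{y_k,p_{n+j}\}=\delta_{kj}$, $\{p_k,p_{n+j}\}=C\delta_{kj}$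 and all other brackets of coordinates zero; and it carries the geodesic flow on the level onto the motion of a charged particle with Hamiltonian $H_C$ in the magnetic field $F=C\sum_i dx_i\wedge dy_i$, i.e. the Hamiltonian system of $H_C$ for the symplectic form $\sum_i dp_i\wedge dq_i+F$. This system is completely integrable: the integrals $I_i$, $i\ne 2n$, descend to first integrals of it which are functionally independent almost everywhere, and the Lie algebra $\mathcal F_C$ they generate is commutative with $\operatorname{ddim}\mathcal F_C=\operatorname{dind}\mathcal F_C=2n$ if $n\in\{1,2\}$, while for $n>2$ they do not all commute and $\mathcal F_C$ is complete with $\operatorname{ddim}\mathcal F_C=3n-2$, $\operatorname{dind}\mathcal F_C=n+2$. Introduce hyperspherical coordinates by $$x_1=r\prod_{j=1}^{n-1}\cos\theta_j\cos\theta_n,\quad y_1=r\prod_{j=1}^{n-1}\cos\theta_j\sin\theta_n,$$ $$x_k=r\prod_{j=1}^{n-k}\cos\theta_j\,\sin\theta_{n-k+1}\cos\theta_{n+k-1},\quad y_k=r\prod_{j=1}^{n-k}\cos\theta_j\,\sin\theta_{n-k+1}\sin\theta_{n+k-1}\quad(2\le k\le n),$$ with $r>0$, $\theta_j\in(0,\pi/2)$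 for $j<n$ and $\theta_j\in(-\pi,\pi)$ for $j\ge n$; they parametrize bijectively the points such that, for every $k$, $x_k>0$ or $y_k\ne0$. Let $p_r,p_{\theta_j}$ be the associated components of the covector $p$. In these coordinates the first integrals are $$\tilde I_0=\tilde H_C=\tfrac12\Big(p_r^2+\tfrac1{r^2}\sum_{k=1}^{n-1}\frac{p_{\theta_k}^2}{\prod_{j=1}^{k-1}\cos^2\theta_j}+\tfrac1{r^2}\rho_{n-1}-\tfrac1{1+r^2}\Big(\sum_{k=n}^{2n-1}p_{\theta_k}\Big)^2\Big),$$ $$\tilde I_1=p_{\theta_n}+\tfrac C2r^2\prod_{k=1}^{n-1}\cos^2\theta_k,\qquad \tilde I_i=p_{\theta_{i+n-1}}+\tfrac C2r^2\prod_{k=1}^{n-i}\cos^2\theta_k\,\sin^2\theta_{n-i+1}\quad(1<i\le n),$$ $$\tilde I_{n+1}=p_{\theta_{n-1}}^2-(p_{\theta_n}+p_{\theta_{n+1}})^2+\frac{p_{\theta_n}^2}{\cos^2\theta_{n-1}}+\frac{p_{\theta_{n+1}}^2}{\sin^2\theta_{n-1}}\quad(n\ge2),$$ $$\tilde I_{n+i}=\Big(p_{\theta_n}\prod_{k=1}^{i-1}\cos^{-1}\theta_{n-k}\tan\theta_{n-i}-p_{\theta_{n+i}}\prod_{k=1}^{i-1}\cos\theta_{n-k}\cot\theta_{n-i}\Big)^2+\Big(p_{\theta_{n-i}}\prod_{k=1}^{i-1}\cos\theta_{n-k}+\varrho_{i-1}\tan\theta_{n-i}\Big)^2\quad(1<i<n),$$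 $$\tilde J_k=\{\tilde I_{n+1},\tilde I_{n+k}\}\quad(1<k<n),$$ where $\rho_0=p_{\theta_n}^2$, $\rho_k=\cos^{-2}\theta_{n-k}\,\rho_{k-1}+\sin^{-2}\theta_{n-k}\,p_{\theta_{n+k}}^2$, and $\varrho_0=0$, $\varrho_i=p_{\theta_{n-i}}\sin\theta_{n-i}\prod_{k=1}^{i-1}\cos\theta_{n-k}+\cos^{-1}\theta_{n-i}\,\varrho_{i-1}$. -/

import Mathlib

open Matrix MeasureTheory Finset
open scoped ContDiff

noncomputable section

/-! ### Phase spaces, Poisson structures and integrability -/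

/-- The cotangent bundle `T*ℝ^ι` in the coordinates (position, momentum). -/
abbrev Phase (ι : Type) : Type := (ι → ℝ) × (ι → ℝ)

/-- A field of bilinear forms on `ℝ^ι`; used for (magnetic) two-forms. -/
abbrev FormField (ι : Type) : Type := (ι → ℝ) → (ι → ℝ) → (ι → ℝ) → ℝ

section Poisson

variable {ι : Type} [Fintype ι] [DecidableEq ι]

/-- The coordinate vector `∂/∂q_i` of the phase space. -/
def dirQ (i : ι) : Phase ι := (Pi.single i 1, 0)

/-- The coordinate vector `∂/∂p_i` of the phase space. -/
def dirP (i : ι) : Phase ι := (0, Pi.single i 1)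

/-- The Poisson tensor on `T*ℝ^ι` with `{q_i, p_j} = δ_ij`, `{q_i, q_j} = 0`,
`{p_i, p_j} = F(∂_i, ∂_j)`, i.e. the one of the symplectic form `Σ dp_i ∧ dq_i + F`.
For `F = 0` it is the canonical one. -/
def poissonTensor (F : FormField ι) (s : Phase ι) (α β : Phase ι →L[ℝ] ℝ) : ℝ :=
  (∑ i, (α (dirQ i) * β (dirP i) - α (dirP i) * β (dirQ i)))
    + ∑ i, ∑ j, F s.1 (Pi.single i 1) (Pi.single j 1) * α (dirP i) * β (dirP j)

/-- The Poisson bracket `{f, g} = Λ(df, dg)`. -/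
def bracket (F : FormField ι) (f g : Phase ι → ℝ) : Phase ι → ℝ :=
  fun s => poissonTensor F s (fderiv ℝ f s) (fderiv ℝ g s)

/-- The canonical Hamiltonian vector field `q' = ∂H/∂p`, `p' = -∂H/∂q`. -/
def hamVec (H : Phase ι → ℝ) (s : Phase ι) : Phase ι :=
  (fun i => fderiv ℝ H s (dirP i), fun i => -fderiv ℝ H s (dirQ i))

/-- `c` solves Hamilton's equations of `H` (canonical symplectic structure) at all times in `T`. -/
def IsHamTrajectoryOn (H : Phase ι → ℝ) (c : ℝ → Phase ι) (T : Set ℝ) : Prop :=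
  ∀ t ∈ T, HasDerivAt c (hamVec H (c t)) t

/-- The magnetic symplectic form `Σ dp_i ∧ dq_i + F` on `T*ℝ^ι`. -/
def magneticForm (F : FormField ι) (s v w : Phase ι) : ℝ :=
  (∑ i, (v.2 i * w.1 i - v.1 i * w.2 i)) + F s.1 v.1 w.1

/-- The motion of a charged particle with kinetic energy `H` in the magnetic field `F`:
Hamilton's equations `Ω(c', ·) = -dH` for the symplectic form `Ω = Σ dp_i ∧ dq_i + F`. -/
def IsChargedMotionOn (F : FormField ι) (H : Phase ι → ℝ) (c : ℝ → Phase ι) (T : Set ℝ) : Prop :=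
  ∀ t ∈ T, ∃ v, HasDerivAt c v t ∧ ∀ w, magneticForm F (c t) v w = -fderiv ℝ H (c t) w

/-- A (smooth) first integral of the Hamiltonian system with Hamiltonian `H`. -/
def IsFirstIntegral (F : FormField ι) (H f : Phase ι → ℝ) : Prop :=
  ContDiff ℝ ∞ f ∧ ∀ s, bracket F f H s = 0

/-- Membership in the Lie algebra of functions generated by `G` under the Poisson bracket. -/
inductive LieGen (F : FormField ι) (G : Set (Phase ι → ℝ)) : (Phase ι → ℝ) → Prop
  | base {f} (hf : f ∈ G) : LieGen F G f
  | zero : LieGen F G 0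
  | add {f g} (hf : LieGen F G f) (hg : LieGen F G g) : LieGen F G (f + g)
  | smul (a : ℝ) {f} (hf : LieGen F G f) : LieGen F G (a • f)
  | brk {f g} (hf : LieGen F G f) (hg : LieGen F G g) : LieGen F G (bracket F f g)

/-- The Lie algebra of functions generated by `G`. -/
def lieAlg (F : FormField ι) (G : Set (Phase ι → ℝ)) : Set (Phase ι → ℝ) := {f | LieGen F G f}

/-- The space spanned by the differentials at `s` of the functions in `A`. -/
def diffSpan (A : Set (Phase ι → ℝ)) (s : Phase ι) : Submodule ℝ (Phase ι →L[ℝ] ℝ) :=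
  Submodule.span ℝ ((fun f => fderiv ℝ f s) '' A)

/-- The kernel of the restriction of the Poisson tensor at `s` to `diffSpan A s`. (The set is
already a linear subspace; the span only makes it a `Submodule`.) -/
def diffKer (F : FormField ι) (A : Set (Phase ι → ℝ)) (s : Phase ι) :
    Submodule ℝ (Phase ι →L[ℝ] ℝ) :=
  Submodule.span ℝ {α | α ∈ diffSpan A s ∧ ∀ β ∈ diffSpan A s, poissonTensor F s α β = 0}

/-- `A` has differential dimension `d` and differential index `k`: these are the dimensions of
`diffSpan` and `diffKer` on an open dense set. -/
def HasDiffDims (F : FormField ι) (A : Set (Phase ι → ℝ)) (d k : ℕ) : Prop :=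
  ∃ U : Set (Phase ι), IsOpen U ∧ Dense U ∧ ∀ s ∈ U,
    Module.finrank ℝ (diffSpan A s) = d ∧ Module.finrank ℝ (diffKer F A s) = k

/-- `A` is a complete Lie algebra of first integrals of `H`, with differential dimension `d` and
differential index `k`: the system is completely integrable in the non-commutative sense. -/
structure IsCompleteAlgebra (F : FormField ι) (H : Phase ι → ℝ) (A : Set (Phase ι → ℝ))
    (d k : ℕ) : Prop where
  zero_mem : (0 : Phase ι → ℝ) ∈ A
  add_mem : ∀ f ∈ A, ∀ g ∈ A, f + g ∈ A
  smul_mem : ∀ a : ℝ, ∀ f ∈ A, a • f ∈ A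
  bracket_mem : ∀ f ∈ A, ∀ g ∈ A, bracket F f g ∈ A
  firstIntegral : ∀ f ∈ A, IsFirstIntegral F H f
  dims : HasDiffDims F A d k
  complete : d + k = Module.finrank ℝ (Phase ι)

/-- All functions in `A` are in involution. -/
def InInvolution (F : FormField ι) (A : Set (Phase ι → ℝ)) : Prop :=
  ∀ f ∈ A, ∀ g ∈ A, ∀ s, bracket F f g s = 0

/-- Functional independence almost everywhere. -/
def IndependentAE {κ : Type} (f : κ → Phase ι → ℝ) : Prop :=
  ∀ᵐ s : Phase ι, LinearIndependent ℝ fun i => fderiv ℝ (f i) s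

end Poisson

/-! ### The Heisenberg group and the sub-Riemannian structure -/

/-- Indices of the coordinates `(x, y)` of `ℝ^{2n}`. -/
abbrev BI (n : ℕ) : Type := Fin n ⊕ Fin n

/-- Indices of the coordinates `(x, y, z)` of the Heisenberg group. -/
abbrev HI (n : ℕ) : Type := BI n ⊕ Unit

section Heisenberg

variable {n : ℕ}

/-- The `x`-part of a vector of `ℝ^{2n}`. -/
def px (q : BI n → ℝ) : Fin n → ℝ := fun k => q (Sum.inl k)

/-- The `y`-part of a vector of `ℝ^{2n}`. -/
def py (q : BI n → ℝ) : Fin n → ℝ := fun k => q (Sum.inr k)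

/-- The `ℝ^{2n}`-part of a vector of `ℝ^{2n+1}`. -/
def bar (g : HI n → ℝ) : BI n → ℝ := fun a => g (Sum.inl a)

/-- The last coordinate of a vector of `ℝ^{2n+1}`. -/
def pz (g : HI n → ℝ) : ℝ := g (Sum.inr ())

/-- The vector `(q, z)` of `ℝ^{2n+1}`. -/
def hVec (q : BI n → ℝ) (z : ℝ) : HI n → ℝ := Sum.elim q (fun _ => z)

/-- Multiplication in the Heisenberg group `H_{2n+1}`, i.e. of the matrices
`[[1, xᵀ, z], [0, E, y], [0, 0, 1]]`. The identity is `0`. -/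
def heisMul (g h : HI n → ℝ) : HI n → ℝ :=
  hVec (bar g + bar h) (pz g + pz h + px (bar g) ⬝ᵥ py (bar h))

/-- Inversion in the Heisenberg group. -/
def heisInv (g : HI n → ℝ) : HI n → ℝ :=
  hVec (-bar g) (-pz g + px (bar g) ⬝ᵥ py (bar g))

/-- The left-invariant Riemannian metric which is the standard inner product at the identity. -/
def leftMetric (g v w : HI n → ℝ) : ℝ :=
  fderiv ℝ (heisMul (heisInv g)) g v ⬝ᵥ fderiv ℝ (heisMul (heisInv g)) g w

/-- The differential at the identity of the right translation `h ↦ h g`. -/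
def rightDiff (g : HI n → ℝ) : (HI n → ℝ) →L[ℝ] (HI n → ℝ) :=
  fderiv ℝ (fun h => heisMul h g) 0

/-- The right-invariant distribution generated by `∂/∂x_k`, `∂/∂y_k` at the identity. -/
def distR (g : HI n → ℝ) : Submodule ℝ (HI n → ℝ) :=
  Submodule.map (rightDiff g : (HI n → ℝ) →ₗ[ℝ] (HI n → ℝ))
    (Submodule.span ℝ (Set.range fun a : BI n => (Pi.single (Sum.inl a) 1 : HI n → ℝ)))

/-- `β : T* → T` is the map of the cometric of the sub-Riemannian structure given by the
distribution `D` and the restriction of the metric `m` to it. -/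
def IsCometricMap (D : (HI n → ℝ) → Submodule ℝ (HI n → ℝ))
    (m : (HI n → ℝ) → (HI n → ℝ) → (HI n → ℝ) → ℝ)
    (β : (HI n → ℝ) → (HI n → ℝ) →ₗ[ℝ] (HI n → ℝ)) : Prop :=
  ∀ g, LinearMap.range (β g) = D g ∧ ∀ l, ∀ v ∈ D g, l ⬝ᵥ v = m g (β g l) v

/-- The vector field of `distR` with the constant coefficients `u` in the right-invariant frame. -/
def rightField (u : BI n → ℝ) (g : HI n → ℝ) : HI n → ℝ := rightDiff g (hVec u 0)

/-- The control Hamiltonian `λ(X_u) - |X_u|²/2` of the energy-minimization problem for curves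
tangent to `distR`. -/
def controlHam (u : BI n → ℝ) (s : Phase (HI n)) : ℝ :=
  s.2 ⬝ᵥ rightField u s.1 - 1 / 2 * leftMetric s.1 (rightField u s.1) (rightField u s.1)

/-- `c = (γ, λ)` is the cotangent lift of a normal geodesic `γ` of the sub-Riemannian structure:
a normal extremal, in the sense of the maximum principle, of the energy-minimization problem. -/
def IsNormalExtremalOn (c : ℝ → Phase (HI n)) (T : Set ℝ) : Prop :=
  ∀ t ∈ T, ∃ u : BI n → ℝ, (∀ w, controlHam w (c t) ≤ controlHam u (c t)) ∧
    HasDerivAt c (hamVec (controlHam u) (c t)) t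

/-- The Hamiltonian of the normal geodesic flow, with `s = ((q, z), (lam, lz))`, `u = (y, 0)` and
`J = [[0, -E], [E, 0]]`. -/
def hamR (s : Phase (HI n)) : ℝ :=
  let q := bar s.1
  let lam := bar s.2
  let lz := pz s.2
  let u : BI n → ℝ := Sum.elim (py q) 0
  let Jq := Matrix.J (Fin n) ℝ *ᵥ q
  1 / 2 * (lam ⬝ᵥ ((1 - (1 / (1 + q ⬝ᵥ q)) • vecMulVec Jq Jq) *ᵥ lam)
    + 2 * lz * (lam ⬝ᵥ (u + ((u ⬝ᵥ u) / (1 + q ⬝ᵥ q)) • Jq))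
    + lz ^ 2 * (u ⬝ᵥ u - (u ⬝ᵥ u) ^ 2 / (1 + q ⬝ᵥ q)))

/-! ### The first integrals of the full system -/

/-- Indices of the first integrals of the full system; `quad k` and `brk l` are zero-based. -/
inductive FullIdx (n : ℕ) : Type
  | ham : FullIdx n
  | ang (j : Fin n) : FullIdx n
  | quad (k : Fin (n - 1)) : FullIdx n
  | cyc : FullIdx n
  | brk (l : Fin (n - 2)) : FullIdx n

/-- The first element of `Fin n`, for `n` with `Fin (n - 1)` inhabited. -/
def firstPos (k : Fin (n - 1)) : Fin n := ⟨0, by have := k.2; omega⟩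

/-- The element following `k`. -/
def nextPos (k : Fin (n - 1)) : Fin n := ⟨k + 1, by have := k.2; omega⟩

/-- The first element of `Fin (n - 1)`, for `n` with `Fin (n - 2)` inhabited. -/
def firstQuad (l : Fin (n - 2)) : Fin (n - 1) := ⟨0, by have := l.2; omega⟩

/-- The element following `l`. -/
def nextQuad (l : Fin (n - 2)) : Fin (n - 1) := ⟨l + 1, by have := l.2; omega⟩

/-- `x_j λ_{n+j} - y_j λ_j + (x_j² - y_j²) λ_{2n+1} / 2`. -/
def intAng (j : Fin n) (s : Phase (HI n)) : ℝ :=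
  let x := px (bar s.1)
  let y := py (bar s.1)
  let lx := px (bar s.2)
  let ly := py (bar s.2)
  x j * ly j - y j * lx j + 1 / 2 * (x j ^ 2 - y j ^ 2) * pz s.2

/-- The quadratic integral of the indices `1` and `k + 1` (`k = 1, …, n - 1`). -/
def intQuad (k : Fin (n - 1)) (s : Phase (HI n)) : ℝ :=
  let x := px (bar s.1)
  let y := py (bar s.1)
  let lx := px (bar s.2)
  let ly := py (bar s.2)
  let o := firstPos k
  let m := nextPos k
  (y m * lx o - x o * ly m + x m * ly o - y o * lx m) ^ 2
    + (x o * lx m - x m * lx o - y o * ly m + y m * ly o + (x o * y m - x m * y o) * pz s.2) ^ 2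

/-- The first integrals of the normal geodesic flow on the cotangent bundle of `H_{2n+1}`. -/
def intFull : FullIdx n → Phase (HI n) → ℝ
  | .ham => hamR
  | .ang j => intAng j
  | .quad k => intQuad k
  | .cyc => fun s => pz s.2
  | .brk l => bracket 0 (intQuad (firstQuad l)) (intQuad (nextQuad l))

/-! ### The reduced system -/

/-- The magnetic field `C Σ dx_i ∧ dy_i` on `ℝ^{2n}`. -/
def magField (C : ℝ) : FormField (BI n) :=
  fun _ v w => C * ∑ k, (px v k * py w k - py v k * px w k)

/-- The Riemannian metric `E + (Jq)(Jq)ᵀ` on `ℝ^{2n}`. -/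
def redMetric : FormField (BI n) :=
  fun q v w => v ⬝ᵥ w + ((Matrix.J (Fin n) ℝ *ᵥ q) ⬝ᵥ v) * ((Matrix.J (Fin n) ℝ *ᵥ q) ⬝ᵥ w)

/-- The map `(q, z, λ) ↦ (q, p)` with `p_k = λ_k + λ_{2n+1} y_k`, `p_{n+k} = λ_{n+k}`. -/
def reduceMap (s : Phase (HI n)) : Phase (BI n) :=
  (bar s.1, Sum.elim (px (bar s.2) + pz s.2 • py (bar s.1)) (py (bar s.2)))

/-- The reduced Hamiltonian `(⟨p, p⟩ - ω(q, p)² / (1 + ⟨q, q⟩)) / 2`, `ω(q, p) = qᵀ J p`. -/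
def hamRed (s : Phase (BI n)) : ℝ :=
  1 / 2 * (s.2 ⬝ᵥ s.2 - (s.1 ⬝ᵥ (Matrix.J (Fin n) ℝ *ᵥ s.2)) ^ 2 / (1 + s.1 ⬝ᵥ s.1))

/-- Indices of the first integrals of the reduced system; `quad k` and `brk l` are zero-based. -/
inductive RedIdx (n : ℕ) : Type
  | ham : RedIdx n
  | ang (j : Fin n) : RedIdx n
  | quad (k : Fin (n - 1)) : RedIdx n
  | brk (l : Fin (n - 2)) : RedIdx n

/-- The index of the integral of the full system which reduces to a given one. -/
def RedIdx.toFull : RedIdx n → FullIdx n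
  | .ham => .ham
  | .ang j => .ang j
  | .quad k => .quad k
  | .brk l => .brk l

/-- `x_j p_{n+j} - y_j p_j + C (x_j² + y_j²) / 2`. -/
def redAng (C : ℝ) (j : Fin n) (s : Phase (BI n)) : ℝ :=
  px s.1 j * py s.2 j - py s.1 j * px s.2 j + 1 / 2 * C * (px s.1 j ^ 2 + py s.1 j ^ 2)

/-- The quadratic integral of the indices `1` and `k + 1`, in the coordinates `(q, p)`. -/
def redQuad (k : Fin (n - 1)) (s : Phase (BI n)) : ℝ :=
  let x := px s.1
  let y := py s.1
  let u := px s.2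
  let v := py s.2
  let o := firstPos k
  let m := nextPos k
  (y m * u o - x o * v m + x m * v o - y o * u m) ^ 2
    + (x o * u m - x m * u o - y o * v m + y m * v o) ^ 2

/-- The first integrals of the reduced system in the coordinates `(q, p)`. -/
def intRed (C : ℝ) : RedIdx n → Phase (BI n) → ℝ
  | .ham => hamRed
  | .ang j => redAng C j
  | .quad k => redQuad k
  | .brk l => bracket (magField C) (redQuad (firstQuad l)) (redQuad (nextQuad l))

/-! ### Hyperspherical coordinates -/

/-- The `j`-th entry of a vector indexed by `0, …, 2n - 1`: applied to the position `(r, θ)` it is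
`r` for `j = 0` and `θ_j` for `1 ≤ j < 2n`, and likewise `p_r`, `p_{θ_j}` for the momentum. -/
def ent (a : Fin (2 * n) → ℝ) (j : ℕ) : ℝ := if h : j < 2 * n then a ⟨j, h⟩ else 0

/-- `√(x_k² + y_k²)` in hyperspherical coordinates, `k = m + 1`. -/
def hypRad (a : Fin (2 * n) → ℝ) (m : Fin n) : ℝ :=
  ent a 0 * (∏ j ∈ Icc 1 (n - 1 - m), Real.cos (ent a j))
    * if (m : ℕ) = 0 then 1 else Real.sin (ent a (n - m))

/-- Hyperspherical coordinates: `(r, θ) ↦ (x, y)`. -/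
def hyp (a : Fin (2 * n) → ℝ) : BI n → ℝ :=
  Sum.elim (fun m => hypRad a m * Real.cos (ent a (n + m)))
    (fun m => hypRad a m * Real.sin (ent a (n + m)))

/-- The domain of the hyperspherical coordinates. -/
def hypDomain (n : ℕ) : Set (Fin (2 * n) → ℝ) :=
  {a | 0 < ent a 0 ∧ (∀ j, 1 ≤ j → j < n → ent a j ∈ Set.Ioo 0 (Real.pi / 2)) ∧
    ∀ j, n ≤ j → j < 2 * n → ent a j ∈ Set.Ioo (-Real.pi) Real.pi}

/-- The associated momenta `(p_r, p_θ)`: the components of the covector `p` in the coordinates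
`(r, θ)`. -/
def hypMom (a : Fin (2 * n) → ℝ) (p : BI n → ℝ) : Fin (2 * n) → ℝ :=
  fun i => p ⬝ᵥ fderiv ℝ hyp a (Pi.single i 1)

/-- The magnetic field in hyperspherical coordinates. -/
def hypField (n : ℕ) (C : ℝ) : FormField (Fin (2 * n)) :=
  fun a v w => magField C (hyp a) (fderiv ℝ (hyp (n := n)) a v) (fderiv ℝ (hyp (n := n)) a w)

/-- `ρ_0 = p_{θ_n}²`, `ρ_k = cos⁻² θ_{n-k} ρ_{k-1} + sin⁻² θ_{n-k} p_{θ_{n+k}}²`. -/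
def hypRho (s : Phase (Fin (2 * n))) : ℕ → ℝ
  | 0 => ent s.2 n ^ 2
  | k + 1 => hypRho s k / Real.cos (ent s.1 (n - (k + 1))) ^ 2
      + ent s.2 (n + (k + 1)) ^ 2 / Real.sin (ent s.1 (n - (k + 1))) ^ 2

/-- The reduced Hamiltonian in hyperspherical coordinates. -/
def hypHam (s : Phase (Fin (2 * n))) : ℝ :=
  1 / 2 * (ent s.2 0 ^ 2
    + 1 / ent s.1 0 ^ 2 * ∑ k ∈ Icc 1 (n - 1),
        ent s.2 k ^ 2 / ∏ j ∈ Icc 1 (k - 1), Real.cos (ent s.1 j) ^ 2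
    + 1 / ent s.1 0 ^ 2 * hypRho s (n - 1)
    - 1 / (1 + ent s.1 0 ^ 2) * (∑ k ∈ Icc n (2 * n - 1), ent s.2 k) ^ 2)

/-- The integrals linear in the momenta, `i = m + 1`:
`p_{θ_{i+n-1}} + r² ∏_{k ≤ n-i} cos² θ_k sin² θ_{n-i+1} C / 2`, without the sine for `i = 1`. -/
def hypAng (C : ℝ) (m : Fin n) (s : Phase (Fin (2 * n))) : ℝ :=
  ent s.2 (n + m) + 1 / 2 * ent s.1 0 ^ 2 * (∏ k ∈ Icc 1 (n - 1 - m), Real.cos (ent s.1 k) ^ 2)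
    * (if (m : ℕ) = 0 then 1 else Real.sin (ent s.1 (n - m)) ^ 2) * C

/-- `ϱ_0 = 0`, `ϱ_i = p_{θ_{n-i}} sin θ_{n-i} ∏_{k < i} cos θ_{n-k} + cos⁻¹ θ_{n-i} ϱ_{i-1}`. -/
def hypVarrho (s : Phase (Fin (2 * n))) : ℕ → ℝ
  | 0 => 0
  | i + 1 => ent s.2 (n - (i + 1)) * Real.sin (ent s.1 (n - (i + 1)))
        * (∏ k ∈ Icc 1 i, Real.cos (ent s.1 (n - k)))
      + hypVarrho s i / Real.cos (ent s.1 (n - (i + 1)))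

/-- The quadratic integrals in hyperspherical coordinates, `i = k + 1`. -/
def hypQuad (k : Fin (n - 1)) (s : Phase (Fin (2 * n))) : ℝ :=
  let i : ℕ := k + 1
  let th := ent s.1
  let p := ent s.2
  if i = 1 then
    p (n - 1) ^ 2 - (p n + p (n + 1)) ^ 2 + p n ^ 2 / Real.cos (th (n - 1)) ^ 2
      + p (n + 1) ^ 2 / Real.sin (th (n - 1)) ^ 2
  else
    (p n * (∏ j ∈ Icc 1 (i - 1), (Real.cos (th (n - j)))⁻¹) * Real.tan (th (n - i))
        - p (n + i) * (∏ j ∈ Icc 1 (i - 1), Real.cos (th (n - j))) * Real.cot (th (n - i))) ^ 2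
      + (p (n - i) * (∏ j ∈ Icc 1 (i - 1), Real.cos (th (n - j)))
        + hypVarrho s (i - 1) * Real.tan (th (n - i))) ^ 2

/-- The first integrals of the reduced system in hyperspherical coordinates. -/
def intHyp (C : ℝ) : RedIdx n → Phase (Fin (2 * n)) → ℝ
  | .ham => hypHam
  | .ang m => hypAng C m
  | .quad k => hypQuad k
  | .brk l => bracket (hypField n C) (hypQuad (firstQuad l)) (hypQuad (nextQuad l))

end Heisenberg

end

set_option linter.unusedSimpArgs false
-- Analyticity: independence at one point gives independence almost everywhere.
noncomputable section

section Generic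

open scoped Pointwise

variable {E : Type*} [NormedAddCommGroup E] [NormedSpace ℝ E]

/-! In the frame of right-invariant fields the sub-Riemannian metric depends only on `q` and equals
`E + (Jq)(Jq)ᵀ`, and the frame components of a covector are the momenta `p` of `reduceMap`. So
`hamR` is the pullback of `hamRed` (`hamR_eq`). On a level of `λ_{2n+1}` the map `reduceMap` carries
the canonical bracket to the magnetic one (`bracket_of_eq_on_level`), and the first integrals
descend (`isLift_intFull`). It therefore suffices to study the reduced system and then adjoin the
central momentum `cycFun`, which raises both dimensions by one.

Put `w = x + iy` and `π = p_x + i p_y`. The reduced Hamiltonian is a function of `sqQ`, `sqP` and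
`omQP`, which together with `dotQP` span a four-dimensional Lie algebra. Each `redAng` generates a
rotation of one complex coordinate plane and preserves these four functions. Their own Hamiltonian
flows act on every pair `(w_k, π_k)` by one and the same complex matrix, which changes the minor
`w_1 π_m - w_m π_1` at most by a phase; its squared modulus is `redQuad`. Hence `redAng` and
`redQuad` are first integrals, and by the Jacobi identity so are iterated brackets. The function
`casimir` is central for the four invariants and commutes with all the integrals.

For `n > 2` there are `3n - 2` generators, and the `n + 2` functions `hamRed`, `casimir` and
`redAng` commute with all of them and with each other. The numbers add up to the dimension `4n` of
the phase space, so linear algebra with the nondegenerate Poisson tensor identifies the span of the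
differentials as the orthogonal complement of the central ones, and its kernel as their span
(`isCompleteAlgebra_lieAlg`). For `n ≤ 2` the generators themselves play both roles. Generic
independence only has to be checked at one point, because everything is real analytic
(`exists_open_dense_linearIndependent`).

The normal extremals follow from an envelope argument: `hamR` is the maximum of the control
Hamiltonians, so at an optimal control the differentials agree (`hamVec_controlHam`). The
hyperspherical formulas are obtained by adding one coordinate plane at a time and tracking partial
norms; the bracket is transported by the cotangent lift of the chart (`IsHypForm.bracket`). -/

lemma ae_ne_zero_of_analytic_line {h : ℝ → ℝ} (hh : ContDiff ℝ ω h) (h0 : h 0 ≠ 0) :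
    ∀ᵐ t : ℝ, h t ≠ 0 := by
  have ha : AnalyticOnNhd ℝ h Set.univ := hh.analyticOnNhd
  -- Identity theorem: the zeros are isolated, and codiscrete sets have full measure.
  have hc := ha.preimage_zero_mem_codiscrete (x := 0) h0
  have := (ae_restrict_le_codiscreteWithin (μ := volume) (U := (Set.univ : Set ℝ))
    MeasurableSet.univ) hc
  rw [Measure.restrict_univ] at this
  filter_upwards [this] with t ht
  simpa using ht

variable [FiniteDimensional ℝ E] [MeasurableSpace E] [BorelSpace E]
  (μ : Measure E) [μ.IsAddHaarMeasure]

/-- A real analytic function which does not vanish at some point vanishes only on a null set. -/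
lemma ae_ne_zero_of_analytic {g : E → ℝ} (hg : ContDiff ℝ ω g) {a : E} (ha : g a ≠ 0) :
    ∀ᵐ x ∂μ, g x ≠ 0 := by
  -- On every line through `a` the one-dimensional case applies. Fubini then yields a single `t ≠ 0`
  -- that is good for almost every `x`, and `x ↦ a + t • x` maps null sets to null sets.
  have h1 : ∀ᵐ x ∂μ, ∀ᵐ t : ℝ, g (a + t • x) ≠ 0 := by
    refine Filter.Eventually.of_forall fun x => ?_
    refine ae_ne_zero_of_analytic_line (h := fun t => g (a + t • x)) ?_ (by simpa using ha)
    exact hg.comp (by fun_prop)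
  have hm : MeasurableSet {p : E × ℝ | g (a + p.2 • p.1) ≠ 0} := by
    apply IsOpen.measurableSet
    have : Continuous fun p : E × ℝ => g (a + p.2 • p.1) := hg.continuous.comp (by fun_prop)
    exact isOpen_ne.preimage this
  rw [Measure.ae_ae_comm hm] at h1
  have h2 : ∀ᵐ t : ℝ, t ≠ 0 := by
    simp [ae_iff]
  obtain ⟨t, ht, ht0⟩ := (h1.and h2).exists
  have hz : μ {x | g (a + t • x) = 0} = 0 := by simpa [ae_iff] using ht
  rw [ae_iff]
  have : {x | ¬ g x ≠ 0} = (fun x => a + x) '' (t • {x | g (a + t • x) = 0}) := by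
    ext y
    simp only [ne_eq, not_not, Set.mem_ofPred_eq, Set.mem_image, Set.mem_smul_set]
    constructor
    · intro hy
      refine ⟨y - a, ⟨t⁻¹ • (y - a), ?_, ?_⟩, by simp⟩
      · simp [smul_smul, mul_inv_cancel₀ ht0, hy]
      · simp [smul_smul, mul_inv_cancel₀ ht0]
    · rintro ⟨_, ⟨x, hx, rfl⟩, rfl⟩
      exact hx
  rw [this, Set.image_add_left, measure_preimage_add, Measure.addHaar_smul, hz, mul_zero]

/-- Analytic functions with linearly independent differentials at one point have linearly
independent differentials on an open dense set of full measure. -/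
lemma exists_open_dense_linearIndependent {κ : Type*} [Finite κ] {f : κ → E → ℝ}
    (hf : ∀ i, ContDiff ℝ ω (f i)) {a : E}
    (ha : LinearIndependent ℝ fun i => fderiv ℝ (f i) a) :
    ∃ U : Set E, IsOpen U ∧ Dense U ∧ (∀ᵐ x ∂μ, x ∈ U) ∧
      ∀ x ∈ U, LinearIndependent ℝ fun i => fderiv ℝ (f i) x := by
  classical
  have := Fintype.ofFinite κ
  -- Vectors dual to the independent differentials at `a`. They exist because a functional vanishing
  -- on the range of the joint map would be a linear relation between the differentials.
  obtain ⟨v, hv⟩ : ∃ v : κ → E, ∀ i j, fderiv ℝ (f i) a (v j) = if i = j then 1 else 0 := by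
    let L : E →ₗ[ℝ] (κ → ℝ) := LinearMap.pi fun i => (fderiv ℝ (f i) a : E →ₗ[ℝ] ℝ)
    have hL : Function.Surjective L := by
      rw [← LinearMap.range_eq_top]
      by_contra hne
      obtain ⟨φ, hφ, hle⟩ := Submodule.exists_le_ker_of_lt_top _ (lt_top_iff_ne_top.2 hne)
      apply hφ
      have key : ∑ i, φ (Pi.single i 1) • fderiv ℝ (f i) a = 0 := by
        ext x
        have h0 : φ (L x) = 0 := hle ⟨x, rfl⟩
        rw [← LinearMap.sum_single_apply (φ := fun _ : κ => ℝ) (L x)] at h0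
        simp only [map_sum] at h0
        simp only [_root_.sum_apply, _root_.smul_apply, smul_eq_mul,
          _root_.zero_apply]
        rw [← h0]
        refine Finset.sum_congr rfl fun i _ => ?_
        have : (Pi.single i (L x i) : κ → ℝ)
            = (L x i) • (Pi.single i 1 : κ → ℝ) := by
          ext j; by_cases h : j = i
          · subst h; simp
          · simp [h]
        rw [this, map_smul, smul_eq_mul, mul_comm]
        rfl
      have h2 := Fintype.linearIndependent_iff.1 ha _ key
      refine LinearMap.pi_ext' fun i => ?_
      ext
      simpa using h2 i
    choose v hv using fun j : κ => hL (Pi.single j 1)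
    refine ⟨v, fun i j => ?_⟩
    have := congrFun (hv j) i
    simpa [L, Pi.single_apply] using this
  -- This determinant is analytic, equals `1` at `a`, and certifies independence wherever it is
  -- nonzero.
  let g : E → ℝ := fun x => Matrix.det (Matrix.of fun i j => fderiv ℝ (f i) x (v j))
  have hg : ContDiff ℝ ω g := by
    have h1 : ∀ i j, ContDiff ℝ ω fun x => fderiv ℝ (f i) x (v j) := fun i j =>
      ((hf i).fderiv_right (m := ω) (by simp)).clm_apply contDiff_const
    simp only [g, Matrix.det_apply, Matrix.of_apply]
    refine ContDiff.sum fun σ _ => ?_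
    refine ContDiff.const_smul _ ?_
    exact contDiff_prod fun i _ => h1 _ _
  have hga : g a ≠ 0 := by
    have : (Matrix.of fun i j => fderiv ℝ (f i) a (v j)) = (1 : Matrix κ κ ℝ) := by
      ext i j; simp [hv, Matrix.one_apply]
    simp [g, this]
  have hae := ae_ne_zero_of_analytic μ hg hga
  refine ⟨{x | g x ≠ 0}, isOpen_ne.preimage hg.continuous, Measure.dense_of_ae hae, hae, ?_⟩
  intro x hx
  rw [Fintype.linearIndependent_iff]
  intro c hc
  have h3 : c ᵥ* (Matrix.of fun i j => fderiv ℝ (f i) x (v j)) = 0 := by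
    ext j
    have := congrArg (fun φ : E →L[ℝ] ℝ => φ (v j)) hc
    simpa [Matrix.vecMul, dotProduct] using this
  have := Matrix.eq_zero_of_vecMul_eq_zero hx h3
  exact fun i => congrFun this i

end Generic
end

/-! ### Poisson brackets with constant coefficients and the completeness criterion. -/

noncomputable section

section ConstantPoisson

variable {ι : Type} [Fintype ι] [DecidableEq ι]

instance phaseIsAddHaarMeasure {ι : Type} [Fintype ι] :
    (volume : Measure (Phase ι)).IsAddHaarMeasure :=
  Measure.prod.instIsAddHaarMeasure _ _

/-- The two-form `F` has constant skew-symmetric coefficients. -/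
structure IsConstSkew (F : FormField ι) : Prop where
  const : ∀ q q', F q = F q'
  skew : ∀ q i j, F q (Pi.single i 1) (Pi.single j 1) = -F q (Pi.single j 1) (Pi.single i 1)

lemma isConstSkew_zero {ι : Type} [DecidableEq ι] : IsConstSkew (0 : FormField ι) := ⟨fun _ _ => rfl, by simp⟩

lemma phase_eq_sum (v : Phase ι) : v = ∑ i, (v.1 i • dirQ i + v.2 i • dirP i) := by
  ext j
  · simp [dirQ, dirP, Prod.fst_sum, Finset.sum_apply, Pi.single_apply]
  · simp [dirQ, dirP, Prod.snd_sum, Finset.sum_apply, Pi.single_apply]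

lemma clm_apply_phase (α : Phase ι →L[ℝ] ℝ) (v : Phase ι) :
    α v = ∑ i, (v.1 i * α (dirQ i) + v.2 i * α (dirP i)) := by
  conv_lhs => rw [phase_eq_sum v]
  simp

/-- The vector `Λ(·, β)` dual to the covector `β`. -/
def sharp (F : FormField ι) (s : Phase ι) (β : Phase ι →L[ℝ] ℝ) : Phase ι :=
  (fun i => β (dirP i),
    fun i => -β (dirQ i) + ∑ j, F s.1 (Pi.single i 1) (Pi.single j 1) * β (dirP j))

lemma poissonTensor_eq_sharp (F : FormField ι) (s : Phase ι) (α β : Phase ι →L[ℝ] ℝ) :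
    poissonTensor F s α β = α (sharp F s β) := by
  rw [clm_apply_phase α, poissonTensor, ← Finset.sum_add_distrib]
  refine Finset.sum_congr rfl fun i _ => ?_
  simp only [sharp, add_mul, Finset.sum_mul]
  rw [← add_assoc]
  congr 1
  · ring
  · exact Finset.sum_congr rfl fun j _ => by ring

/-- `sharp` as a linear map. -/
def sharpLM (F : FormField ι) (s : Phase ι) : (Phase ι →L[ℝ] ℝ) →ₗ[ℝ] Phase ι where
  toFun := sharp F s
  map_add' α β := by
    ext i
    · simp [sharp]
    · simp [sharp, mul_add, Finset.sum_add_distrib]; ring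
  map_smul' a α := by
    ext i
    · simp [sharp]
    · simp [sharp, mul_add, Finset.mul_sum, mul_left_comm]

lemma bracket_eq_sharp (F : FormField ι) (f g : Phase ι → ℝ) (s : Phase ι) :
    bracket F f g s = fderiv ℝ f s (sharp F s (fderiv ℝ g s)) :=
  poissonTensor_eq_sharp _ _ _ _

/-- The Poisson tensor as a bilinear form. -/
def poissonForm (F : FormField ι) (s : Phase ι) : LinearMap.BilinForm ℝ (Phase ι →L[ℝ] ℝ) :=
  LinearMap.mk₂ ℝ (fun α β => α (sharpLM F s β)) (by simp) (by simp) (by simp) (by simp)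

lemma poissonForm_apply (F : FormField ι) (s : Phase ι) (α β : Phase ι →L[ℝ] ℝ) :
    poissonForm F s α β = poissonTensor F s α β :=
  (poissonTensor_eq_sharp _ _ _ _).symm

lemma IsConstSkew.tensor_skew {F : FormField ι} (hF : IsConstSkew F) (s : Phase ι)
    (α β : Phase ι →L[ℝ] ℝ) : poissonTensor F s α β = -poissonTensor F s β α := by
  unfold poissonTensor
  rw [neg_add, ← Finset.sum_neg_distrib]
  congr 1
  · exact Finset.sum_congr rfl fun i _ => by ring
  · rw [Finset.sum_comm, ← Finset.sum_neg_distrib]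
    refine Finset.sum_congr rfl fun i _ => ?_
    rw [← Finset.sum_neg_distrib]
    refine Finset.sum_congr rfl fun j _ => ?_
    rw [hF.skew _ j i]; ring

lemma IsConstSkew.bracket_skew {F : FormField ι} (hF : IsConstSkew F) (f g : Phase ι → ℝ)
    (s : Phase ι) : bracket F f g s = -bracket F g f s := hF.tensor_skew _ _ _

lemma IsConstSkew.bracket_self {F : FormField ι} (hF : IsConstSkew F) (f : Phase ι → ℝ)
    (s : Phase ι) : bracket F f f s = 0 := by
  have := hF.bracket_skew f f s
  linarith

lemma IsConstSkew.isRefl {F : FormField ι} (hF : IsConstSkew F) (s : Phase ι) :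
    (poissonForm F s).IsRefl := by
  intro α β h
  rw [poissonForm_apply] at h ⊢
  rw [hF.tensor_skew, h, neg_zero]

/-- The position part of `sharp` reads off the momentum components of `β`. Once these vanish the
magnetic term disappears, and the momentum part reads off the remaining components. -/
lemma sharp_injective (F : FormField ι) (s : Phase ι) {β : Phase ι →L[ℝ] ℝ}
    (h : sharp F s β = 0) : β = 0 := by
  have h1 : ∀ i, β (dirP i) = 0 := fun i => congrFun (congrArg Prod.fst h) i
  have h2 : ∀ i, β (dirQ i) = 0 := fun i => by
    have := congrFun (congrArg Prod.snd h) i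
    simpa [sharp, h1] using this
  refine ContinuousLinearMap.ext fun v => ?_
  rw [clm_apply_phase β]
  simp [h1, h2]

lemma IsConstSkew.nondegenerate {F : FormField ι} (hF : IsConstSkew F) (s : Phase ι) :
    (poissonForm F s).Nondegenerate := by
  have key : ∀ β, (∀ α, poissonForm F s α β = 0) → β = 0 := by
    intro β h
    apply sharp_injective F s
    by_contra hne
    obtain ⟨φ, hφ⟩ := SeparatingDual.exists_ne_zero (R := ℝ) hne
    exact hφ (h φ)
  refine ⟨fun α h => key α fun β => hF.isRefl s _ _ (h β), fun β h => key β h⟩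

lemma bracket_contDiff {F : FormField ι} (hF : IsConstSkew F) {f g : Phase ι → ℝ}
    (hf : ContDiff ℝ ω f) (hg : ContDiff ℝ ω g) : ContDiff ℝ ω (bracket F f g) := by
  have h1 : ∀ {f : Phase ι → ℝ}, ContDiff ℝ ω f → ∀ v, ContDiff ℝ ω fun s => fderiv ℝ f s v :=
    fun hf v => (hf.fderiv_right (m := ω) (by simp)).clm_apply contDiff_const
  unfold bracket poissonTensor
  refine ContDiff.add (ContDiff.sum fun i _ => ?_) (ContDiff.sum fun i _ => ContDiff.sum fun j _ => ?_)
  · exact ((h1 hf _).mul (h1 hg _)).sub ((h1 hf _).mul (h1 hg _))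
  · have : ∀ s : Phase ι, F s.1 = F 0 := fun s => hF.const _ _
    simp only [this]
    exact (contDiff_const.mul (h1 hf _)).mul (h1 hg _)

/-- Constant coefficients make `sharp` one fixed linear map, so the product rule leaves only second
derivatives of `f` and `g`; skewness moves the map from one factor to the other. -/
lemma fderiv_bracket {F : FormField ι} (hF : IsConstSkew F) {f g : Phase ι → ℝ}
    (hf : ContDiff ℝ ω f) (hg : ContDiff ℝ ω g) (s v : Phase ι) :
    fderiv ℝ (bracket F f g) s v
      = fderiv ℝ (fderiv ℝ f) s v (sharp F s (fderiv ℝ g s))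
        - fderiv ℝ (fderiv ℝ g) s v (sharp F s (fderiv ℝ f s)) := by
  let P : (Phase ι →L[ℝ] ℝ) →L[ℝ] Phase ι := (sharpLM F 0).toContinuousLinearMap
  have hP : ∀ s β, sharp F s β = P β := fun s β => by
    simp [P, sharpLM, sharp, hF.const s.1 (0 : Phase ι).1]
  have h1 : ∀ {f : Phase ι → ℝ}, ContDiff ℝ ω f → HasFDerivAt (fderiv ℝ f)
      (fderiv ℝ (fderiv ℝ f) s) s := fun hf =>
    (((hf.fderiv_right (m := ω) (by simp)).differentiable (by simp)) s).hasFDerivAt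
  have hb : bracket F f g = fun s => fderiv ℝ f s (P (fderiv ℝ g s)) := by
    funext s; rw [bracket_eq_sharp, hP]
  have h2 : HasFDerivAt (fun s => P (fderiv ℝ g s)) (P.comp (fderiv ℝ (fderiv ℝ g) s)) s :=
    P.hasFDerivAt.comp s (h1 hg)
  rw [hb, ((h1 hf).clm_apply h2).fderiv, hP, hP]
  have h3 : fderiv ℝ f s (P (fderiv ℝ (fderiv ℝ g) s v))
      = -fderiv ℝ (fderiv ℝ g) s v (P (fderiv ℝ f s)) := by
    rw [← hP s, ← hP s, ← poissonTensor_eq_sharp, ← poissonTensor_eq_sharp, hF.tensor_skew]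
  simp [h3]
  ring

/-- The Jacobi identity. -/
lemma jacobi {F : FormField ι} (hF : IsConstSkew F) {f g h : Phase ι → ℝ}
    (hf : ContDiff ℝ ω f) (hg : ContDiff ℝ ω g) (hh : ContDiff ℝ ω h) (s : Phase ι) :
    bracket F (bracket F f g) h s + bracket F (bracket F g h) f s
      + bracket F (bracket F h f) g s = 0 := by
  have hsym : ∀ {f : Phase ι → ℝ}, ContDiff ℝ ω f → ∀ v w,
      fderiv ℝ (fderiv ℝ f) s v w = fderiv ℝ (fderiv ℝ f) s w v := fun hf v w =>
    (hf.contDiffAt.isSymmSndFDerivAt (by simp)) v w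
  -- Each second derivative occurs twice with opposite signs and swapped arguments, so symmetry of
  -- second derivatives cancels all terms.
  rw [bracket_eq_sharp F (bracket F f g), bracket_eq_sharp F (bracket F g h),
    bracket_eq_sharp F (bracket F h f), fderiv_bracket hF hf hg, fderiv_bracket hF hg hh,
    fderiv_bracket hF hh hf, hsym hf (sharp F s (fderiv ℝ h s)),
    hsym hg (sharp F s (fderiv ℝ h s)), hsym hh (sharp F s (fderiv ℝ f s))]
  ring

lemma bracket_zero_left (F : FormField ι) (f : Phase ι → ℝ) (s : Phase ι) :
    bracket F 0 f s = 0 := by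
  rw [bracket_eq_sharp]
  simp

/-- The functions in involution with a given one are closed under the bracket. -/
lemma bracket_bracket_eq_zero {F : FormField ι} (hF : IsConstSkew F) {f g h : Phase ι → ℝ}
    (hf : ContDiff ℝ ω f) (hg : ContDiff ℝ ω g) (hh : ContDiff ℝ ω h)
    (hfh : ∀ s, bracket F f h s = 0) (hgh : ∀ s, bracket F g h s = 0) (s : Phase ι) :
    bracket F (bracket F f g) h s = 0 := by
  have h1 : bracket F g h = 0 := funext hgh
  have h2 : bracket F h f = 0 := funext fun s => by
    rw [hF.bracket_skew, hfh]; simp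
  have := jacobi hF hf hg hh s
  rw [h1, h2, bracket_zero_left, bracket_zero_left] at this
  simpa using this

lemma lieAlg_contDiff {F : FormField ι} (hF : IsConstSkew F) {G : Set (Phase ι → ℝ)}
    (hG : ∀ f ∈ G, ContDiff ℝ ω f) {f : Phase ι → ℝ} (hf : f ∈ lieAlg F G) : ContDiff ℝ ω f := by
  change LieGen F G f at hf
  induction hf with
  | base hf => exact hG _ hf
  | zero => exact contDiff_const
  | add hf hg h1 h2 => exact h1.add h2
  | smul a hf h1 => exact h1.const_smul a
  | brk hf hg h1 h2 => exact bracket_contDiff hF h1 h2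

/-- By the Jacobi identity the analytic functions commuting with `k` form a Lie algebra, which
contains the one generated by `G` as soon as it contains `G`. -/
lemma lieAlg_bracket_eq_zero {F : FormField ι} (hF : IsConstSkew F) {G : Set (Phase ι → ℝ)}
    (hG : ∀ f ∈ G, ContDiff ℝ ω f) {k : Phase ι → ℝ} (hk : ContDiff ℝ ω k)
    (hGk : ∀ f ∈ G, ∀ s, bracket F f k s = 0) {f : Phase ι → ℝ} (hf : f ∈ lieAlg F G)
    (s : Phase ι) : bracket F f k s = 0 := by
  change LieGen F G f at hf
  induction hf generalizing s with
  | base hf => exact hGk _ hf s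
  | zero => exact bracket_zero_left _ _ _
  | @add f g hf hg h1 h2 =>
    rw [bracket_eq_sharp, fderiv_add ((lieAlg_contDiff hF hG hf).differentiable (by simp) s)
      ((lieAlg_contDiff hF hG hg).differentiable (by simp) s), _root_.add_apply,
      ← bracket_eq_sharp, ← bracket_eq_sharp, h1, h2, add_zero]
  | @smul a f hf h1 =>
    rw [bracket_eq_sharp, fderiv_const_smul ((lieAlg_contDiff hF hG hf).differentiable (by simp) s),
      _root_.smul_apply, ← bracket_eq_sharp, h1, smul_zero]
  | @brk f g hf hg h1 h2 =>
    exact bracket_bracket_eq_zero hF (lieAlg_contDiff hF hG hf) (lieAlg_contDiff hF hG hg) hk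
      h1 h2 s

/-- A Lie algebra generated by functions in involution is commutative. -/
lemma inInvolution_lieAlg {F : FormField ι} (hF : IsConstSkew F) {G : Set (Phase ι → ℝ)}
    (hG : ∀ f ∈ G, ContDiff ℝ ω f) (hGG : ∀ f ∈ G, ∀ g ∈ G, ∀ s, bracket F f g s = 0) :
    InInvolution F (lieAlg F G) := by
  intro f hf g hg s
  -- The centralizer argument is applied twice, once in each slot of the bracket.
  refine lieAlg_bracket_eq_zero hF hG (lieAlg_contDiff hF hG hg) (fun k hk s => ?_) hf s
  rw [hF.bracket_skew, lieAlg_bracket_eq_zero hF hG (hG k hk) (fun f hf s => hGG f hf k hk s) hg,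
    neg_zero]

/-- If the generators `G` of a Lie algebra of functions are in involution with functions `K`, which
are in involution with each other, and if both have generically independent differentials and are
together as many as the dimension of the phase space, then the algebra is complete. -/
theorem isCompleteAlgebra_lieAlg {F : FormField ι} (hF : IsConstSkew F) {H : Phase ι → ℝ}
    {κ μ : Type} [Fintype κ] [Fintype μ] {G : κ → Phase ι → ℝ} {K : μ → Phase ι → ℝ}
    (hG : ∀ i, ContDiff ℝ ω (G i)) (hK : ∀ j, ContDiff ℝ ω (K j))
    (hGK : ∀ i j s, bracket F (G i) (K j) s = 0) (hKK : ∀ i j s, bracket F (K i) (K j) s = 0)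
    (hH : H ∈ Set.range K)
    {a b : Phase ι} (ha : LinearIndependent ℝ fun i => fderiv ℝ (G i) a)
    (hb : LinearIndependent ℝ fun i => fderiv ℝ (K i) b)
    (hcard : Fintype.card κ + Fintype.card μ = 2 * Fintype.card ι) :
    IsCompleteAlgebra F H (lieAlg F (Set.range G)) (Fintype.card κ) (Fintype.card μ) := by
  have hG' : ∀ f ∈ Set.range G, ContDiff ℝ ω f := by rintro _ ⟨i, rfl⟩; exact hG i
  have hcomm : ∀ f ∈ lieAlg F (Set.range G), ∀ j s, bracket F f (K j) s = 0 := fun f hf j s =>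
    lieAlg_bracket_eq_zero hF hG' (hK j) (by rintro _ ⟨i, rfl⟩ s; exact hGK i j s) hf s
  have hdim : Module.finrank ℝ (Phase ι) = 2 * Fintype.card ι := by
    simp [two_mul]
  refine ⟨LieGen.zero, fun _ hf _ hg => LieGen.add hf hg, fun a _ hf => LieGen.smul a hf,
    fun _ hf _ hg => LieGen.brk hf hg, fun f hf => ⟨(lieAlg_contDiff hF hG' hf).of_le (by simp), ?_⟩,
    ?_, by rw [hdim, hcard]⟩
  · obtain ⟨j, rfl⟩ := hH
    exact hcomm f hf j
  obtain ⟨U, hUo, hUd, -, hU⟩ := exists_open_dense_linearIndependent (volume : Measure (Phase ι)) hG ha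
  obtain ⟨V, hVo, hVd, -, hV⟩ := exists_open_dense_linearIndependent (volume : Measure (Phase ι)) hK hb
  refine ⟨U ∩ V, hUo.inter hVo, hUd.inter_of_isOpen_left hVd hUo, fun s hs => ?_⟩
  have hGs := hU s hs.1
  have hKs := hV s hs.2
  set S := diffSpan (lieAlg F (Set.range G)) s with hS
  let N : Submodule ℝ (Phase ι →L[ℝ] ℝ) := Submodule.span ℝ (Set.range fun j => fderiv ℝ (K j) s)
  have hN : Module.finrank ℝ N = Fintype.card μ := finrank_span_eq_card hKs
  have hdual : Module.finrank ℝ (Phase ι →L[ℝ] ℝ) = 2 * Fintype.card ι := by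
    rw [← hdim, ← (LinearMap.toContinuousLinearMap (𝕜 := ℝ) (E := Phase ι) (F' := ℝ)).finrank_eq]
    exact Subspace.dual_finrank_eq
  -- Nondegeneracy turns the count `hcard` into the dimension of the orthogonal complement of the
  -- central differentials.
  have hNperp : Module.finrank ℝ ((poissonForm F s).orthogonal N) = Fintype.card κ := by
    rw [LinearMap.BilinForm.finrank_orthogonal (hF.nondegenerate s), hN, hdual]
    omega
  have hrefl := hF.isRefl s
  have hSle : S ≤ (poissonForm F s).orthogonal N := by
    refine Submodule.span_le.2 ?_
    rintro _ ⟨f, hf, rfl⟩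
    rw [SetLike.mem_coe, LinearMap.BilinForm.mem_orthogonal_iff]
    intro n hn
    refine hrefl _ _ ?_
    induction hn using Submodule.span_induction with
    | mem x hx =>
      obtain ⟨j, rfl⟩ := hx
      rw [poissonForm_apply]
      exact hcomm f hf j s
    | zero => simp
    | add x y _ _ hx hy => simp [hx, hy]
    | smul a x _ hx => simp [hx]
  have hSge : Submodule.span ℝ (Set.range fun i => fderiv ℝ (G i) s) ≤ S := by
    refine Submodule.span_mono ?_
    rintro _ ⟨i, rfl⟩
    exact ⟨G i, LieGen.base ⟨i, rfl⟩, rfl⟩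
  -- `S` lies in this complement and contains as many independent differentials as the complement
  -- has dimensions.
  have hSeq : S = (poissonForm F s).orthogonal N := by
    refine Submodule.eq_of_le_of_finrank_le hSle ?_
    rw [hNperp, ← finrank_span_eq_card hGs]
    exact Submodule.finrank_mono hSge
  have hNle : N ≤ S := by
    rw [hSeq]
    refine Submodule.span_le.2 ?_
    rintro _ ⟨i, rfl⟩
    rw [SetLike.mem_coe, LinearMap.BilinForm.mem_orthogonal_iff]
    intro n hn
    refine hrefl _ _ ?_
    induction hn using Submodule.span_induction with
    | mem x hx =>
      obtain ⟨j, rfl⟩ := hx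
      rw [poissonForm_apply]
      exact hKK i j s
    | zero => simp
    | add x y _ _ hx hy => simp [hx, hy]
    | smul a x _ hx => simp [hx]
  -- The kernel is `S` intersected with its orthogonal complement. Since `S` is the complement of
  -- `N`, its own complement is `N` again, and `N` lies in `S` by the involutivity of `K`.
  have hker : diffKer F (lieAlg F (Set.range G)) s = N := by
    have : {α | α ∈ S ∧ ∀ β ∈ S, poissonTensor F s α β = 0} = (N : Set (Phase ι →L[ℝ] ℝ)) := by
      ext α
      simp only [Set.mem_ofPred_eq, SetLike.mem_coe]
      constructor
      · rintro ⟨-, h⟩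
        rw [← LinearMap.BilinForm.orthogonal_orthogonal (hF.nondegenerate s) hrefl N, ← hSeq,
          LinearMap.BilinForm.mem_orthogonal_iff]
        intro β hβ
        refine hrefl _ _ ?_
        rw [poissonForm_apply]
        exact h β hβ
      · intro h
        refine ⟨hNle h, fun β hβ => ?_⟩
        rw [hSeq, LinearMap.BilinForm.mem_orthogonal_iff] at hβ
        rw [← poissonForm_apply]
        exact hβ α h
    rw [diffKer, ← hS, this, Submodule.span_eq]
  exact ⟨by rw [hSeq, hNperp], by rw [hker, hN]⟩

end ConstantPoisson
end

/-! ### The reduced system: differentials of the quadratic invariants and of the integrals. -/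

noncomputable section

section LineDerivatives

variable {E : Type*} [NormedAddCommGroup E] [NormedSpace ℝ E]

lemma fderiv_apply_of_line {f : E → ℝ} {s v : E} {d : ℝ} (hf : DifferentiableAt ℝ f s)
    (h : HasDerivAt (fun t : ℝ => f (s + t • v)) d 0) : fderiv ℝ f s v = d := by
  have h1 : HasLineDerivAt ℝ f (fderiv ℝ f s v) s v := hf.hasFDerivAt.hasLineDerivAt v
  exact HasDerivAt.unique h1 h

lemma hasDerivAt_quadratic (a b c : ℝ) : HasDerivAt (fun t : ℝ => a + t * b + t ^ 2 * c) b 0 := by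
  have h : HasDerivAt (fun t : ℝ => a + t * b + t ^ 2 * c) _ 0 :=
    (((hasDerivAt_id (0 : ℝ)).mul_const b).const_add a).add
      (((hasDerivAt_id (0 : ℝ)).pow 2).mul_const c)
  exact h.congr_deriv (by simp)

/-- The invariants restrict to polynomials of degree at most two on every line, so a derivative can
be read off as the linear coefficient of an exact expansion. -/
lemma fderiv_apply_of_quadratic {f : E → ℝ} {s v : E} {a d c : ℝ} (hf : DifferentiableAt ℝ f s)
    (h : ∀ t : ℝ, f (s + t • v) = a + t * d + t ^ 2 * c) : fderiv ℝ f s v = d := by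
  refine fderiv_apply_of_line hf ?_
  rw [funext h]
  exact hasDerivAt_quadratic a d c

end LineDerivatives

section Reduced

variable {n : ℕ}

lemma magField_skew (C : ℝ) (q v w : BI n → ℝ) : magField C q v w = -magField C q w v := by
  simp only [magField]
  rw [← mul_neg, ← Finset.sum_neg_distrib]
  congr 1
  exact Finset.sum_congr rfl fun k _ => by ring

lemma isConstSkew_magField (C : ℝ) : IsConstSkew (magField (n := n) C) :=
  ⟨fun _ _ => rfl, fun _ _ _ => magField_skew _ _ _ _⟩

section
variable (C : ℝ) (s : Phase (BI n)) (β : Phase (BI n) →L[ℝ] ℝ)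

lemma sharp_mag_fst (i : BI n) : (sharp (magField C) s β).1 i = β (dirP i) := rfl

lemma sharp_mag_inl (k : Fin n) : (sharp (magField C) s β).2 (Sum.inl k)
    = -β (dirQ (Sum.inl k)) + C * β (dirP (Sum.inr k)) := by
  simp [sharp, magField, px, py, Fintype.sum_sum_type, Pi.single_apply]

lemma sharp_mag_inr (k : Fin n) : (sharp (magField C) s β).2 (Sum.inr k)
    = -β (dirQ (Sum.inr k)) - C * β (dirP (Sum.inl k)) := by
  simp [sharp, magField, px, py, Fintype.sum_sum_type, Pi.single_apply]
  ring

end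

/-! ### The quadratic invariants -/

/-- `⟨q, q⟩`. -/
def sqQ (s : Phase (BI n)) : ℝ := s.1 ⬝ᵥ s.1

/-- `⟨p, p⟩`. -/
def sqP (s : Phase (BI n)) : ℝ := s.2 ⬝ᵥ s.2

/-- `⟨q, p⟩`. -/
def dotQP (s : Phase (BI n)) : ℝ := s.1 ⬝ᵥ s.2

/-- `ω(q, p) = qᵀ J p`. -/
def omQP (s : Phase (BI n)) : ℝ := s.1 ⬝ᵥ (Matrix.J (Fin n) ℝ *ᵥ s.2)

lemma J_mulVec (p : BI n → ℝ) : Matrix.J (Fin n) ℝ *ᵥ p = Sum.elim (-py p) (px p) := by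
  ext (k | k) <;> simp [Matrix.J, px, py, Matrix.fromBlocks_mulVec, Function.comp_def, neg_mulVec]

lemma dot_BI (a b : BI n → ℝ) : a ⬝ᵥ b = ∑ k, (px a k * px b k + py a k * py b k) := by
  simp [dotProduct, Fintype.sum_sum_type, px, py, Finset.sum_add_distrib]

lemma omQP_eq (s : Phase (BI n)) :
    omQP s = ∑ k, (py s.1 k * px s.2 k - px s.1 k * py s.2 k) := by
  rw [omQP, J_mulVec, dot_BI]
  refine Finset.sum_congr rfl fun k _ => ?_
  simp only [px, py, Sum.elim_inl, Sum.elim_inr, Pi.neg_apply]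
  ring

lemma contDiff_sqQ : ContDiff ℝ ω (sqQ (n := n)) := by
  unfold sqQ dotProduct; fun_prop
lemma contDiff_sqP : ContDiff ℝ ω (sqP (n := n)) := by
  unfold sqP dotProduct; fun_prop
lemma contDiff_dotQP : ContDiff ℝ ω (dotQP (n := n)) := by
  unfold dotQP dotProduct; fun_prop
lemma contDiff_omQP : ContDiff ℝ ω (omQP (n := n)) := by
  unfold omQP mulVec dotProduct; fun_prop

lemma contDiff_redAng (C : ℝ) (j : Fin n) : ContDiff ℝ ω (redAng C j) := by
  unfold redAng px py; fun_prop
lemma contDiff_redQuad (k : Fin (n - 1)) : ContDiff ℝ ω (redQuad k) := by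
  unfold redQuad px py; fun_prop

lemma one_add_sqQ_pos (s : Phase (BI n)) : 0 < 1 + sqQ s := by
  have : 0 ≤ sqQ s := by
    unfold sqQ dotProduct; exact Finset.sum_nonneg fun i _ => mul_self_nonneg _
  linarith

/-- The Hamiltonian is a function of three quadratic invariants, so whatever commutes with these
commutes with it. -/
lemma hamRed_eq (s : Phase (BI n)) :
    hamRed s = 1 / 2 * (sqP s - omQP s ^ 2 / (1 + sqQ s)) := rfl

lemma contDiff_hamRed : ContDiff ℝ ω (hamRed (n := n)) := by
  have : hamRed (n := n) = fun s => 1 / 2 * (sqP s - omQP s ^ 2 / (1 + sqQ s)) := rfl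
  rw [this]
  exact contDiff_const.mul (contDiff_sqP.sub ((contDiff_omQP.pow 2).div
    (contDiff_const.add contDiff_sqQ) fun s => (one_add_sqQ_pos s).ne'))

lemma omega_ne_zero' : (ω : WithTop ℕ∞) ≠ 0 := by simp

lemma fderiv_sqQ (s v : Phase (BI n)) : fderiv ℝ sqQ s v = 2 * (s.1 ⬝ᵥ v.1) := by
  refine fderiv_apply_of_quadratic (a := s.1 ⬝ᵥ s.1) (c := v.1 ⬝ᵥ v.1)
    (contDiff_sqQ.differentiable omega_ne_zero' s) fun t => ?_
  simp only [sqQ, Prod.fst_add, Prod.smul_fst, add_dotProduct, dotProduct_add, smul_dotProduct,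
    dotProduct_smul, smul_eq_mul, dotProduct_comm v.1 s.1]
  ring

lemma fderiv_sqP (s v : Phase (BI n)) : fderiv ℝ sqP s v = 2 * (s.2 ⬝ᵥ v.2) := by
  refine fderiv_apply_of_quadratic (a := s.2 ⬝ᵥ s.2) (c := v.2 ⬝ᵥ v.2)
    (contDiff_sqP.differentiable omega_ne_zero' s) fun t => ?_
  simp only [sqP, Prod.snd_add, Prod.smul_snd, add_dotProduct, dotProduct_add, smul_dotProduct,
    dotProduct_smul, smul_eq_mul, dotProduct_comm v.2 s.2]
  ring

lemma fderiv_dotQP (s v : Phase (BI n)) :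
    fderiv ℝ dotQP s v = s.1 ⬝ᵥ v.2 + s.2 ⬝ᵥ v.1 := by
  refine fderiv_apply_of_quadratic (a := s.1 ⬝ᵥ s.2) (c := v.1 ⬝ᵥ v.2)
    (contDiff_dotQP.differentiable omega_ne_zero' s) fun t => ?_
  simp only [dotQP, Prod.snd_add, Prod.smul_snd, Prod.fst_add, Prod.smul_fst, add_dotProduct,
    dotProduct_add, smul_dotProduct, dotProduct_smul, smul_eq_mul, dotProduct_comm v.1 s.2]
  ring

lemma fderiv_omQP (s v : Phase (BI n)) :
    fderiv ℝ omQP s v = ∑ k, (py v.1 k * px s.2 k + py s.1 k * px v.2 k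
      - px v.1 k * py s.2 k - px s.1 k * py v.2 k) := by
  refine fderiv_apply_of_quadratic (a := omQP s) (c := omQP v)
    (contDiff_omQP.differentiable omega_ne_zero' s) fun t => ?_
  simp only [omQP_eq, Finset.mul_sum, ← Finset.sum_add_distrib]
  refine Finset.sum_congr rfl fun k _ => ?_
  simp only [px, py, Prod.snd_add, Prod.smul_snd, Prod.fst_add, Prod.smul_fst, Pi.add_apply,
    Pi.smul_apply, smul_eq_mul]
  ring

lemma fderiv_redAng (C : ℝ) (j : Fin n) (s v : Phase (BI n)) :
    fderiv ℝ (redAng C j) s v = px v.1 j * py s.2 j + px s.1 j * py v.2 j - py v.1 j * px s.2 j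
      - py s.1 j * px v.2 j + C * (px s.1 j * px v.1 j + py s.1 j * py v.1 j) := by
  refine fderiv_apply_of_quadratic (a := redAng C j s) (c := redAng C j v)
    ((contDiff_redAng C j).differentiable omega_ne_zero' s) fun t => ?_
  simp only [redAng, px, py, Prod.snd_add, Prod.smul_snd, Prod.fst_add, Prod.smul_fst, Pi.add_apply,
    Pi.smul_apply, smul_eq_mul]
  ring

/-- Minus the imaginary part of `w_i π_j - w_j π_i`, where `w = x + i y`, `π = p_x + i p_y`. -/
def wedgeIm (i j : Fin n) (s : Phase (BI n)) : ℝ :=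
  py s.1 j * px s.2 i - px s.1 i * py s.2 j + px s.1 j * py s.2 i - py s.1 i * px s.2 j

/-- The real part of `w_i π_j - w_j π_i`, where `w = x + i y`, `π = p_x + i p_y`. -/
def wedgeRe (i j : Fin n) (s : Phase (BI n)) : ℝ :=
  px s.1 i * px s.2 j - px s.1 j * px s.2 i - py s.1 i * py s.2 j + py s.1 j * py s.2 i

/-- In complex coordinates this is the squared modulus of the minor `w_1 π_m - w_m π_1`. -/
lemma redQuad_eq (k : Fin (n - 1)) (s : Phase (BI n)) :
    redQuad k s = wedgeIm (firstPos k) (nextPos k) s ^ 2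
      + wedgeRe (firstPos k) (nextPos k) s ^ 2 := rfl

lemma fderiv_redQuad (k : Fin (n - 1)) (s v : Phase (BI n)) :
    fderiv ℝ (redQuad k) s v
      = 2 * wedgeIm (firstPos k) (nextPos k) s *
          (py v.1 (nextPos k) * px s.2 (firstPos k) + py s.1 (nextPos k) * px v.2 (firstPos k)
          - px v.1 (firstPos k) * py s.2 (nextPos k) - px s.1 (firstPos k) * py v.2 (nextPos k)
          + px v.1 (nextPos k) * py s.2 (firstPos k) + px s.1 (nextPos k) * py v.2 (firstPos k)
          - py v.1 (firstPos k) * px s.2 (nextPos k) - py s.1 (firstPos k) * px v.2 (nextPos k))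
        + 2 * wedgeRe (firstPos k) (nextPos k) s *
          (px v.1 (firstPos k) * px s.2 (nextPos k) + px s.1 (firstPos k) * px v.2 (nextPos k)
          - px v.1 (nextPos k) * px s.2 (firstPos k) - px s.1 (nextPos k) * px v.2 (firstPos k)
          - py v.1 (firstPos k) * py s.2 (nextPos k) - py s.1 (firstPos k) * py v.2 (nextPos k)
          + py v.1 (nextPos k) * py s.2 (firstPos k)
          + py s.1 (nextPos k) * py v.2 (firstPos k)) := by
  refine fderiv_apply_of_line ((contDiff_redQuad k).differentiable omega_ne_zero' s) ?_
  have key : ∀ (a b c a' b' c' : ℝ), HasDerivAt (fun t : ℝ => (a + t * b + t ^ 2 * c) ^ 2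
      + (a' + t * b' + t ^ 2 * c') ^ 2) (2 * a * b + 2 * a' * b') 0 := by
    intro a b c a' b' c'
    have h : HasDerivAt (fun t : ℝ => (a + t * b + t ^ 2 * c) ^ 2
        + (a' + t * b' + t ^ 2 * c') ^ 2) _ 0 :=
      ((hasDerivAt_quadratic a b c).pow 2).add ((hasDerivAt_quadratic a' b' c').pow 2)
    exact h.congr_deriv (by simp)
  refine (key (wedgeIm (firstPos k) (nextPos k) s) _ (wedgeIm (firstPos k) (nextPos k) v)
    (wedgeRe (firstPos k) (nextPos k) s) _ (wedgeRe (firstPos k) (nextPos k) v)).congr_of_eventuallyEq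
    (Filter.Eventually.of_forall fun t => ?_)
  simp only [redQuad_eq, wedgeIm, wedgeRe, px, py, Prod.snd_add, Prod.smul_snd, Prod.fst_add,
    Prod.smul_fst, Pi.add_apply, Pi.smul_apply, smul_eq_mul]
  ring

/-! ### The Hamiltonian vector fields of the quadratic invariants -/

lemma px_dirP_fst (i : BI n) (k : Fin n) : px (dirP i).1 k = 0 := by simp [px, dirP]
lemma py_dirP_fst (i : BI n) (k : Fin n) : py (dirP i).1 k = 0 := by simp [py, dirP]
lemma px_dirQ_snd (i : BI n) (k : Fin n) : px (dirQ i).2 k = 0 := by simp [px, dirQ]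
lemma py_dirQ_snd (i : BI n) (k : Fin n) : py (dirQ i).2 k = 0 := by simp [py, dirQ]
lemma px_dirQ_inl (i k : Fin n) : px (dirQ (Sum.inl i)).1 k = if k = i then 1 else 0 := by
  simp [px, dirQ, Pi.single_apply]
lemma px_dirQ_inr (i k : Fin n) : px (dirQ (Sum.inr i)).1 k = 0 := by
  simp [px, dirQ]
lemma py_dirQ_inr (i k : Fin n) : py (dirQ (Sum.inr i)).1 k = if k = i then 1 else 0 := by
  simp [py, dirQ, Pi.single_apply]
lemma py_dirQ_inl (i k : Fin n) : py (dirQ (Sum.inl i)).1 k = 0 := by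
  simp [py, dirQ]
lemma px_dirP_inl (i k : Fin n) : px (dirP (Sum.inl i)).2 k = if k = i then 1 else 0 := by
  simp [px, dirP, Pi.single_apply]
lemma px_dirP_inr (i k : Fin n) : px (dirP (Sum.inr i)).2 k = 0 := by
  simp [px, dirP]
lemma py_dirP_inr (i k : Fin n) : py (dirP (Sum.inr i)).2 k = if k = i then 1 else 0 := by
  simp [py, dirP, Pi.single_apply]
lemma py_dirP_inl (i k : Fin n) : py (dirP (Sum.inl i)).2 k = 0 := by
  simp [py, dirP]

section
variable (C : ℝ) (s : Phase (BI n))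

lemma phase_BI_ext {v w : Phase (BI n)} (h1 : ∀ k, px v.1 k = px w.1 k)
    (h2 : ∀ k, py v.1 k = py w.1 k) (h3 : ∀ k, px v.2 k = px w.2 k)
    (h4 : ∀ k, py v.2 k = py w.2 k) : v = w := by
  ext (k | k)
  exacts [h1 k, h2 k, h3 k, h4 k]

lemma px_sharp_fst (β : Phase (BI n) →L[ℝ] ℝ) (k : Fin n) :
    px (sharp (magField C) s β).1 k = β (dirP (Sum.inl k)) := rfl
lemma py_sharp_fst (β : Phase (BI n) →L[ℝ] ℝ) (k : Fin n) :
    py (sharp (magField C) s β).1 k = β (dirP (Sum.inr k)) := rfl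
lemma px_sharp_snd (β : Phase (BI n) →L[ℝ] ℝ) (k : Fin n) :
    px (sharp (magField C) s β).2 k = -β (dirQ (Sum.inl k)) + C * β (dirP (Sum.inr k)) :=
  sharp_mag_inl C s β k
lemma py_sharp_snd (β : Phase (BI n) →L[ℝ] ℝ) (k : Fin n) :
    py (sharp (magField C) s β).2 k = -β (dirQ (Sum.inr k)) - C * β (dirP (Sum.inl k)) :=
  sharp_mag_inr C s β k

end
end Reduced
end

/-! ### Brackets between the invariants and the integrals. -/

noncomputable section

section ReducedBrackets

variable {n : ℕ}

section
variable (s : Phase (BI n)) (k : Fin n)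

lemma sqQ_dirP_inl : fderiv ℝ sqQ s (dirP (Sum.inl k)) = 0 := by
  simp [fderiv_sqQ, dirP, px, py]
lemma sqQ_dirQ_inl : fderiv ℝ sqQ s (dirQ (Sum.inl k)) = 2 * px s.1 k := by
  simp [fderiv_sqQ, dirQ, px, py]
lemma sqP_dirP_inl : fderiv ℝ sqP s (dirP (Sum.inl k)) = 2 * px s.2 k := by
  simp [fderiv_sqP, dirP, px, py]
lemma sqP_dirQ_inl : fderiv ℝ sqP s (dirQ (Sum.inl k)) = 0 := by
  simp [fderiv_sqP, dirQ, px, py]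
lemma dotQP_dirP_inl : fderiv ℝ dotQP s (dirP (Sum.inl k)) = px s.1 k := by
  simp [fderiv_dotQP, dirP, px, py]
lemma dotQP_dirQ_inl : fderiv ℝ dotQP s (dirQ (Sum.inl k)) = px s.2 k := by
  simp [fderiv_dotQP, dirQ, px, py]
lemma sqQ_dirP_inr : fderiv ℝ sqQ s (dirP (Sum.inr k)) = 0 := by
  simp [fderiv_sqQ, dirP, px, py]
lemma sqQ_dirQ_inr : fderiv ℝ sqQ s (dirQ (Sum.inr k)) = 2 * py s.1 k := by
  simp [fderiv_sqQ, dirQ, px, py]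
lemma sqP_dirP_inr : fderiv ℝ sqP s (dirP (Sum.inr k)) = 2 * py s.2 k := by
  simp [fderiv_sqP, dirP, px, py]
lemma sqP_dirQ_inr : fderiv ℝ sqP s (dirQ (Sum.inr k)) = 0 := by
  simp [fderiv_sqP, dirQ, px, py]
lemma dotQP_dirP_inr : fderiv ℝ dotQP s (dirP (Sum.inr k)) = py s.1 k := by
  simp [fderiv_dotQP, dirP, px, py]
lemma dotQP_dirQ_inr : fderiv ℝ dotQP s (dirQ (Sum.inr k)) = py s.2 k := by
  simp [fderiv_dotQP, dirQ, px, py]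
lemma omQP_dirP_inl : fderiv ℝ omQP s (dirP (Sum.inl k)) = py s.1 k := by
  simp [fderiv_omQP, px_dirP_fst, py_dirP_fst, px_dirP_inl, py_dirP_inl]
lemma omQP_dirP_inr : fderiv ℝ omQP s (dirP (Sum.inr k)) = -px s.1 k := by
  simp [fderiv_omQP, px_dirP_fst, py_dirP_fst, px_dirP_inr, py_dirP_inr]
lemma omQP_dirQ_inl : fderiv ℝ omQP s (dirQ (Sum.inl k)) = -py s.2 k := by
  simp [fderiv_omQP, px_dirQ_snd, py_dirQ_snd, px_dirQ_inl, py_dirQ_inl]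
lemma omQP_dirQ_inr : fderiv ℝ omQP s (dirQ (Sum.inr k)) = px s.2 k := by
  simp [fderiv_omQP, px_dirQ_snd, py_dirQ_snd, px_dirQ_inr, py_dirQ_inr]

end

variable (C : ℝ) (s : Phase (BI n))

/-- The Hamiltonian field of `redAng` rotates `(x_j, y_j)` and `(p_j, p_{n+j})` simultaneously, the
term with `C` compensating exactly for the magnetic part of the bracket. The invariant is unchanged
by such a rotation; the same reason serves `sqP`, `dotQP` and `omQP`. -/
lemma redAng_sqQ (j : Fin n) : bracket (magField C) (redAng C j) sqQ s = 0 := by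
  simp only [bracket_eq_sharp, fderiv_redAng, px_sharp_fst, py_sharp_fst, px_sharp_snd,
    py_sharp_snd, sqQ_dirP_inl, sqQ_dirQ_inl, sqQ_dirP_inr, sqQ_dirQ_inr]
  ring

lemma redAng_sqP (j : Fin n) : bracket (magField C) (redAng C j) sqP s = 0 := by
  simp only [bracket_eq_sharp, fderiv_redAng, px_sharp_fst, py_sharp_fst, px_sharp_snd,
    py_sharp_snd, sqP_dirP_inl, sqP_dirQ_inl, sqP_dirP_inr, sqP_dirQ_inr]
  ring

lemma redAng_dotQP (j : Fin n) : bracket (magField C) (redAng C j) dotQP s = 0 := by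
  simp only [bracket_eq_sharp, fderiv_redAng, px_sharp_fst, py_sharp_fst, px_sharp_snd,
    py_sharp_snd, dotQP_dirP_inl, dotQP_dirQ_inl, dotQP_dirP_inr, dotQP_dirQ_inr]
  ring

lemma redAng_omQP (j : Fin n) : bracket (magField C) (redAng C j) omQP s = 0 := by
  simp only [bracket_eq_sharp, fderiv_redAng, px_sharp_fst, py_sharp_fst, px_sharp_snd,
    py_sharp_snd, omQP_dirP_inl, omQP_dirQ_inl, omQP_dirP_inr, omQP_dirQ_inr]
  ring

/-- The Hamiltonian fields of the four quadratic invariants act on each pair `(w_k, π_k)` by a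
complex matrix that does not depend on `k` and has purely imaginary trace. For `sqQ` it sends `(w,
π)` to `(0, -2w)`, for `sqP` to `(2π, -2iCπ)`. The minors are therefore multiplied by a phase, and
their moduli are preserved. This covers this bracket and the next three. -/
lemma redQuad_sqQ (k : Fin (n - 1)) : bracket (magField C) (redQuad k) sqQ s = 0 := by
  simp only [bracket_eq_sharp, fderiv_redQuad, px_sharp_fst, py_sharp_fst, px_sharp_snd,
    py_sharp_snd, sqQ_dirP_inl, sqQ_dirQ_inl, sqQ_dirP_inr, sqQ_dirQ_inr]
  ring

lemma redQuad_sqP (k : Fin (n - 1)) : bracket (magField C) (redQuad k) sqP s = 0 := by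
  simp only [bracket_eq_sharp, fderiv_redQuad, px_sharp_fst, py_sharp_fst, px_sharp_snd,
    py_sharp_snd, sqP_dirP_inl, sqP_dirQ_inl, sqP_dirP_inr, sqP_dirQ_inr, wedgeIm, wedgeRe]
  ring

lemma redQuad_dotQP (k : Fin (n - 1)) : bracket (magField C) (redQuad k) dotQP s = 0 := by
  simp only [bracket_eq_sharp, fderiv_redQuad, px_sharp_fst, py_sharp_fst, px_sharp_snd,
    py_sharp_snd, dotQP_dirP_inl, dotQP_dirQ_inl, dotQP_dirP_inr, dotQP_dirQ_inr, wedgeIm, wedgeRe]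
  ring

lemma redQuad_omQP (k : Fin (n - 1)) : bracket (magField C) (redQuad k) omQP s = 0 := by
  simp only [bracket_eq_sharp, fderiv_redQuad, px_sharp_fst, py_sharp_fst, px_sharp_snd,
    py_sharp_snd, omQP_dirP_inl, omQP_dirQ_inl, omQP_dirP_inr, omQP_dirQ_inr, wedgeIm, wedgeRe]
  ring

lemma firstPos_ne_nextPos (k : Fin (n - 1)) : firstPos k ≠ nextPos k := by
  simp [firstPos, nextPos, Fin.ext_iff]

/-- Rotating the `j`-th plane multiplies `w_j` and `π_j` by the same phase, hence multiplies the
minor by a phase or leaves it alone. -/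
lemma redQuad_redAng (k : Fin (n - 1)) (j : Fin n) :
    bracket (magField C) (redQuad k) (redAng C j) s = 0 := by
  simp only [bracket_eq_sharp, fderiv_redQuad, px_sharp_fst, py_sharp_fst, px_sharp_snd,
    py_sharp_snd, fderiv_redAng, px_dirP_fst, py_dirP_fst, px_dirP_inl, py_dirP_inl, px_dirP_inr,
    py_dirP_inr, px_dirQ_snd, py_dirQ_snd, px_dirQ_inl, py_dirQ_inl, px_dirQ_inr, py_dirQ_inr,
    wedgeIm, wedgeRe]
  have hne := firstPos_ne_nextPos k
  generalize firstPos k = o at hne ⊢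
  generalize nextPos k = m at hne ⊢
  by_cases h1 : j = o
  · subst h1
    simp only [if_true, if_neg hne]
    ring
  · by_cases h2 : j = m
    · subst h2
      simp only [if_true, if_neg h1]
      ring
    · simp only [if_neg h1, if_neg h2]
      ring

lemma redAng_redAng (i j : Fin n) :
    bracket (magField C) (redAng C i) (redAng C j) s = 0 := by
  simp only [bracket_eq_sharp, px_sharp_fst, py_sharp_fst, px_sharp_snd,
    py_sharp_snd, fderiv_redAng, px_dirP_fst, py_dirP_fst, px_dirP_inl, py_dirP_inl, px_dirP_inr,
    py_dirP_inr, px_dirQ_snd, py_dirQ_snd, px_dirQ_inl, py_dirQ_inl, px_dirQ_inr, py_dirQ_inr]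
  by_cases h1 : j = i
  · subst h1
    simp only [if_true]
    ring
  · simp only [if_neg h1]
    ring

lemma fderiv_hamRed :
    fderiv ℝ hamRed s = (1 / 2 : ℝ) • fderiv ℝ sqP s
      - (omQP s / (1 + sqQ s)) • fderiv ℝ omQP s
      + (omQP s ^ 2 / (2 * (1 + sqQ s) ^ 2)) • fderiv ℝ sqQ s := by
  have hP := (contDiff_sqP.differentiable omega_ne_zero' s).hasFDerivAt
  have hO := (contDiff_omQP.differentiable omega_ne_zero' s).hasFDerivAt
  have hQ := (contDiff_sqQ.differentiable omega_ne_zero' s).hasFDerivAt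
  have hne := (one_add_sqQ_pos s).ne'
  have h : HasFDerivAt hamRed _ s :=
    (hP.sub ((hO.pow 2).mul ((hasDerivAt_inv hne).comp_hasFDerivAt s (hQ.const_add 1)))).const_mul
      (1 / 2)
  rw [h.fderiv]
  ext v <;>
  · simp
    field_simp
    ring

/-- The Casimir function `⟨q,q⟩⟨p,p⟩ - ⟨q,p⟩² - ω(q,p)²`. -/
def casimir (s : Phase (BI n)) : ℝ := sqQ s * sqP s - dotQP s ^ 2 - omQP s ^ 2

lemma contDiff_casimir : ContDiff ℝ ω (casimir (n := n)) :=
  ((contDiff_sqQ.mul contDiff_sqP).sub (contDiff_dotQP.pow 2)).sub (contDiff_omQP.pow 2)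

lemma fderiv_casimir :
    fderiv ℝ casimir s = sqP s • fderiv ℝ sqQ s + sqQ s • fderiv ℝ sqP s
      - (2 * dotQP s) • fderiv ℝ dotQP s - (2 * omQP s) • fderiv ℝ omQP s := by
  have hP := (contDiff_sqP.differentiable omega_ne_zero' s).hasFDerivAt
  have hO := (contDiff_omQP.differentiable omega_ne_zero' s).hasFDerivAt
  have hQ := (contDiff_sqQ.differentiable omega_ne_zero' s).hasFDerivAt
  have hS := (contDiff_dotQP.differentiable omega_ne_zero' s).hasFDerivAt
  have h : HasFDerivAt casimir _ s := ((hQ.mul hP).sub (hS.pow 2)).sub (hO.pow 2)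
  rw [h.fderiv]
  ext v <;>
  · simp
    ring

variable {C s}

lemma bracket_hamRed_of {f : Phase (BI n) → ℝ}
    (hQ : bracket (magField C) f sqQ s = 0) (hP : bracket (magField C) f sqP s = 0)
    (hO : bracket (magField C) f omQP s = 0) : bracket (magField C) f hamRed s = 0 := by
  rw [bracket, ← poissonForm_apply] at *
  rw [fderiv_hamRed]
  simp [hQ, hP, hO]

lemma bracket_casimir_of {f : Phase (BI n) → ℝ}
    (hQ : bracket (magField C) f sqQ s = 0) (hP : bracket (magField C) f sqP s = 0)
    (hS : bracket (magField C) f dotQP s = 0)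
    (hO : bracket (magField C) f omQP s = 0) : bracket (magField C) f casimir s = 0 := by
  rw [bracket, ← poissonForm_apply] at *
  rw [fderiv_casimir]
  simp [hQ, hP, hS, hO]

variable (C s)

/-- First of six relations showing that the four quadratic invariants close under the bracket. They
are what makes `casimir` central. -/
lemma sqP_sqQ : bracket (magField C) sqP sqQ s = -4 * dotQP s := by
  simp only [bracket_eq_sharp, fderiv_sqP, dot_BI, px_sharp_fst, py_sharp_fst, px_sharp_snd, py_sharp_snd,
    sqQ_dirP_inl, sqQ_dirP_inr, sqQ_dirQ_inl, sqQ_dirQ_inr, dotQP, sqQ, sqP, omQP_eq, dot_BI,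
    Finset.mul_sum, ← Finset.sum_add_distrib, ← Finset.sum_sub_distrib]
  exact Finset.sum_congr rfl fun k _ => by ring

lemma dotQP_sqQ : bracket (magField C) dotQP sqQ s = -2 * sqQ s := by
  simp only [bracket_eq_sharp, fderiv_dotQP, dot_BI, px_sharp_fst, py_sharp_fst, px_sharp_snd, py_sharp_snd,
    sqQ_dirP_inl, sqQ_dirP_inr, sqQ_dirQ_inl, sqQ_dirQ_inr, dotQP, sqQ, sqP, omQP_eq, dot_BI,
    Finset.mul_sum, ← Finset.sum_add_distrib, ← Finset.sum_sub_distrib]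
  exact Finset.sum_congr rfl fun k _ => by ring

lemma dotQP_sqP : bracket (magField C) dotQP sqP s = 2 * sqP s - 2 * C * omQP s := by
  simp only [bracket_eq_sharp, fderiv_dotQP, dot_BI, px_sharp_fst, py_sharp_fst, px_sharp_snd, py_sharp_snd,
    sqP_dirP_inl, sqP_dirP_inr, sqP_dirQ_inl, sqP_dirQ_inr, dotQP, sqQ, sqP, omQP_eq, dot_BI,
    Finset.mul_sum, ← Finset.sum_add_distrib, ← Finset.sum_sub_distrib]
  exact Finset.sum_congr rfl fun k _ => by ring

lemma omQP_sqP : bracket (magField C) omQP sqP s = 2 * C * dotQP s := by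
  simp only [bracket_eq_sharp, fderiv_omQP, px_sharp_fst, py_sharp_fst, px_sharp_snd, py_sharp_snd,
    sqP_dirP_inl, sqP_dirP_inr, sqP_dirQ_inl, sqP_dirQ_inr, dotQP, sqQ, sqP, omQP_eq, dot_BI,
    Finset.mul_sum, ← Finset.sum_add_distrib, ← Finset.sum_sub_distrib]
  exact Finset.sum_congr rfl fun k _ => by ring

lemma dotQP_omQP : bracket (magField C) dotQP omQP s = -C * sqQ s := by
  simp only [bracket_eq_sharp, fderiv_dotQP, dot_BI, px_sharp_fst, py_sharp_fst, px_sharp_snd, py_sharp_snd,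
    omQP_dirP_inl, omQP_dirP_inr, omQP_dirQ_inl, omQP_dirQ_inr, dotQP, sqQ, sqP, omQP_eq, dot_BI,
    Finset.mul_sum, ← Finset.sum_add_distrib, ← Finset.sum_sub_distrib]
  exact Finset.sum_congr rfl fun k _ => by ring

lemma omQP_sqQ : bracket (magField C) omQP sqQ s = 0 := by
  simp only [bracket_eq_sharp, fderiv_omQP, px_sharp_fst, py_sharp_fst, px_sharp_snd, py_sharp_snd,
    sqQ_dirP_inl, sqQ_dirP_inr, sqQ_dirQ_inl, sqQ_dirQ_inr]
  exact Finset.sum_eq_zero fun k _ => by ring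

lemma casimir_bracket (g : Phase (BI n) → ℝ) : bracket (magField C) casimir g s
    = sqP s * bracket (magField C) sqQ g s + sqQ s * bracket (magField C) sqP g s
      - 2 * dotQP s * bracket (magField C) dotQP g s
      - 2 * omQP s * bracket (magField C) omQP g s := by
  simp only [bracket_eq_sharp, fderiv_casimir, _root_.add_apply, _root_.sub_apply,
    _root_.smul_apply, smul_eq_mul]

/-- The Casimir function commutes with each of `sqQ`, `sqP` and `omQP` by the structure relations,
hence with the Hamiltonian built from them. It is the squared area `|w|²|π|² - |⟨w, π⟩|²`, that is,
the sum of the squared moduli of all the minors `w_i π_j - w_j π_i`. -/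
lemma casimir_hamRed : bracket (magField C) casimir hamRed s = 0 := by
  have hF := isConstSkew_magField (n := n) C
  refine bracket_hamRed_of ?_ ?_ ?_ <;> rw [casimir_bracket]
  · rw [hF.bracket_self, sqP_sqQ, dotQP_sqQ, omQP_sqQ]
    ring
  · rw [hF.bracket_skew sqQ sqP, sqP_sqQ, hF.bracket_self, dotQP_sqP, omQP_sqP]
    ring
  · rw [hF.bracket_skew sqQ omQP, omQP_sqQ, hF.bracket_skew sqP omQP, omQP_sqP, dotQP_omQP,
      hF.bracket_self]
    ring

lemma redAng_hamRed (j : Fin n) : bracket (magField C) (redAng C j) hamRed s = 0 :=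
  bracket_hamRed_of (redAng_sqQ C s j) (redAng_sqP C s j) (redAng_omQP C s j)

lemma redQuad_hamRed (k : Fin (n - 1)) : bracket (magField C) (redQuad k) hamRed s = 0 :=
  bracket_hamRed_of (redQuad_sqQ C s k) (redQuad_sqP C s k) (redQuad_omQP C s k)

lemma redAng_casimir (j : Fin n) : bracket (magField C) (redAng C j) casimir s = 0 :=
  bracket_casimir_of (redAng_sqQ C s j) (redAng_sqP C s j) (redAng_dotQP C s j) (redAng_omQP C s j)

lemma redQuad_casimir (k : Fin (n - 1)) : bracket (magField C) (redQuad k) casimir s = 0 :=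
  bracket_casimir_of (redQuad_sqQ C s k) (redQuad_sqP C s k) (redQuad_dotQP C s k)
    (redQuad_omQP C s k)

lemma contDiff_intRed (i : RedIdx n) : ContDiff ℝ ω (intRed C i) := by
  cases i with
  | ham => exact contDiff_hamRed
  | ang j => exact contDiff_redAng C j
  | quad k => exact contDiff_redQuad k
  | brk l => exact bracket_contDiff (isConstSkew_magField C) (contDiff_redQuad _) (contDiff_redQuad _)

/-- The iterated brackets need no separate computation: the Jacobi identity reduces them to the
quadratic integrals. -/
lemma intRed_bracket_eq_zero {h : Phase (BI n) → ℝ} (hh : ContDiff ℝ ω h)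
    (h0 : ∀ s, bracket (magField C) hamRed h s = 0)
    (h1 : ∀ j s, bracket (magField C) (redAng C j) h s = 0)
    (h2 : ∀ k s, bracket (magField C) (redQuad k) h s = 0) (i : RedIdx n) :
    bracket (magField C) (intRed C i) h s = 0 := by
  cases i with
  | ham => exact h0 s
  | ang j => exact h1 j s
  | quad k => exact h2 k s
  | brk l =>
    exact bracket_bracket_eq_zero (isConstSkew_magField C) (contDiff_redQuad _)
      (contDiff_redQuad _) hh (h2 _) (h2 _) s

lemma intRed_hamRed (i : RedIdx n) : bracket (magField C) (intRed C i) hamRed s = 0 :=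
  intRed_bracket_eq_zero C s contDiff_hamRed (fun s => (isConstSkew_magField C).bracket_self _ s)
    (fun j s => redAng_hamRed C s j) (fun k s => redQuad_hamRed C s k) i

lemma intRed_casimir (i : RedIdx n) : bracket (magField C) (intRed C i) casimir s = 0 :=
  intRed_bracket_eq_zero C s contDiff_casimir
    (fun s => by rw [(isConstSkew_magField C).bracket_skew, casimir_hamRed, neg_zero])
    (fun j s => redAng_casimir C s j) (fun k s => redQuad_casimir C s k) i

lemma intRed_redAng (i : RedIdx n) (j : Fin n) :
    bracket (magField C) (intRed C i) (redAng C j) s = 0 :=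
  intRed_bracket_eq_zero C s (contDiff_redAng C j)
    (fun s => by rw [(isConstSkew_magField C).bracket_skew, redAng_hamRed, neg_zero])
    (fun i s => redAng_redAng C s i j) (fun k s => redQuad_redAng C s k j) i

end ReducedBrackets
end

/-! ### Independence of the reduced integrals at one explicit point. -/

noncomputable section

section ReducedIndependence

variable {n : ℕ}

lemma nextPos_injective {k k' : Fin (n - 1)} (h : nextPos k = nextPos k') : k = k' := by
  simpa [nextPos, Fin.ext_iff] using h

/-- The explicit polynomial is needed because the iterated bracket must itself be differentiated at
the base point. -/
lemma bracket_redQuad (C : ℝ) {k k' : Fin (n - 1)} (hk : k ≠ k') (s : Phase (BI n)) :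
    bracket (magField C) (redQuad k) (redQuad k') s =
      4 * ((wedgeRe (firstPos k) (nextPos k) s * wedgeRe (firstPos k) (nextPos k') s
          + wedgeIm (firstPos k) (nextPos k) s * wedgeIm (firstPos k) (nextPos k') s)
        * (px s.1 (nextPos k) * px s.2 (nextPos k') + py s.1 (nextPos k) * py s.2 (nextPos k')
          - px s.2 (nextPos k) * px s.1 (nextPos k') - py s.2 (nextPos k) * py s.1 (nextPos k')
          + C * (py s.1 (nextPos k) * px s.1 (nextPos k')
            - px s.1 (nextPos k) * py s.1 (nextPos k')))
        - (wedgeIm (firstPos k) (nextPos k) s * wedgeRe (firstPos k) (nextPos k') s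
          - wedgeRe (firstPos k) (nextPos k) s * wedgeIm (firstPos k) (nextPos k') s)
        * (py s.1 (nextPos k) * px s.2 (nextPos k') - px s.1 (nextPos k) * py s.2 (nextPos k')
          - py s.2 (nextPos k) * px s.1 (nextPos k') + px s.2 (nextPos k) * py s.1 (nextPos k')
          - C * (px s.1 (nextPos k) * px s.1 (nextPos k')
            + py s.1 (nextPos k) * py s.1 (nextPos k')))) := by
  have h0 : firstPos k' = firstPos k := rfl
  have h1 : firstPos k ≠ nextPos k := firstPos_ne_nextPos k
  have h2 : firstPos k ≠ nextPos k' := firstPos_ne_nextPos k'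
  have h3 : nextPos k ≠ nextPos k' := fun h => hk (nextPos_injective h)
  simp only [bracket_eq_sharp, px_sharp_fst, py_sharp_fst, px_sharp_snd,
    py_sharp_snd, fderiv_redQuad, px_dirP_fst, py_dirP_fst, px_dirP_inl, py_dirP_inl, px_dirP_inr,
    py_dirP_inr, px_dirQ_snd, py_dirQ_snd, px_dirQ_inl, py_dirQ_inl, px_dirQ_inr, py_dirQ_inr, h0,
    if_neg h1, if_neg h1.symm, if_neg h2, if_neg h2.symm, if_neg h3, if_neg h3.symm, if_true]
  ring

/-- The point where the differentials of the first integrals are shown to be independent. -/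
def basePt (n : ℕ) : Phase (BI n) :=
  (Sum.elim (fun k => if (k : ℕ) = 1 then 0 else 1) 0,
    Sum.elim (fun k => if (k : ℕ) ≤ 1 then 1 else 0) 0)

lemma px_basePt_fst (k : Fin n) : px (basePt n).1 k = if (k : ℕ) = 1 then 0 else 1 := rfl
lemma px_basePt_snd (k : Fin n) : px (basePt n).2 k = if (k : ℕ) ≤ 1 then 1 else 0 := rfl
lemma py_basePt_fst (k : Fin n) : py (basePt n).1 k = 0 := rfl
lemma py_basePt_snd (k : Fin n) : py (basePt n).2 k = 0 := rfl

/-- At the base point all `y`-components vanish, so `w` and `π` are real. The form `ω` is then zero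
and only the differential of the kinetic term of the Hamiltonian survives. The entries are chosen so
that the minors of the first plane with the others are `1` for the second plane and `-1` for the
later ones. -/
lemma omQP_basePt : omQP (basePt n) = 0 := by
  simp [omQP_eq, py_basePt_fst, py_basePt_snd]

lemma fderiv_hamRed_basePt (v : Phase (BI n)) :
    fderiv ℝ hamRed (basePt n) v = ∑ k : Fin n, if (k : ℕ) ≤ 1 then px v.2 k else 0 := by
  rw [fderiv_hamRed, omQP_basePt]
  simp [fderiv_sqP, dot_BI, px_basePt_snd, py_basePt_snd]

lemma fderiv_redAng_basePt (C : ℝ) (j : Fin n) (v : Phase (BI n)) :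
    fderiv ℝ (redAng C j) (basePt n) v
      = (if (j : ℕ) = 1 then 0 else py v.2 j + C * px v.1 j)
        - (if (j : ℕ) ≤ 1 then py v.1 j else 0) := by
  rw [fderiv_redAng, px_basePt_fst, px_basePt_snd, py_basePt_fst, py_basePt_snd]
  split_ifs <;> ring

/-- Variations that fix the first plane are enough, since the independence proof eliminates
coefficients from the last planes towards the first. -/
lemma fderiv_redQuad_basePt_zero (k : Fin (n - 1)) (hk : (k : ℕ) = 0) (v : Phase (BI n))
    (h1 : px v.1 (firstPos k) = 0) (h2 : py v.1 (firstPos k) = 0) (h3 : px v.2 (firstPos k) = 0)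
    (h4 : py v.2 (firstPos k) = 0) :
    fderiv ℝ (redQuad k) (basePt n) v = 2 * (px v.2 (nextPos k) - px v.1 (nextPos k)) := by
  have ha : ((firstPos k : Fin n) : ℕ) = 0 := rfl
  have hb : ((nextPos k : Fin n) : ℕ) = 1 := by simp [nextPos, hk]
  rw [fderiv_redQuad]
  simp [wedgeIm, wedgeRe, px_basePt_fst, px_basePt_snd, py_basePt_fst, py_basePt_snd, ha, hb,
    h1, h2, h3, h4]

lemma fderiv_redQuad_basePt_pos (k : Fin (n - 1)) (hk : 0 < (k : ℕ)) (v : Phase (BI n))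
    (h1 : px v.1 (firstPos k) = 0) (h2 : py v.1 (firstPos k) = 0) (h3 : px v.2 (firstPos k) = 0)
    (h4 : py v.2 (firstPos k) = 0) :
    fderiv ℝ (redQuad k) (basePt n) v = 2 * (px v.1 (nextPos k) - px v.2 (nextPos k)) := by
  have ha : ((firstPos k : Fin n) : ℕ) = 0 := rfl
  have hb : ((nextPos k : Fin n) : ℕ) ≠ 1 := by simp [nextPos]; omega
  have hc : ¬ ((nextPos k : Fin n) : ℕ) ≤ 1 := by simp [nextPos]; omega
  rw [fderiv_redQuad]
  simp [wedgeIm, wedgeRe, px_basePt_fst, px_basePt_snd, py_basePt_fst, py_basePt_snd, ha, hb,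
    h1, h2, h3, h4, hc]
  ring

lemma firstQuad_ne_nextQuad (l : Fin (n - 2)) : firstQuad l ≠ nextQuad l := by
  simp [firstQuad, nextQuad, Fin.ext_iff]

/-- When the first two planes are held fixed, the minor of these planes stays equal to `1` and the
other factors are affine in `t`, so the polynomial of `bracket_redQuad` is quadratic along the line;
`a` and `c` are its outer coefficients. -/
lemma fderiv_brk_basePt (C : ℝ) (l : Fin (n - 2)) (v : Phase (BI n))
    (hv : ∀ k : Fin n, (k : ℕ) ≤ 1 → px v.1 k = 0 ∧ py v.1 k = 0 ∧ px v.2 k = 0 ∧ py v.2 k = 0) :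
    fderiv ℝ (intRed C (.brk l)) (basePt n) v
      = -4 * (px v.2 (nextPos (nextQuad l)) - 2 * px v.1 (nextPos (nextQuad l))) := by
  have hc : ContDiff ℝ ω (intRed C (RedIdx.brk l)) := contDiff_intRed C _
  refine fderiv_apply_of_quadratic (a := 4)
    (c := -4 * (px v.1 (nextPos (nextQuad l)) * (px v.2 (nextPos (nextQuad l))
        - px v.1 (nextPos (nextQuad l))) + py v.1 (nextPos (nextQuad l)) *
        (py v.2 (nextPos (nextQuad l)) - py v.1 (nextPos (nextQuad l)))))
    (hc.differentiable omega_ne_zero' _) fun t => ?_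
  have ha : ((firstPos (firstQuad l) : Fin n) : ℕ) = 0 := rfl
  have hb : ((nextPos (firstQuad l) : Fin n) : ℕ) = 1 := rfl
  have hd : ((nextPos (nextQuad l) : Fin n) : ℕ) ≠ 1 := by simp [nextPos, nextQuad]
  have he : ¬ ((nextPos (nextQuad l) : Fin n) : ℕ) ≤ 1 := by simp [nextPos, nextQuad]
  have e1 : ∀ k, px (basePt n + t • v).1 k = px (basePt n).1 k + t * px v.1 k := fun _ => rfl
  have e2 : ∀ k, py (basePt n + t • v).1 k = py (basePt n).1 k + t * py v.1 k := fun _ => rfl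
  have e3 : ∀ k, px (basePt n + t • v).2 k = px (basePt n).2 k + t * px v.2 k := fun _ => rfl
  have e4 : ∀ k, py (basePt n + t • v).2 k = py (basePt n).2 k + t * py v.2 k := fun _ => rfl
  obtain ⟨a1, a2, a3, a4⟩ := hv _ (ha.trans_le zero_le_one)
  obtain ⟨b1, b2, b3, b4⟩ := hv _ hb.le
  rw [intRed, bracket_redQuad C (firstQuad_ne_nextQuad l)]
  simp only [wedgeIm, wedgeRe, e1, e2, e3, e4, px_basePt_fst, px_basePt_snd, py_basePt_fst,
    py_basePt_snd, ha, hb, if_neg hd, if_neg he, a1, a2, a3, a4, b1, b2, b3, b4]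
  norm_num
  ring

/-- The indices of the first integrals of the reduced system as a sum type. -/
def redIdxEquiv (n : ℕ) : (Unit ⊕ Fin n) ⊕ (Fin (n - 1) ⊕ Fin (n - 2)) ≃ RedIdx n where
  toFun
    | .inl (.inl _) => .ham
    | .inl (.inr j) => .ang j
    | .inr (.inl k) => .quad k
    | .inr (.inr l) => .brk l
  invFun
    | .ham => .inl (.inl ())
    | .ang j => .inl (.inr j)
    | .quad k => .inr (.inl k)
    | .brk l => .inr (.inr l)
  left_inv := by rintro ((_ | _) | (_ | _)) <;> rfl
  right_inv := by rintro (_ | _ | _ | _) <;> rfl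

instance fintypeRedIdx : Fintype (RedIdx n) := Fintype.ofEquiv _ (redIdxEquiv n)

lemma card_redIdx : Fintype.card (RedIdx n) = 1 + n + ((n - 1) + (n - 2)) := by
  rw [← Fintype.card_congr (redIdxEquiv n)]
  simp

lemma sum_redIdx (f : RedIdx n → ℝ) :
    ∑ i, f i = f .ham + ∑ j, f (.ang j) + (∑ k, f (.quad k) + ∑ l, f (.brk l)) := by
  rw [← (redIdxEquiv n).sum_comp]
  simp [Fintype.sum_sum_type, redIdxEquiv]

/-- Triangular elimination. In a plane of index at least two, the three partial derivatives in `x`,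
`p_x` and `p_y` see only the coefficients of one angular, one quadratic and one iterated integral;
`p_y` isolates the angular one, and the other two equations have the coefficient rows `(2, 8)` and
`(-2, -4)`. The second plane then removes the first quadratic integral and its own angular one. The
first plane settles the Hamiltonian and the last angular integral. -/
lemma linearIndependent_intRed_basePt (hn : 1 ≤ n) (C : ℝ) :
    LinearIndependent ℝ fun i => fderiv ℝ (intRed (n := n) C i) (basePt n) := by
  rw [Fintype.linearIndependent_iff]
  intro c hc
  have H : ∀ v : Phase (BI n), c .ham * fderiv ℝ hamRed (basePt n) v
      + ∑ j, c (.ang j) * fderiv ℝ (redAng C j) (basePt n) v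
      + (∑ k, c (.quad k) * fderiv ℝ (redQuad k) (basePt n) v
        + ∑ l, c (.brk l) * fderiv ℝ (intRed C (.brk l)) (basePt n) v) = 0 := by
    intro v
    have h := congrArg (fun φ : Phase (BI n) →L[ℝ] ℝ => φ v) hc
    simp only [_root_.sum_apply, _root_.smul_apply, smul_eq_mul, _root_.zero_apply] at h
    rw [sum_redIdx] at h
    exact h
  have hfirst : ∀ (m : Fin n) (k : Fin (n - 1)), 1 ≤ (m : ℕ) → firstPos k ≠ m := by
    intro m k hm h
    have := congrArg Fin.val h
    simp [firstPos] at this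
    omega
  -- positions at least two
  have key : ∀ l : Fin (n - 2), c (.ang (nextPos (nextQuad l))) = 0 ∧ c (.quad (nextQuad l)) = 0
      ∧ c (.brk l) = 0 := by
    intro l
    set m : Fin n := nextPos (nextQuad l) with hm
    have hm2 : (m : ℕ) = l + 2 := by simp [hm, nextPos, nextQuad]
    have hv : ∀ d ∈ ({dirQ (Sum.inl m), dirP (Sum.inl m), dirP (Sum.inr m)} : Set (Phase (BI n))),
        c (.ang m) * (py d.2 m + C * px d.1 m) + (c (.quad (nextQuad l)) * (2 * (px d.1 m - px d.2 m))
          + c (.brk l) * (-4 * (px d.2 m - 2 * px d.1 m))) = 0 := by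
      intro d hd
      have hz : ∀ k : Fin n, k ≠ m → px d.1 k = 0 ∧ py d.1 k = 0 ∧ px d.2 k = 0 ∧ py d.2 k = 0 := by
        intro k hk
        rcases hd with rfl | rfl | rfl <;>
        simp [px_dirP_fst, py_dirP_fst, px_dirP_inl, py_dirP_inl, px_dirP_inr,
          py_dirP_inr, px_dirQ_snd, py_dirQ_snd, px_dirQ_inl, py_dirQ_inl, hk]
      have hle : ∀ k : Fin n, (k : ℕ) ≤ 1 → k ≠ m := by
        rintro k hk rfl; omega
      rw [← H d]
      have t0 : fderiv ℝ hamRed (basePt n) d = 0 := by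
        rw [fderiv_hamRed_basePt]
        refine Finset.sum_eq_zero fun k _ => ?_
        split_ifs with h
        · exact (hz k (hle k h)).2.2.1
        · rfl
      have t1 : ∑ j, c (.ang j) * fderiv ℝ (redAng C j) (basePt n) d
          = c (.ang m) * (py d.2 m + C * px d.1 m) := by
        rw [Finset.sum_eq_single m]
        · rw [fderiv_redAng_basePt, if_neg (by omega), if_neg (by omega), sub_zero]
        · intro j _ hj
          rw [fderiv_redAng_basePt]
          simp [hz j hj]
        · simp
      have t2 : ∑ k, c (.quad k) * fderiv ℝ (redQuad k) (basePt n) d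
          = c (.quad (nextQuad l)) * (2 * (px d.1 m - px d.2 m)) := by
        have hf : ∀ k : Fin (n - 1), firstPos k ≠ m := fun k => hfirst m k (by omega)
        rw [Finset.sum_eq_single (nextQuad l)]
        · obtain ⟨h1, h2, h3, h4⟩ := hz _ (hf (nextQuad l))
          rw [fderiv_redQuad_basePt_pos _ (by simp [nextQuad]) d h1 h2 h3 h4]
        · intro k _ hk
          obtain ⟨h1, h2, h3, h4⟩ := hz _ (hf k)
          have hk' : nextPos k ≠ m := fun h => hk (nextPos_injective h)
          obtain ⟨g1, -, g3, -⟩ := hz _ hk'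
          rcases Nat.eq_zero_or_pos (k : ℕ) with h0 | h0
          · rw [fderiv_redQuad_basePt_zero _ h0 d h1 h2 h3 h4, g1, g3]; simp
          · rw [fderiv_redQuad_basePt_pos _ h0 d h1 h2 h3 h4, g1, g3]; simp
        · simp
      have t3 : ∑ l, c (.brk l) * fderiv ℝ (intRed C (.brk l)) (basePt n) d
          = c (.brk l) * (-4 * (px d.2 m - 2 * px d.1 m)) := by
        have hd' := fun (k : Fin n) hk => hz k (hle k hk)
        rw [Finset.sum_eq_single l]
        · rw [fderiv_brk_basePt C l d hd']
        · intro l' _ hl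
          have hk' : nextPos (nextQuad l') ≠ m := by
            intro h
            apply hl
            have := congrArg Fin.val h
            ext
            simp [nextPos, nextQuad, hm] at this
            omega
          obtain ⟨g1, -, g3, -⟩ := hz _ hk'
          rw [fderiv_brk_basePt C l' d hd', g1, g3]; simp
        · simp
      rw [t0, t1, t2, t3]
      ring
    have h1 := hv (dirQ (Sum.inl m)) (by simp)
    have h2 := hv (dirP (Sum.inl m)) (by simp)
    have h3 := hv (dirP (Sum.inr m)) (by simp)
    simp only [px_dirP_fst, px_dirP_inl, py_dirP_inl, px_dirP_inr,
          py_dirP_inr, px_dirQ_snd, py_dirQ_snd, px_dirQ_inl, if_true] at h1 h2 h3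
    have e1 : c (.ang m) = 0 := by linarith
    rw [e1] at h1 h2
    refine ⟨e1, ?_, ?_⟩ <;> linarith
  have hang2 : ∀ j : Fin n, 2 ≤ (j : ℕ) → c (.ang j) = 0 := by
    intro j hj
    have : j = nextPos (nextQuad (⟨j - 2, by omega⟩ : Fin (n - 2))) := by
      ext; simp [nextPos, nextQuad]; omega
    rw [this]
    exact (key _).1
  have hquad1 : ∀ k : Fin (n - 1), 1 ≤ (k : ℕ) → c (.quad k) = 0 := by
    intro k hk
    have : k = nextQuad (⟨k - 1, by omega⟩ : Fin (n - 2)) := by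
      ext; simp [nextQuad]; omega
    rw [this]
    exact (key _).2.1
  have hbrk : ∀ l, c (.brk l) = 0 := fun l => (key l).2.2
  have H' : ∀ v : Phase (BI n), c .ham * fderiv ℝ hamRed (basePt n) v
      + ∑ j, c (.ang j) * fderiv ℝ (redAng C j) (basePt n) v
      + ∑ k, c (.quad k) * fderiv ℝ (redQuad k) (basePt n) v = 0 := by
    intro v
    rw [← H v]
    simp [hbrk]
  -- the second position
  have hsecond : (∀ k, c (.quad k) = 0) ∧ (∀ j : Fin n, (j : ℕ) = 1 → c (.ang j) = 0)
      ∧ (2 ≤ n → c .ham = 0) := by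
    -- For `n = 1` there is no second plane and the claims are vacuous.
    rcases Nat.lt_or_ge n 2 with h2 | h2
    · exact ⟨fun k => absurd k.2 (by omega), fun j hj => absurd j.2 (by omega), fun h => by omega⟩
    set m : Fin n := ⟨1, h2⟩ with hm
    set k0 : Fin (n - 1) := ⟨0, by omega⟩ with hk0
    have hmk : nextPos k0 = m := rfl
    have hv : ∀ d ∈ ({dirQ (Sum.inl m), dirP (Sum.inl m), dirQ (Sum.inr m)} : Set (Phase (BI n))),
        c .ham * px d.2 m - c (.ang m) * py d.1 m
          + c (.quad k0) * (2 * (px d.2 m - px d.1 m)) = 0 := by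
      intro d hd
      have hz : ∀ k : Fin n, k ≠ m → px d.1 k = 0 ∧ py d.1 k = 0 ∧ px d.2 k = 0 ∧ py d.2 k = 0 := by
        intro k hk
        rcases hd with rfl | rfl | rfl <;>
        simp [px_dirP_fst, py_dirP_fst, px_dirP_inl, py_dirP_inl, px_dirQ_inr,
          py_dirQ_inr, px_dirQ_snd, py_dirQ_snd, px_dirQ_inl, py_dirQ_inl, hk]
      rw [← H' d]
      have t0 : fderiv ℝ hamRed (basePt n) d = px d.2 m := by
        rw [fderiv_hamRed_basePt, Finset.sum_eq_single m]
        · simp [hm]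
        · intro k _ hk
          simp [hz k hk]
        · simp
      have t1 : ∑ j, c (.ang j) * fderiv ℝ (redAng C j) (basePt n) d
          = -(c (.ang m) * py d.1 m) := by
        rw [Finset.sum_eq_single m]
        · rw [fderiv_redAng_basePt]; simp [hm]
        · intro j _ hj
          rw [fderiv_redAng_basePt]
          simp [hz j hj]
        · simp
      have t2 : ∑ k, c (.quad k) * fderiv ℝ (redQuad k) (basePt n) d
          = c (.quad k0) * (2 * (px d.2 m - px d.1 m)) := by
        rw [Finset.sum_eq_single k0]
        · obtain ⟨h1, h2, h3, h4⟩ := hz _ (hfirst m k0 le_rfl)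
          rw [fderiv_redQuad_basePt_zero _ rfl d h1 h2 h3 h4, hmk]
        · intro k _ hk
          rw [hquad1 k, zero_mul]
          by_contra h
          apply hk
          ext
          simp [hk0]
          omega
        · simp
      rw [t0, t1, t2]
      ring
    have h1 := hv (dirQ (Sum.inl m)) (by simp)
    have h2 := hv (dirP (Sum.inl m)) (by simp)
    have h3 := hv (dirQ (Sum.inr m)) (by simp)
    simp only [px_dirP_fst, px_dirP_inl, py_dirP_fst, py_dirQ_inl, px_dirQ_inr,
          py_dirQ_inr, px_dirQ_snd, px_dirQ_inl, if_true] at h1 h2 h3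
    have e1 : c (.quad k0) = 0 := by linarith
    rw [e1] at h2
    refine ⟨fun k => ?_, fun j hj => ?_, fun _ => by linarith⟩
    · rcases Nat.eq_zero_or_pos (k : ℕ) with h0 | h0
      · have : k = k0 := by ext; exact h0
        rw [this, e1]
      · exact hquad1 k h0
    · have : j = m := by ext; exact hj
      rw [this]
      linarith
  obtain ⟨hquad, hang1, hham2⟩ := hsecond
  -- the first position
  set o : Fin n := ⟨0, hn⟩ with ho
  have H'' : ∀ v : Phase (BI n), c .ham * fderiv ℝ hamRed (basePt n) v
      + c (.ang o) * fderiv ℝ (redAng C o) (basePt n) v = 0 := by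
    intro v
    rw [← H' v, Finset.sum_eq_single o]
    · simp [hquad]
    · intro j _ hj
      have hj0 : (j : ℕ) ≠ 0 := fun h => hj (by ext; exact h)
      rcases Nat.lt_or_ge (j : ℕ) 2 with h | h
      · rw [hang1 j (by omega), zero_mul]
      · rw [hang2 j h, zero_mul]
    · simp
  have h1 := H'' (dirP (Sum.inl o))
  have h2 := H'' (dirP (Sum.inr o))
  rw [fderiv_hamRed_basePt, fderiv_redAng_basePt] at h1 h2
  simp [px_dirP_fst, px_dirP_inl, py_dirP_fst, py_dirP_inl, px_dirP_inr, py_dirP_inr, ho] at h1 h2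
  have hham : c .ham = 0 := by
    rw [Finset.sum_eq_single o] at h1
    · simpa [ho] using h1
    · intro j _ hj
      simp [show j ≠ ⟨0, hn⟩ from hj]
    · simp
  rintro (_ | j | k | l)
  · exact hham
  · rcases Nat.lt_or_ge (j : ℕ) 2 with h | h
    · rcases Nat.eq_zero_or_pos (j : ℕ) with h0 | h0
      · have : j = o := by ext; exact h0
        rw [this, ho]
        exact h2
      · exact hang1 j (by omega)
    · exact hang2 j h
  · exact hquad k
  · exact hbrk l

end ReducedIndependence
end

/-! ### Complete integrability of the reduced system. -/

noncomputable section

section ReducedIntegrability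

variable {n : ℕ}

/-- The first integrals which are in involution with all the others: the Hamiltonian, the Casimir
function and the integrals linear in the momenta. -/
def centralRed (C : ℝ) : Option (Option (Fin n)) → Phase (BI n) → ℝ
  | none => hamRed
  | some none => casimir
  | some (some j) => redAng C j

lemma contDiff_centralRed (C : ℝ) (j : Option (Option (Fin n))) :
    ContDiff ℝ ω (centralRed C j) := by
  rcases j with _ | _ | j
  exacts [contDiff_hamRed, contDiff_casimir, contDiff_redAng C j]

lemma intRed_centralRed (C : ℝ) (i : RedIdx n) (j : Option (Option (Fin n))) (s : Phase (BI n)) :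
    bracket (magField C) (intRed C i) (centralRed C j) s = 0 := by
  rcases j with _ | _ | j
  exacts [intRed_hamRed C s i, intRed_casimir C s i, intRed_redAng C s i j]

lemma centralRed_centralRed (C : ℝ) (i j : Option (Option (Fin n))) (s : Phase (BI n)) :
    bracket (magField C) (centralRed C i) (centralRed C j) s = 0 := by
  have hF := isConstSkew_magField (n := n) C
  rcases i with _ | _ | i
  · exact intRed_centralRed C .ham j s
  · rcases j with _ | _ | j
    · exact casimir_hamRed C s
    · exact hF.bracket_self _ _
    · rw [hF.bracket_skew]
      exact neg_eq_zero.2 (redAng_casimir C s j)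
  · exact intRed_centralRed C (.ang i) j s

lemma sqP_basePt (hn : 2 ≤ n) : sqP (basePt n) ≠ 0 := by
  have : 0 < sqP (basePt n) := by
    rw [sqP, dot_BI]
    refine Finset.sum_pos' (fun k _ => add_nonneg (mul_self_nonneg _) (mul_self_nonneg _)) ⟨⟨0, by omega⟩, Finset.mem_univ _, ?_⟩
    simp [px_basePt_snd, py_basePt_snd]
  exact this.ne'

/-- The derivatives in `p_y`, or in `y` for the second plane, isolate the angular integrals. The
third plane, available for `n > 2`, then separates the Casimir function from the Hamiltonian. -/
lemma linearIndependent_centralRed_basePt (hn : 2 < n) (C : ℝ) :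
    LinearIndependent ℝ fun i => fderiv ℝ (centralRed (n := n) C i) (basePt n) := by
  rw [Fintype.linearIndependent_iff]
  intro c hc
  have H : ∀ v : Phase (BI n), c none * fderiv ℝ hamRed (basePt n) v
      + (c (some none) * fderiv ℝ casimir (basePt n) v
      + ∑ j, c (some (some j)) * fderiv ℝ (redAng C j) (basePt n) v) = 0 := by
    intro v
    have h := congrArg (fun φ : Phase (BI n) →L[ℝ] ℝ => φ v) hc
    simp only [_root_.sum_apply, _root_.smul_apply, smul_eq_mul, _root_.zero_apply] at h
    rw [Fintype.sum_option, Fintype.sum_option] at h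
    exact h
  have hcas : ∀ v : Phase (BI n), fderiv ℝ casimir (basePt n) v
      = sqP (basePt n) * (2 * ((basePt n).1 ⬝ᵥ v.1)) + sqQ (basePt n) * (2 * ((basePt n).2 ⬝ᵥ v.2))
        - 2 * dotQP (basePt n) * ((basePt n).1 ⬝ᵥ v.2 + (basePt n).2 ⬝ᵥ v.1) := by
    intro v
    rw [fderiv_casimir, omQP_basePt]
    simp [fderiv_sqQ, fderiv_sqP, fderiv_dotQP]
  have hang : ∀ j : Fin n, c (some (some j)) = 0 := by
    intro j
    by_cases hj : (j : ℕ) = 1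
    · have h := H (dirQ (Sum.inr j))
      rw [Finset.sum_eq_single j, hcas, fderiv_hamRed_basePt] at h
      · simp [dot_BI, fderiv_redAng_basePt, px_dirQ_inr, py_dirQ_inr, px_dirQ_snd, py_dirQ_snd, hj,
          py_basePt_fst, py_basePt_snd] at h
        exact h
      · intro k _ hk
        rw [fderiv_redAng_basePt]
        simp [px_dirQ_inr, py_dirQ_inr, py_dirQ_snd, hk]
      · simp
    · have h := H (dirP (Sum.inr j))
      rw [Finset.sum_eq_single j, hcas, fderiv_hamRed_basePt] at h
      · simp [dot_BI, fderiv_redAng_basePt, px_dirP_inr, py_dirP_inr, px_dirP_fst, py_dirP_fst, hj,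
          py_basePt_fst, py_basePt_snd] at h
        exact h
      · intro k _ hk
        rw [fderiv_redAng_basePt]
        simp [py_dirP_inr, px_dirP_fst, py_dirP_fst, hk]
      · simp
  -- At the base point the third plane carries nonzero position and zero momentum, so moving `x_3`
  -- changes the Casimir function at the rate `2 * sqP` and leaves the Hamiltonian stationary.
  have hc1 : c (some none) = 0 := by
    have h := H (dirQ (Sum.inl ⟨2, hn⟩))
    rw [hcas, fderiv_hamRed_basePt] at h
    simpa [hang, dot_BI, px_dirQ_inl, py_dirQ_inl, px_dirQ_snd, py_dirQ_snd, px_basePt_fst,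
      px_basePt_snd, sqP_basePt hn.le] using h
  have hc0 : c none = 0 := by
    have h := H (dirP (Sum.inl ⟨0, by omega⟩))
    rw [fderiv_hamRed_basePt, Finset.sum_eq_single ⟨0, by omega⟩] at h
    · simpa [hang, hc1, px_dirP_inl] using h
    · intro k _ hk
      simp [px_dirP_inl, hk]
    · simp
  rintro (_ | _ | j)
  exacts [hc0, hc1, hang j]

lemma quad_subsingleton (hn : n ≤ 2) (k k' : Fin (n - 1)) : k = k' := by
  ext; omega

/-- At most one quadratic integral and no iterated bracket exist here, and everything else already
commutes. -/
lemma intRed_intRed_of_le_two (hn : n ≤ 2) (C : ℝ) (i j : RedIdx n) (s : Phase (BI n)) :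
    bracket (magField C) (intRed C i) (intRed C j) s = 0 := by
  have hF := isConstSkew_magField (n := n) C
  cases j with
  | ham => exact intRed_hamRed C s i
  | ang j => exact intRed_redAng C s i j
  | quad k =>
    refine intRed_bracket_eq_zero C s (contDiff_redQuad k) (fun s => ?_) (fun j s => ?_)
      (fun k' s => ?_) i
    · rw [hF.bracket_skew, redQuad_hamRed, neg_zero]
    · rw [hF.bracket_skew, redQuad_redAng, neg_zero]
    · rw [quad_subsingleton hn k' k, hF.bracket_self]
  | brk l => exact absurd l.2 (by omega)

lemma isFirstIntegral_intRed (C : ℝ) (i : RedIdx n) :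
    IsFirstIntegral (magField C) hamRed (intRed C i) :=
  ⟨(contDiff_intRed C i).of_le (by simp), fun s => intRed_hamRed C s i⟩

lemma independentAE_of_linearIndependent {ι κ : Type} [Fintype ι] [DecidableEq ι] [Finite κ]
    {f : κ → Phase ι → ℝ} (hf : ∀ i, ContDiff ℝ ω (f i)) {a : Phase ι}
    (ha : LinearIndependent ℝ fun i => fderiv ℝ (f i) a) : IndependentAE f := by
  obtain ⟨U, -, -, hU, h⟩ :=
    exists_open_dense_linearIndependent (volume : Measure (Phase ι)) hf ha
  exact hU.mono h

lemma independentAE_intRed (hn : 1 ≤ n) (C : ℝ) : IndependentAE (intRed (n := n) C) :=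
  independentAE_of_linearIndependent (contDiff_intRed C) (linearIndependent_intRed_basePt hn C)

/-- The reduced system is Liouville integrable for `n ≤ 2`. -/
theorem reduced_integrable_of_le_two (hn : 1 ≤ n) (h2 : n ≤ 2) (C : ℝ) :
    InInvolution (magField C) (lieAlg (magField C) (Set.range (intRed (n := n) C))) ∧
    IsCompleteAlgebra (magField C) hamRed
      (lieAlg (magField C) (Set.range (intRed (n := n) C))) (2 * n) (2 * n) := by
  have hcard : Fintype.card (RedIdx n) = 2 * n := by rw [card_redIdx]; omega
  have hli := linearIndependent_intRed_basePt hn C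
  have hcomm := intRed_intRed_of_le_two h2 C
  constructor
  · refine inInvolution_lieAlg (isConstSkew_magField C) ?_ ?_
    · rintro _ ⟨i, rfl⟩
      exact contDiff_intRed C i
    · rintro _ ⟨i, rfl⟩ _ ⟨j, rfl⟩ s
      exact hcomm i j s
  · have := isCompleteAlgebra_lieAlg (isConstSkew_magField C) (contDiff_intRed C)
      (contDiff_intRed C) hcomm hcomm (H := hamRed) ⟨.ham, rfl⟩ hli hli
      (by rw [hcard]; simp; ring)
    rwa [hcard] at this

/-- The reduced system is integrable in the non-commutative sense for `n > 2`. -/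
theorem reduced_integrable_of_two_lt (h2 : 2 < n) (C : ℝ) :
    ¬ InInvolution (magField C) (Set.range (intRed (n := n) C)) ∧
    IsCompleteAlgebra (magField C) hamRed
      (lieAlg (magField C) (Set.range (intRed (n := n) C))) (3 * n - 2) (n + 2) := by
  have hli := linearIndependent_intRed_basePt (by omega : 1 ≤ n) C
  constructor
  · intro h
    -- If the integrals commuted, the iterated bracket would be the zero function, yet its
    -- differential is a member of an independent family.
    have hne := hli.ne_zero (.brk ⟨0, by omega⟩)
    apply hne
    have h0 : intRed (n := n) C (.brk ⟨0, by omega⟩) = 0 :=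
      funext fun s => h _ ⟨.quad _, rfl⟩ _ ⟨.quad _, rfl⟩ s
    rw [h0]
    simp
  · have hcard : Fintype.card (RedIdx n) = 3 * n - 2 := by rw [card_redIdx]; omega
    have hcard' : Fintype.card (Option (Option (Fin n))) = n + 2 := by simp
    have := isCompleteAlgebra_lieAlg (isConstSkew_magField C) (contDiff_intRed C)
      (contDiff_centralRed C) (intRed_centralRed C) (centralRed_centralRed C) (H := hamRed)
      ⟨none, rfl⟩ hli (linearIndependent_centralRed_basePt h2 C)
      (by rw [hcard, hcard']; simp; omega)
    rwa [hcard, hcard'] at this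

end ReducedIntegrability
end

/-! ### Reduction by the central translations and lifting to the full phase space. -/

noncomputable section

section Reduction

variable {n : ℕ}

/-- The differential of `reduceMap`. -/
def reduceDiff (s v : Phase (HI n)) : Phase (BI n) :=
  (bar v.1, Sum.elim (px (bar v.2) + pz s.2 • py (bar v.1) + pz v.2 • py (bar s.1)) (py (bar v.2)))

lemma contDiff_reduceMap : ContDiff ℝ ω (reduceMap (n := n)) := by
  refine ContDiff.prodMk ?_ ?_
  · unfold bar; fun_prop
  · rw [contDiff_pi]
    rintro (k | k)
    · simp only [Sum.elim_inl, Pi.add_apply, Pi.smul_apply, smul_eq_mul, bar, px, py, pz]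
      fun_prop
    · simp only [Sum.elim_inr, bar, py]
      fun_prop

/-- The product of `λ_{2n+1}` with `y` is the only nonlinear term. Its second-order part carries the
factor `pz v.2`, so lines inside a level project to lines. -/
lemma reduceMap_line (s v : Phase (HI n)) (t : ℝ) :
    reduceMap (s + t • v) = reduceMap s + t • reduceDiff s v
      + t ^ 2 • ((0, Sum.elim (pz v.2 • py (bar v.1)) 0) : Phase (BI n)) := by
  refine phase_BI_ext (fun k => ?_) (fun k => ?_) (fun k => ?_) fun k => ?_ <;>
    simp [reduceMap, reduceDiff, px, py, pz, bar]
  ring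

lemma fderiv_reduceMap (s v : Phase (HI n)) : fderiv ℝ reduceMap s v = reduceDiff s v := by
  have hd := (contDiff_reduceMap (n := n)).differentiable omega_ne_zero' s
  have h1 : HasLineDerivAt ℝ reduceMap (fderiv ℝ reduceMap s v) s v :=
    hd.hasFDerivAt.hasLineDerivAt v
  refine HasDerivAt.unique h1 ?_
  rw [funext (reduceMap_line s v)]
  have h : HasDerivAt (fun t : ℝ => reduceMap s + t • reduceDiff s v
      + t ^ 2 • ((0, Sum.elim (pz v.2 • py (bar v.1)) 0) : Phase (BI n))) _ 0 :=
    (((hasDerivAt_id (0 : ℝ)).smul_const (reduceDiff s v)).const_add (reduceMap s)).add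
      (((hasDerivAt_id (0 : ℝ)).pow 2).smul_const _)
  exact h.congr_deriv (by simp)

/-- The function `F` on the phase space of the full system restricts to `f C` on the level
`λ_{2n+1} = C`. -/
structure IsLift (F : Phase (HI n) → ℝ) (f : ℝ → Phase (BI n) → ℝ) : Prop where
  contDiff : ContDiff ℝ ω F
  contDiff_red : ∀ C, ContDiff ℝ ω (f C)
  eq : ∀ s, F s = f (pz s.2) (reduceMap s)

/-- A direction with no central momentum component keeps the whole line in the level, where `F` and
the pullback of `f` coincide. -/
lemma fderiv_of_eq_on_level {F : Phase (HI n) → ℝ} {f : Phase (BI n) → ℝ} {s v : Phase (HI n)}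
    (hF : DifferentiableAt ℝ F s) (hf : DifferentiableAt ℝ f (reduceMap s))
    (h : ∀ s', pz s'.2 = pz s.2 → F s' = f (reduceMap s')) (hv : pz v.2 = 0) :
    fderiv ℝ F s v = fderiv ℝ f (reduceMap s) (reduceDiff s v) := by
  refine fderiv_apply_of_line hF ?_
  have h1 : (fun t : ℝ => F (s + t • v)) = fun t => f (reduceMap s + t • reduceDiff s v) := by
    funext t
    rw [h _ (by rw [Prod.snd_add, Prod.smul_snd]; simp only [pz] at hv ⊢; simp [hv]), reduceMap_line,
      hv, zero_smul]
    congr 1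
    ext (k | k) <;> simp
  rw [h1]
  exact hf.hasFDerivAt.hasLineDerivAt _

section Directions

variable (s : Phase (HI n)) (k : Fin n)

lemma reduceDiff_dirP (a : BI n) : reduceDiff s (dirP (Sum.inl a)) = dirP a := by
  rcases a with k | k <;> refine phase_BI_ext (fun i => ?_) (fun i => ?_) (fun i => ?_) fun i => ?_ <;>
    simp [reduceDiff, dirP, px, py, pz, bar, Pi.single_apply]

lemma reduceDiff_dirQ_inl :
    reduceDiff s (dirQ (Sum.inl (Sum.inl k))) = dirQ (Sum.inl k) := by
  refine phase_BI_ext (fun i => ?_) (fun i => ?_) (fun i => ?_) fun i => ?_ <;>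
    simp [reduceDiff, dirQ, px, py, pz, bar, Pi.single_apply]

/-- The extra momentum term, caused by `p_k = λ_k + λ_{2n+1} y_k`, is the source of the magnetic
field. -/
lemma reduceDiff_dirQ_inr :
    reduceDiff s (dirQ (Sum.inl (Sum.inr k))) = dirQ (Sum.inr k) + pz s.2 • dirP (Sum.inl k) := by
  refine phase_BI_ext (fun i => ?_) (fun i => ?_) (fun i => ?_) fun i => ?_ <;>
    simp [reduceDiff, dirQ, dirP, px, py, pz, bar, Pi.single_apply]

lemma reduceDiff_dirQ_z : reduceDiff s (dirQ (Sum.inr ())) = 0 := by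
  refine phase_BI_ext (fun i => ?_) (fun i => ?_) (fun i => ?_) fun i => ?_ <;>
    simp [reduceDiff, dirQ, px, py, pz, bar]

lemma reduceDiff_dirP_z :
    reduceDiff s (dirP (Sum.inr ())) = (0, Sum.elim (py (bar s.1)) 0) := by
  refine phase_BI_ext (fun i => ?_) (fun i => ?_) (fun i => ?_) fun i => ?_ <;>
    simp [reduceDiff, dirP, px, py, pz, bar]

lemma pz_dirQ (a : HI n) : pz (dirQ a).2 = 0 := rfl

lemma pz_dirP (a : BI n) : pz (dirP (Sum.inl a : HI n)).2 = 0 := by simp [pz, dirP]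

end Directions

lemma bracket_mag_eq (C : ℝ) (f g : Phase (BI n) → ℝ) (b : Phase (BI n)) :
    bracket (magField C) f g b = ∑ k : Fin n,
      (fderiv ℝ f b (dirQ (Sum.inl k)) * fderiv ℝ g b (dirP (Sum.inl k))
        - fderiv ℝ f b (dirP (Sum.inl k)) * fderiv ℝ g b (dirQ (Sum.inl k))
        + fderiv ℝ f b (dirQ (Sum.inr k)) * fderiv ℝ g b (dirP (Sum.inr k))
        - fderiv ℝ f b (dirP (Sum.inr k)) * fderiv ℝ g b (dirQ (Sum.inr k))
        + C * (fderiv ℝ f b (dirP (Sum.inl k)) * fderiv ℝ g b (dirP (Sum.inr k))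
          - fderiv ℝ f b (dirP (Sum.inr k)) * fderiv ℝ g b (dirP (Sum.inl k)))) := by
  rw [bracket_eq_sharp, clm_apply_phase, Fintype.sum_sum_type, ← Finset.sum_add_distrib]
  refine Finset.sum_congr rfl fun k _ => ?_
  rw [sharp_mag_inl, sharp_mag_inr, sharp_mag_fst, sharp_mag_fst]
  ring

/-- Neither function depends on `z` to first order, so the derivative in the conjugate direction
`λ_{2n+1}`, about which nothing is known, drops out. The remaining terms reproduce the magnetic
bracket with strength `pz s.2`. -/
lemma bracket_of_eq_on_level {F G : Phase (HI n) → ℝ} {f g : Phase (BI n) → ℝ} {s : Phase (HI n)}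
    (hF : DifferentiableAt ℝ F s) (hf : DifferentiableAt ℝ f (reduceMap s))
    (hG : DifferentiableAt ℝ G s) (hg : DifferentiableAt ℝ g (reduceMap s))
    (hFf : ∀ s', pz s'.2 = pz s.2 → F s' = f (reduceMap s'))
    (hGg : ∀ s', pz s'.2 = pz s.2 → G s' = g (reduceMap s')) :
    bracket 0 F G s = bracket (magField (pz s.2)) f g (reduceMap s) := by
  have eF := fun v hv => fderiv_of_eq_on_level (v := v) hF hf hFf hv
  have eG := fun v hv => fderiv_of_eq_on_level (v := v) hG hg hGg hv
  rw [bracket_mag_eq, bracket, poissonTensor]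
  simp only [Pi.zero_apply, zero_mul, Finset.sum_const_zero, add_zero]
  rw [Fintype.sum_sum_type, Fintype.sum_sum_type]
  simp only [eF _ (pz_dirQ _), eG _ (pz_dirQ _), eF _ (pz_dirP _), eG _ (pz_dirP _),
    reduceDiff_dirP, reduceDiff_dirQ_inl, reduceDiff_dirQ_inr, Finset.univ_unique,
    PUnit.default_eq_unit, Finset.sum_singleton, reduceDiff_dirQ_z, map_zero, zero_mul, mul_zero,
    sub_zero, add_zero, map_add, map_smul, smul_eq_mul]
  rw [← Finset.sum_add_distrib]
  exact Finset.sum_congr rfl fun k _ => by ring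

lemma IsLift.bracket {F G : Phase (HI n) → ℝ} {f g : ℝ → Phase (BI n) → ℝ}
    (hF : IsLift F f) (hG : IsLift G g) (s : Phase (HI n)) :
    bracket 0 F G s = _root_.bracket (magField (pz s.2)) (f (pz s.2)) (g (pz s.2)) (reduceMap s) :=
  bracket_of_eq_on_level (hF.contDiff.differentiable omega_ne_zero' s)
    ((hF.contDiff_red _).differentiable omega_ne_zero' _)
    (hG.contDiff.differentiable omega_ne_zero' s)
    ((hG.contDiff_red _).differentiable omega_ne_zero' _)
    (fun s' hs => by rw [hF.eq, hs]) (fun s' hs => by rw [hG.eq, hs])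

/-- The momentum of the central direction. -/
def cycFun (s : Phase (HI n)) : ℝ := pz s.2

lemma contDiff_cycFun : ContDiff ℝ ω (cycFun (n := n)) := by
  unfold cycFun pz; fun_prop

lemma fderiv_cycFun (s v : Phase (HI n)) : fderiv ℝ cycFun s v = pz v.2 := by
  refine fderiv_apply_of_quadratic (a := pz s.2) (c := 0)
    (contDiff_cycFun.differentiable omega_ne_zero' s) fun t => ?_
  simp [cycFun, pz]

/-- The Hamiltonian field of the central momentum is the translation in `z`, which `reduceMap`
forgets. -/
lemma IsLift.bracket_cycFun {F : Phase (HI n) → ℝ} {f : ℝ → Phase (BI n) → ℝ}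
    (hF : IsLift F f) (s : Phase (HI n)) : _root_.bracket 0 F cycFun s = 0 := by
  have h : sharp 0 s (fderiv ℝ (cycFun (n := n)) s) = dirQ (Sum.inr ()) := by
    ext (a | a)
    · simp [sharp, fderiv_cycFun, pz_dirP, dirQ]
    · simp [sharp, fderiv_cycFun, dirP, dirQ, pz]
    · simp [sharp, fderiv_cycFun, dirQ, pz]
    · simp [sharp, fderiv_cycFun, dirQ, pz]
  rw [bracket_eq_sharp, h, fderiv_of_eq_on_level (hF.contDiff.differentiable omega_ne_zero' s)
    ((hF.contDiff_red _).differentiable omega_ne_zero' _) (fun s' hs => by rw [hF.eq, hs])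
    (pz_dirQ _), reduceDiff_dirQ_z, map_zero]

/-- A point over a given point of the reduced phase space. -/
def sectionMap (C z : ℝ) (b : Phase (BI n)) : Phase (HI n) :=
  (hVec b.1 z, hVec (Sum.elim (px b.2 - C • py b.1) (py b.2)) C)

lemma pz_sectionMap (C z : ℝ) (b : Phase (BI n)) : pz (sectionMap C z b).2 = C := rfl

lemma reduceMap_sectionMap (C z : ℝ) (b : Phase (BI n)) : reduceMap (sectionMap C z b) = b := by
  refine phase_BI_ext (fun i => ?_) (fun i => ?_) (fun i => ?_) fun i => ?_ <;>
    simp [reduceMap, sectionMap, hVec, px, py, pz, bar]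

/-- Directions tangent to the level turn a relation into one between the reduced differentials,
since every reduced direction lifts to such a direction. The transversal direction then removes the
coefficient of `cycFun`. -/
lemma linearIndependent_lift {κ : Type} [Fintype κ] {F : κ → Phase (HI n) → ℝ}
    {f : κ → ℝ → Phase (BI n) → ℝ} (hF : ∀ i, IsLift (F i) (f i)) {s : Phase (HI n)}
    (hli : LinearIndependent ℝ fun i => fderiv ℝ (f i (pz s.2)) (reduceMap s)) :
    LinearIndependent ℝ fun i : Option κ => fderiv ℝ (i.elim cycFun F) s := by
  rw [Fintype.linearIndependent_iff] at hli ⊢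
  intro c hc
  have H : ∀ v : Phase (HI n), c none * pz v.2 + ∑ i, c (some i) * fderiv ℝ (F i) s v = 0 := by
    intro v
    have h := congrArg (fun φ : Phase (HI n) →L[ℝ] ℝ => φ v) hc
    simp only [_root_.sum_apply, _root_.smul_apply, smul_eq_mul, _root_.zero_apply] at h
    rw [Fintype.sum_option] at h
    simpa [fderiv_cycFun] using h
  have h1 : ∀ i, c (some i) = 0 := by
    refine hli (fun i => c (some i)) (ContinuousLinearMap.ext fun w => ?_)
    let v : Phase (HI n) := (hVec w.1 0, hVec (Sum.elim (px w.2 - pz s.2 • py w.1) (py w.2)) 0)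
    have hv : pz v.2 = 0 := rfl
    have hvw : reduceDiff s v = w := by
      refine phase_BI_ext (fun i => ?_) (fun i => ?_) (fun i => ?_) fun i => ?_ <;>
        simp [reduceDiff, v, hVec, px, py, pz, bar]
    have h := H v
    rw [hv, mul_zero, zero_add] at h
    simp only [_root_.sum_apply, _root_.smul_apply, smul_eq_mul, _root_.zero_apply]
    rw [← h]
    refine Finset.sum_congr rfl fun i _ => ?_
    rw [fderiv_of_eq_on_level ((hF i).contDiff.differentiable omega_ne_zero' s)
      (((hF i).contDiff_red _).differentiable omega_ne_zero' _)
      (fun s' hs => by rw [(hF i).eq, hs]) hv, hvw]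
  have h0 : c none = 0 := by
    have h := H (dirP (Sum.inr ()))
    simpa [h1, pz, dirP] using h
  rintro (_ | i)
  exacts [h0, h1 i]

/-! ### The first integrals of the full system -/

lemma dot_J (q p : BI n → ℝ) : q ⬝ᵥ (Matrix.J (Fin n) ℝ *ᵥ p) = -((Matrix.J (Fin n) ℝ *ᵥ q) ⬝ᵥ p) := by
  rw [J_mulVec, J_mulVec, dot_BI, dot_BI, ← Finset.sum_neg_distrib]
  refine Finset.sum_congr rfl fun k _ => ?_
  simp only [px, py, Sum.elim_inl, Sum.elim_inr, Pi.neg_apply]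
  ring

lemma J_dot_J (q : BI n → ℝ) :
    (Matrix.J (Fin n) ℝ *ᵥ q) ⬝ᵥ (Matrix.J (Fin n) ℝ *ᵥ q) = q ⬝ᵥ q := by
  rw [J_mulVec, dot_BI, dot_BI]
  refine Finset.sum_congr rfl fun k _ => ?_
  simp only [px, py, Sum.elim_inl, Sum.elim_inr, Pi.neg_apply]
  ring

/-- Expand `hamRed` at `p = λ + λ_{2n+1} u`, using `⟨Jq, u⟩ = -⟨u, u⟩`. -/
lemma hamR_eq (s : Phase (HI n)) : hamR s = hamRed (reduceMap s) := by
  have hp : (reduceMap s).2 = bar s.2 + pz s.2 • Sum.elim (py (bar s.1)) 0 := by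
    ext (k | k) <;> simp [reduceMap, px, py, bar]
  have hu : (Matrix.J (Fin n) ℝ *ᵥ bar s.1) ⬝ᵥ (Sum.elim (py (bar s.1)) 0)
      = -((Sum.elim (py (bar s.1)) 0 : BI n → ℝ) ⬝ᵥ Sum.elim (py (bar s.1)) 0) := by
    rw [J_mulVec, dot_BI, dot_BI, ← Finset.sum_neg_distrib]
    refine Finset.sum_congr rfl fun k _ => ?_
    simp [px, py]
  have hq : (reduceMap s).1 = bar s.1 := rfl
  have hpos : 0 < 1 + bar s.1 ⬝ᵥ bar s.1 := one_add_sqQ_pos (bar s.1, 0)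
  rw [hamRed, dot_J, hp, hq]
  unfold hamR
  simp only
  generalize (Sum.elim (py (bar s.1)) 0 : BI n → ℝ) = u at *
  generalize Matrix.J (Fin n) ℝ *ᵥ bar s.1 = w at *
  generalize bar s.2 = l
  simp only [sub_mulVec, one_mulVec, smul_mulVec, vecMulVec_mulVec, dotProduct_sub, dotProduct_smul,
    dotProduct_add, add_dotProduct, smul_dotProduct, smul_eq_mul, hu, dotProduct_comm u l,
    dotProduct_comm l w, op_smul_eq_smul]
  field_simp
  ring

lemma isLift_ham : IsLift (hamR (n := n)) fun _ => hamRed :=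
  ⟨by rw [funext hamR_eq]; exact contDiff_hamRed.comp contDiff_reduceMap, fun _ => contDiff_hamRed,
    hamR_eq⟩

lemma isLift_ang (j : Fin n) : IsLift (intAng j) fun C => redAng C j := by
  refine ⟨?_, fun C => contDiff_redAng C j, fun s => ?_⟩
  · unfold intAng px py bar pz; fun_prop
  · simp [intAng, redAng, reduceMap, px, py, bar]
    ring

lemma isLift_quad (k : Fin (n - 1)) : IsLift (intQuad k) fun _ => redQuad k := by
  refine ⟨?_, fun C => contDiff_redQuad k, fun s => ?_⟩
  · unfold intQuad px py bar pz; fun_prop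
  · simp [intQuad, redQuad, reduceMap, px, py, bar]
    ring

lemma isLift_intFull (i : RedIdx n) : IsLift (intFull i.toFull) fun C => intRed C i := by
  cases i with
  | ham => exact isLift_ham
  | ang j => exact isLift_ang j
  | quad k => exact isLift_quad k
  | brk l =>
    exact ⟨bracket_contDiff isConstSkew_zero (isLift_quad _).contDiff (isLift_quad _).contDiff,
      fun C => contDiff_intRed C _, (isLift_quad _).bracket (isLift_quad _)⟩

/-- The indices of the first integrals of the full system. -/
def fullIdxEquiv (n : ℕ) : Option (RedIdx n) ≃ FullIdx n where
  toFun i := i.elim .cyc RedIdx.toFull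
  invFun
    | .ham => some .ham
    | .ang j => some (.ang j)
    | .quad k => some (.quad k)
    | .cyc => none
    | .brk l => some (.brk l)
  left_inv := by rintro (_ | _ | _ | _ | _) <;> rfl
  right_inv := by rintro (_ | _ | _ | _ | _) <;> rfl

instance fintypeFullIdx : Fintype (FullIdx n) := Fintype.ofEquiv _ (fullIdxEquiv n)

lemma intFull_fullIdxEquiv (i : Option (RedIdx n)) :
    intFull (fullIdxEquiv n i) = i.elim cycFun fun j => intFull j.toFull := by
  cases i <;> rfl

lemma range_intFull : Set.range (intFull (n := n))
    = Set.range fun i : Option (RedIdx n) => i.elim cycFun fun j => intFull j.toFull := by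
  rw [← (fullIdxEquiv n).surjective.range_comp]
  congr 1
  funext i
  exact intFull_fullIdxEquiv i

lemma contDiff_optionElim {κ : Type} {F : κ → Phase (HI n) → ℝ} {f : κ → ℝ → Phase (BI n) → ℝ}
    (hF : ∀ i, IsLift (F i) (f i)) (i : Option κ) : ContDiff ℝ ω (i.elim cycFun F) := by
  cases i with
  | none => exact contDiff_cycFun
  | some i => exact (hF i).contDiff

lemma bracket_optionElim {κ μ : Type} {F : κ → Phase (HI n) → ℝ} {f : κ → ℝ → Phase (BI n) → ℝ}
    {G : μ → Phase (HI n) → ℝ} {g : μ → ℝ → Phase (BI n) → ℝ}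
    (hF : ∀ i, IsLift (F i) (f i)) (hG : ∀ i, IsLift (G i) (g i))
    (h : ∀ i j C s, bracket (magField C) (f i C) (g j C) s = 0) (i : Option κ) (j : Option μ)
    (s : Phase (HI n)) : bracket 0 (i.elim cycFun F) (j.elim cycFun G) s = 0 := by
  cases i with
  | none =>
    cases j with
    | none => exact isConstSkew_zero.bracket_self _ _
    | some j =>
      rw [isConstSkew_zero.bracket_skew]
      exact neg_eq_zero.2 ((hG j).bracket_cycFun s)
  | some i =>
    cases j with
    | none => exact (hF i).bracket_cycFun s
    | some j => exact ((hF i).bracket (hG j) s).trans (h i j _ _)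

lemma contDiff_intFull (i : FullIdx n) : ContDiff ℝ ω (intFull i) := by
  obtain ⟨i, rfl⟩ := (fullIdxEquiv n).surjective i
  rw [intFull_fullIdxEquiv]
  exact contDiff_optionElim isLift_intFull i

lemma isFirstIntegral_intFull (i : FullIdx n) : IsFirstIntegral 0 hamR (intFull i) := by
  refine ⟨(contDiff_intFull i).of_le (by simp), fun s => ?_⟩
  obtain ⟨i, rfl⟩ := (fullIdxEquiv n).surjective i
  rw [intFull_fullIdxEquiv]
  exact bracket_optionElim (μ := Unit) (G := fun _ => hamR) (g := fun _ _ => hamRed)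
    isLift_intFull (fun _ => isLift_ham) (fun i _ C s => intRed_hamRed C s i) i (some ()) s

lemma linearIndependent_intFull_option (hn : 1 ≤ n) :
    LinearIndependent ℝ fun i : Option (RedIdx n) =>
      fderiv ℝ (i.elim cycFun fun j => intFull j.toFull) (sectionMap 0 0 (basePt n)) := by
  refine linearIndependent_lift isLift_intFull ?_
  rw [reduceMap_sectionMap]
  exact linearIndependent_intRed_basePt hn _

lemma independentAE_intFull (hn : 1 ≤ n) : IndependentAE (intFull (n := n)) := by
  refine independentAE_of_linearIndependent contDiff_intFull
    (a := sectionMap 0 0 (basePt n)) ?_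
  rw [← linearIndependent_equiv (fullIdxEquiv n)]
  convert linearIndependent_intFull_option hn with i
  rw [Function.comp_apply, intFull_fullIdxEquiv]

lemma finrank_HI : Fintype.card (HI n) = 2 * n + 1 := by
  simp; ring

/-- The central momentum joins both the generators and the commuting family, which matches the two
extra dimensions of the phase space. -/
theorem full_integrable_of_le_two (hn : 1 ≤ n) (h2 : n ≤ 2) :
    InInvolution 0 (lieAlg 0 (Set.range (intFull (n := n)))) ∧
    IsCompleteAlgebra 0 hamR (lieAlg 0 (Set.range (intFull (n := n))))
      (2 * n + 1) (2 * n + 1) := by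
  have hcard : Fintype.card (Option (RedIdx n)) = 2 * n + 1 := by
    rw [Fintype.card_option, card_redIdx]; omega
  have hli := linearIndependent_intFull_option hn
  have hcomm := bracket_optionElim (n := n) isLift_intFull isLift_intFull
    fun i j C s => intRed_intRed_of_le_two h2 C i j s
  rw [range_intFull]
  constructor
  · refine inInvolution_lieAlg isConstSkew_zero ?_ ?_
    · rintro _ ⟨i, rfl⟩
      exact contDiff_optionElim isLift_intFull i
    · rintro _ ⟨i, rfl⟩ _ ⟨j, rfl⟩ s
      exact hcomm i j s
  · have := isCompleteAlgebra_lieAlg isConstSkew_zero (contDiff_optionElim isLift_intFull)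
      (contDiff_optionElim isLift_intFull) hcomm hcomm (H := hamR) ⟨some .ham, rfl⟩ hli hli
      (by rw [hcard, finrank_HI]; ring)
    rwa [hcard] at this

/-- The functions on the full phase space which restrict to `centralRed`. -/
def centralFull : Option (Option (Fin n)) → Phase (HI n) → ℝ
  | none => hamR
  | some none => fun s => casimir (reduceMap s)
  | some (some j) => intAng j

lemma isLift_centralFull (i : Option (Option (Fin n))) :
    IsLift (centralFull i) fun C => centralRed C i := by
  rcases i with _ | _ | j
  · exact isLift_ham
  · exact ⟨contDiff_casimir.comp contDiff_reduceMap, fun _ => contDiff_casimir, fun _ => rfl⟩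
  · exact isLift_ang j

theorem full_integrable_of_two_lt (h2 : 2 < n) :
    ¬ InInvolution 0 (Set.range (intFull (n := n))) ∧
    IsCompleteAlgebra 0 hamR (lieAlg 0 (Set.range (intFull (n := n))))
      (3 * n - 1) (n + 3) := by
  have hli := linearIndependent_intFull_option (by omega : 1 ≤ n)
  constructor
  · intro h
    have hne := hli.ne_zero (some (.brk ⟨0, by omega⟩))
    apply hne
    have h0 : intFull (n := n) (.brk ⟨0, by omega⟩) = 0 :=
      funext fun s => h _ ⟨.quad _, rfl⟩ _ ⟨.quad _, rfl⟩ s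
    change fderiv ℝ (intFull (n := n) (.brk ⟨0, by omega⟩)) _ = 0
    rw [h0]
    simp
  · have hcard : Fintype.card (Option (RedIdx n)) = 3 * n - 1 := by
      rw [Fintype.card_option, card_redIdx]; omega
    have hcard' : Fintype.card (Option (Option (Option (Fin n)))) = n + 3 := by simp
    have hliK : LinearIndependent ℝ fun i : Option (Option (Option (Fin n))) =>
        fderiv ℝ (i.elim cycFun centralFull) (sectionMap 0 0 (basePt n)) := by
      refine linearIndependent_lift isLift_centralFull ?_
      rw [reduceMap_sectionMap]
      exact linearIndependent_centralRed_basePt h2 _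
    rw [range_intFull]
    have := isCompleteAlgebra_lieAlg isConstSkew_zero (contDiff_optionElim isLift_intFull)
      (contDiff_optionElim isLift_centralFull)
      (bracket_optionElim isLift_intFull isLift_centralFull
        fun i j C s => intRed_centralRed C i j s)
      (bracket_optionElim isLift_centralFull isLift_centralFull
        fun i j C s => centralRed_centralRed C i j s) (H := hamR) ⟨some none, rfl⟩ hli hliK
      (by rw [hcard, hcard', finrank_HI]; omega)
    rwa [hcard, hcard'] at this

end Reduction
end

/-! ### Cometric, normal extremals and charged particles. -/

noncomputable section

section Geodesics

variable {n : ℕ}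

lemma fderiv_of_affine {V W : Type*} [NormedAddCommGroup V] [NormedSpace ℝ V]
    [FiniteDimensional ℝ V] [NormedAddCommGroup W] [NormedSpace ℝ W] {f : V → W} (L : V →ₗ[ℝ] W)
    (c : W) (h : ∀ x, f x = L x + c) (x v : V) : fderiv ℝ f x v = L v := by
  have : f = fun x => L.toContinuousLinearMap x + c := funext h
  rw [this, fderiv_add_const, ContinuousLinearMap.fderiv]
  rfl

lemma rightDiff_apply (g v : HI n → ℝ) :
    rightDiff g v = hVec (bar v) (pz v + px (bar v) ⬝ᵥ py (bar g)) := by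
  let L : (HI n → ℝ) →ₗ[ℝ] (HI n → ℝ) :=
    { toFun := fun v => hVec (bar v) (pz v + px (bar v) ⬝ᵥ py (bar g))
      map_add' := by
        intro v w
        ext (a | a)
        · simp [hVec, bar]
        · have : px (bar (v + w)) = px (bar v) + px (bar w) := rfl
          simp only [hVec, this, add_dotProduct, Sum.elim_inr, Pi.add_apply, pz]
          ring
      map_smul' := by
        intro r w
        ext (a | a)
        · simp [hVec, bar]
        · have : px (bar (r • w)) = r • px (bar w) := rfl
          simp only [hVec, this, smul_dotProduct, Sum.elim_inr, Pi.smul_apply, pz, smul_eq_mul,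
            RingHom.id_apply]
          ring }
  refine fderiv_of_affine L g (fun h => ?_) 0 v
  ext (a | a)
  · simp [heisMul, L, hVec, bar]
  · simp only [heisMul, L, hVec, pz, LinearMap.coe_mk, AddHom.coe_mk, Pi.add_apply, Sum.elim_inr]
    ring

lemma rightField_eq (u : BI n → ℝ) (g : HI n → ℝ) :
    rightField u g = hVec u (px u ⬝ᵥ py (bar g)) := by
  rw [rightField, rightDiff_apply]
  change hVec u (0 + px u ⬝ᵥ py (bar g)) = _
  rw [zero_add]

lemma bar_rightField (u : BI n → ℝ) (g : HI n → ℝ) : bar (rightField u g) = u := by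
  rw [rightField_eq]; rfl

lemma fderiv_leftTranslation (g v : HI n → ℝ) :
    fderiv ℝ (heisMul (heisInv g)) g v = hVec (bar v) (pz v - px (bar g) ⬝ᵥ py (bar v)) := by
  let L : (HI n → ℝ) →ₗ[ℝ] (HI n → ℝ) :=
    { toFun := fun v => hVec (bar v) (pz v - px (bar g) ⬝ᵥ py (bar v))
      map_add' := by
        intro v w
        ext (a | a)
        · simp [hVec, bar]
        · have : py (bar (v + w)) = py (bar v) + py (bar w) := rfl
          simp only [hVec, this, dotProduct_add, Sum.elim_inr, Pi.add_apply, pz]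
          ring
      map_smul' := by
        intro r w
        ext (a | a)
        · simp [hVec, bar]
        · have : py (bar (r • w)) = r • py (bar w) := rfl
          simp only [hVec, this, dotProduct_smul, Sum.elim_inr, Pi.smul_apply, pz, smul_eq_mul,
            RingHom.id_apply]
          ring }
  refine fderiv_of_affine L (heisInv g) (fun h => ?_) g v
  ext (a | a)
  · simp [heisMul, L, hVec, bar, add_comm]
  · have : px (bar (heisInv g)) = -px (bar g) := rfl
    simp only [heisMul, L, hVec, pz, LinearMap.coe_mk, AddHom.coe_mk, Pi.add_apply, Sum.elim_inr,
      this, neg_dotProduct]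
    ring

lemma dot_HI (v w : HI n → ℝ) : v ⬝ᵥ w = bar v ⬝ᵥ bar w + pz v * pz w := by
  simp [dotProduct, Fintype.sum_sum_type, bar, pz]

/-- Translating the right-invariant field back to the identity from the left keeps its horizontal
part and produces the vertical component `-⟨Jq, v⟩`, whence the rank-one term. -/
lemma leftMetric_rightField (g : HI n → ℝ) (v w : BI n → ℝ) :
    leftMetric g (rightField v g) (rightField w g) = redMetric (bar g) v w := by
  have key : ∀ v : BI n → ℝ, px v ⬝ᵥ py (bar g) - px (bar g) ⬝ᵥ py v
      = -((Matrix.J (Fin n) ℝ *ᵥ bar g) ⬝ᵥ v) := by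
    intro v
    rw [J_mulVec, dot_BI, ← Finset.sum_neg_distrib, dotProduct, dotProduct,
      ← Finset.sum_sub_distrib]
    refine Finset.sum_congr rfl fun k _ => ?_
    simp only [px, py, Sum.elim_inl, Sum.elim_inr, Pi.neg_apply]
    ring
  rw [leftMetric, fderiv_leftTranslation, fderiv_leftTranslation, rightField_eq, rightField_eq,
    dot_HI]
  change v ⬝ᵥ w + (px v ⬝ᵥ py (bar g) - px (bar g) ⬝ᵥ py v)
    * (px w ⬝ᵥ py (bar g) - px (bar g) ⬝ᵥ py w) = _
  rw [key, key, redMetric]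
  ring

/-- The momenta `p` are the values of the covector on the right-invariant frame. -/
lemma dot_rightField (s : Phase (HI n)) (u : BI n → ℝ) :
    s.2 ⬝ᵥ rightField u s.1 = (reduceMap s).2 ⬝ᵥ u := by
  rw [rightField_eq, dot_HI]
  change bar s.2 ⬝ᵥ u + pz s.2 * (px u ⬝ᵥ py (bar s.1)) = _
  rw [dot_BI, dot_BI, dotProduct, Finset.mul_sum, ← Finset.sum_add_distrib]
  refine Finset.sum_congr rfl fun k _ => ?_
  simp only [px, py, reduceMap, Sum.elim_inl, Sum.elim_inr, Pi.add_apply, Pi.smul_apply, smul_eq_mul]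
  ring

lemma redMetric_add (q v w u : BI n → ℝ) :
    redMetric q (v + w) u = redMetric q v u + redMetric q w u := by
  simp only [redMetric, add_dotProduct, dotProduct_add]; ring

lemma redMetric_smul (q : BI n → ℝ) (a : ℝ) (v u : BI n → ℝ) :
    redMetric q (a • v) u = a * redMetric q v u := by
  simp only [redMetric, smul_dotProduct, dotProduct_smul, smul_eq_mul]; ring

lemma redMetric_comm (q v w : BI n → ℝ) : redMetric q v w = redMetric q w v := by
  simp only [redMetric, dotProduct_comm v w]; ring

lemma redMetric_sub_self (q v w : BI n → ℝ) : redMetric q (v - w) (v - w)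
    = redMetric q v v - 2 * redMetric q v w + redMetric q w w := by
  simp only [redMetric, sub_dotProduct, dotProduct_sub, dotProduct_comm w v]; ring

lemma redMetric_self_nonneg (q v : BI n → ℝ) : 0 ≤ redMetric q v v := by
  rw [redMetric]
  have : 0 ≤ v ⬝ᵥ v := Finset.sum_nonneg fun i _ => mul_self_nonneg _
  nlinarith [mul_self_nonneg ((Matrix.J (Fin n) ℝ *ᵥ q) ⬝ᵥ v)]

lemma eq_zero_of_redMetric_self {q v : BI n → ℝ} (h : redMetric q v v = 0) : v = 0 := by
  rw [redMetric] at h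
  have h1 : 0 ≤ v ⬝ᵥ v := Finset.sum_nonneg fun i _ => mul_self_nonneg _
  have h2 : v ⬝ᵥ v = 0 := by
    nlinarith [mul_self_nonneg ((Matrix.J (Fin n) ℝ *ᵥ q) ⬝ᵥ v)]
  exact dotProduct_self_eq_zero.1 h2

/-- The vector dual to the covector `p` with respect to `redMetric`. -/
def redDual (q p : BI n → ℝ) : BI n → ℝ :=
  p - (((Matrix.J (Fin n) ℝ *ᵥ q) ⬝ᵥ p) / (1 + q ⬝ᵥ q)) • (Matrix.J (Fin n) ℝ *ᵥ q)

/-- `redDual` is the inverse of a rank-one perturbation of the identity (Sherman–Morrison), with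
`|Jq|² = |q|²`. -/
lemma redMetric_redDual (q p w : BI n → ℝ) : redMetric q (redDual q p) w = p ⬝ᵥ w := by
  have hpos : 0 < 1 + q ⬝ᵥ q := one_add_sqQ_pos (q, 0)
  simp only [redMetric, redDual, sub_dotProduct, dotProduct_sub, smul_dotProduct, dotProduct_smul,
    smul_eq_mul, J_dot_J]
  field_simp
  ring

lemma eq_redDual {q v p : BI n → ℝ} (h : ∀ w, redMetric q v w = p ⬝ᵥ w) : v = redDual q p := by
  have : redMetric q (v - redDual q p) (v - redDual q p) = 0 := by
    have h1 : p ⬝ᵥ v = p ⬝ᵥ redDual q p := by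
      rw [← redMetric_redDual q p v, redMetric_comm, h]
    rw [redMetric_sub_self, redMetric_redDual, h, h, h1]
    ring
  exact sub_eq_zero.1 (eq_zero_of_redMetric_self this)

lemma hamRed_eq_redDual (q p : BI n → ℝ) :
    hamRed (q, p) = 1 / 2 * redMetric q (redDual q p) (redDual q p) := by
  have hpos : 0 < 1 + q ⬝ᵥ q := one_add_sqQ_pos (q, 0)
  rw [redMetric_redDual, hamRed, dot_J]
  simp only [redDual, dotProduct_sub, dotProduct_smul, smul_eq_mul,
    dotProduct_comm p (Matrix.J (Fin n) ℝ *ᵥ q)]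
  field_simp

lemma hamRed_of_dual {q v p : BI n → ℝ} (h : ∀ w, redMetric q v w = p ⬝ᵥ w) :
    hamRed (q, p) = 1 / 2 * redMetric q v v := by
  rw [hamRed_eq_redDual, eq_redDual h]

lemma redDual_surjective (q u : BI n → ℝ) : ∃ p, redDual q p = u := by
  refine ⟨u + ((Matrix.J (Fin n) ℝ *ᵥ q) ⬝ᵥ u) • (Matrix.J (Fin n) ℝ *ᵥ q), ?_⟩
  refine (eq_redDual fun w => ?_).symm
  simp [redMetric, add_dotProduct, smul_dotProduct]

lemma mem_distR {g v : HI n → ℝ} : v ∈ distR g ↔ ∃ u, rightField u g = v := by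
  have hspan : (Submodule.span ℝ (Set.range fun a : BI n =>
      (Pi.single (Sum.inl a) 1 : HI n → ℝ)) : Set (HI n → ℝ)) = {v | pz v = 0} := by
    ext v
    simp only [SetLike.mem_coe, Set.mem_ofPred_eq]
    constructor
    · intro h
      induction h using Submodule.span_induction with
      | mem x hx => obtain ⟨a, rfl⟩ := hx; simp [pz]
      | zero => rfl
      | add x y _ _ hx hy => simp only [pz, Pi.add_apply] at *; linarith
      | smul a x _ hx => simp only [pz, Pi.smul_apply] at *; simp [hx]
    · intro h
      have : v = ∑ a : BI n, v (Sum.inl a) • (Pi.single (Sum.inl a) 1 : HI n → ℝ) := by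
        ext (a | a)
        · simp [Finset.sum_apply, Pi.single_apply]
        · have h' : v (Sum.inr a) = 0 := h
          simp [Finset.sum_apply, h']
      rw [this]
      exact Submodule.sum_mem _ fun a _ => Submodule.smul_mem _ _ (Submodule.subset_span ⟨a, rfl⟩)
  rw [distR, Submodule.mem_map]
  constructor
  · rintro ⟨y, hy, rfl⟩
    rw [← SetLike.mem_coe, hspan] at hy
    refine ⟨bar y, ?_⟩
    have : y = hVec (bar y) 0 := by
      ext (a | a)
      · rfl
      · exact hy
    rw [rightField, ← this]
    rfl
  · rintro ⟨u, rfl⟩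
    refine ⟨hVec u 0, ?_, rfl⟩
    rw [← SetLike.mem_coe, hspan]
    rfl

lemma rightField_add (u v : BI n → ℝ) (g : HI n → ℝ) :
    rightField (u + v) g = rightField u g + rightField v g := by
  rw [rightField, rightField, rightField, ← map_add]
  congr 1
  ext (a | a) <;> simp [hVec]

lemma rightField_smul (r : ℝ) (u : BI n → ℝ) (g : HI n → ℝ) :
    rightField (r • u) g = r • rightField u g := by
  rw [rightField, rightField, ← map_smul]
  congr 1
  ext (a | a) <;> simp [hVec]

/-- The map of the cometric of the sub-Riemannian structure. -/
def cometricMap (g : HI n → ℝ) : (HI n → ℝ) →ₗ[ℝ] (HI n → ℝ) where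
  toFun l := rightField (redDual (bar g) (reduceMap (g, l)).2) g
  map_add' l m := by
    rw [← rightField_add]
    congr 1
    refine (eq_redDual fun w => ?_).symm
    rw [redMetric_add, redMetric_redDual, redMetric_redDual, ← add_dotProduct]
    congr 1
    ext (k | k) <;> simp [reduceMap, px, py, pz, bar]
    ring
  map_smul' r l := by
    rw [RingHom.id_apply, ← rightField_smul]
    congr 1
    refine (eq_redDual fun w => ?_).symm
    rw [redMetric_smul, redMetric_redDual, ← smul_eq_mul, ← smul_dotProduct]
    congr 1
    ext (k | k) <;> simp [reduceMap, px, py, pz, bar]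
    ring

/-- The range condition writes `β g l` as a frame combination, and the pairing determines its
coefficients because `redMetric` is positive definite. Surjectivity onto the distribution comes from
`redDual_surjective`. -/
lemma isCometricMap_iff {β : (HI n → ℝ) → (HI n → ℝ) →ₗ[ℝ] (HI n → ℝ)} :
    IsCometricMap distR leftMetric β ↔ β = cometricMap := by
  constructor
  · intro h
    funext g
    refine LinearMap.ext fun l => ?_
    obtain ⟨h1, h2⟩ := h g
    obtain ⟨u, hu⟩ := mem_distR.1 (h1 ▸ LinearMap.mem_range_self (β g) l)
    change β g l = rightField (redDual (bar g) (reduceMap (g, l)).2) g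
    rw [← hu]
    congr 1
    refine eq_redDual fun w => ?_
    rw [← leftMetric_rightField g, hu, ← h2 l _ (mem_distR.2 ⟨w, rfl⟩)]
    exact dot_rightField (g, l) w
  · rintro rfl g
    refine ⟨?_, fun l v hv => ?_⟩
    · ext v
      rw [mem_distR]
      constructor
      · rintro ⟨l, rfl⟩
        exact ⟨_, rfl⟩
      · rintro ⟨u, rfl⟩
        obtain ⟨p, rfl⟩ := redDual_surjective (bar g) u
        refine ⟨hVec p 0, ?_⟩
        have : (reduceMap (g, hVec p 0)).2 = p := by
          ext (k | k) <;> simp [reduceMap, px, py, pz, bar, hVec]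
        change rightField (redDual (bar g) (reduceMap (g, hVec p 0)).2) g = _
        rw [this]
    · obtain ⟨w, rfl⟩ := mem_distR.1 hv
      change _ = leftMetric g (rightField (redDual (bar g) (reduceMap (g, l)).2) g) _
      rw [leftMetric_rightField, redMetric_redDual]
      exact dot_rightField (g, l) w

lemma half_dot_cometricMap (s : Phase (HI n)) : 1 / 2 * (s.2 ⬝ᵥ cometricMap s.1 s.2) = hamR s := by
  rw [hamR_eq]
  change 1 / 2 * (s.2 ⬝ᵥ rightField (redDual (bar s.1) (reduceMap s).2) s.1) = _
  rw [dot_rightField, ← redMetric_redDual (bar s.1), ← hamRed_eq_redDual]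
  rfl

lemma controlHam_eq (u : BI n → ℝ) (s : Phase (HI n)) :
    controlHam u s = (reduceMap s).2 ⬝ᵥ u - 1 / 2 * redMetric (bar s.1) u u := by
  rw [controlHam, dot_rightField, leftMetric_rightField]

/-- Completing the square: the gap measures the distance of the control from the optimal one. -/
lemma hamR_sub_controlHam (u : BI n → ℝ) (s : Phase (HI n)) :
    hamR s - controlHam u s = 1 / 2 * redMetric (bar s.1)
      (redDual (bar s.1) (reduceMap s).2 - u) (redDual (bar s.1) (reduceMap s).2 - u) := by
  rw [controlHam_eq, hamR_eq, redMetric_sub_self, redMetric_redDual _ _ u]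
  have : hamRed (reduceMap s) = _ := hamRed_eq_redDual (bar s.1) (reduceMap s).2
  rw [this]
  ring

lemma controlHam_le (u : BI n → ℝ) (s : Phase (HI n)) : controlHam u s ≤ hamR s := by
  have := hamR_sub_controlHam u s
  have h2 := redMetric_self_nonneg (bar s.1) (redDual (bar s.1) (reduceMap s).2 - u)
  linarith

lemma controlHam_redDual (s : Phase (HI n)) :
    controlHam (redDual (bar s.1) (reduceMap s).2) s = hamR s := by
  have := hamR_sub_controlHam (redDual (bar s.1) (reduceMap s).2) s
  rw [sub_self] at this
  simp [redMetric] at this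
  linarith

lemma differentiable_controlHam (u : BI n → ℝ) : Differentiable ℝ (controlHam (n := n) u) := by
  have h : controlHam (n := n) u = fun s => (reduceMap s).2 ⬝ᵥ u
      - 1 / 2 * redMetric (bar s.1) u u := funext (controlHam_eq u)
  have h1 : Differentiable ℝ (reduceMap (n := n)) :=
    contDiff_reduceMap.differentiable omega_ne_zero'
  have h2 : ∀ a, Differentiable ℝ fun s => (reduceMap (n := n) s).2 a := fun a s =>
    ((differentiable_pi.1 h1.snd) a) s
  rw [h]
  simp only [redMetric, dotProduct, mulVec, bar]
  fun_prop

/-- At a point where the control `u` is optimal, the differentials of the control Hamiltonian and of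
the Hamiltonian coincide. -/
lemma hamVec_controlHam {u : BI n → ℝ} {s : Phase (HI n)}
    (h : ∀ w, controlHam w s ≤ controlHam u s) : hamVec (controlHam u) s = hamVec hamR s := by
  have hu : controlHam u s = hamR s :=
    le_antisymm (controlHam_le u s) ((controlHam_redDual s).symm.le.trans (h _))
  -- With `u` frozen, the gap is nonnegative everywhere and vanishes at `s`, so its differential
  -- vanishes there.
  have hmin : IsLocalMin (fun s => hamR s - controlHam u s) s := by
    refine Filter.Eventually.of_forall fun s' => ?_
    simp only [hu, sub_self]
    exact sub_nonneg.2 (controlHam_le u s')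
  have hd : DifferentiableAt ℝ (hamR (n := n)) s :=
    isLift_ham.contDiff.differentiable omega_ne_zero' s
  have h0 := hmin.fderiv_eq_zero
  rw [fderiv_fun_sub hd (differentiable_controlHam u s), sub_eq_zero] at h0
  simp only [hamVec, h0]

/-- The normal extremals are the solutions of Hamilton's equations of `hamR`. -/
theorem isNormalExtremalOn_iff (c : ℝ → Phase (HI n)) (T : Set ℝ) :
    IsNormalExtremalOn c T ↔ IsHamTrajectoryOn hamR c T := by
  constructor
  · intro h t ht
    obtain ⟨u, hu, hd⟩ := h t ht
    rwa [hamVec_controlHam hu] at hd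
  · intro h t ht
    have hu : ∀ w, controlHam w (c t)
        ≤ controlHam (redDual (bar (c t).1) (reduceMap (c t)).2) (c t) := fun w => by
      rw [controlHam_redDual]; exact controlHam_le w _
    refine ⟨_, hu, ?_⟩
    rw [hamVec_controlHam hu]
    exact h t ht

/-! ### Charged particles -/

/-- Solves Hamilton's equations of the symplectic form for the velocity, which identifies them with
the Hamiltonian field of the Poisson tensor. -/
lemma magneticForm_eq_iff (C : ℝ) (b v : Phase (BI n)) (β : Phase (BI n) →L[ℝ] ℝ) :
    (∀ w, magneticForm (magField C) b v w = -β w) ↔ v = sharp (magField C) b β := by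
  have hform : ∀ w, magneticForm (magField C) b v w = ∑ k : Fin n,
      ((px v.2 k - C * py v.1 k) * px w.1 k + (py v.2 k + C * px v.1 k) * py w.1 k
        - px v.1 k * px w.2 k - py v.1 k * py w.2 k) := by
    intro w
    rw [magneticForm, magField, Fintype.sum_sum_type, Finset.mul_sum, ← Finset.sum_add_distrib,
      ← Finset.sum_add_distrib]
    refine Finset.sum_congr rfl fun k _ => ?_
    simp only [px, py]
    ring
  constructor
  · intro h
    have h' := fun w => (hform w).symm.trans (h w)
    have e1 : ∀ k, px v.1 k = β (dirP (Sum.inl k)) := by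
      intro k
      have := h' (dirP (Sum.inl k))
      simp [px_dirP_fst, py_dirP_fst, px_dirP_inl, py_dirP_inl] at this
      linarith
    have e2 : ∀ k, py v.1 k = β (dirP (Sum.inr k)) := by
      intro k
      have := h' (dirP (Sum.inr k))
      simp [px_dirP_fst, py_dirP_fst, px_dirP_inr, py_dirP_inr] at this
      linarith
    refine phase_BI_ext e1 e2 (fun k => ?_) fun k => ?_
    · have := h' (dirQ (Sum.inl k))
      simp [px_dirQ_snd, py_dirQ_snd, px_dirQ_inl, py_dirQ_inl] at this
      rw [px_sharp_snd, ← e2]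
      linarith
    · have := h' (dirQ (Sum.inr k))
      simp [px_dirQ_snd, py_dirQ_snd, px_dirQ_inr, py_dirQ_inr] at this
      rw [py_sharp_snd, ← e1]
      linarith
  · intro h w
    rw [hform, h, clm_apply_phase β, Fintype.sum_sum_type, ← Finset.sum_add_distrib,
      ← Finset.sum_neg_distrib]
    refine Finset.sum_congr rfl fun k _ => ?_
    rw [px_sharp_fst, py_sharp_fst, px_sharp_snd, py_sharp_snd]
    simp only [px, py]
    ring

lemma fderiv_hamR (s v : Phase (HI n)) :
    fderiv ℝ hamR s v = fderiv ℝ hamRed (reduceMap s) (reduceDiff s v) := by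
  have h : hamR (n := n) = hamRed ∘ reduceMap := funext hamR_eq
  rw [h, fderiv_comp s (contDiff_hamRed.differentiable omega_ne_zero' _)
    (contDiff_reduceMap.differentiable omega_ne_zero' _), ContinuousLinearMap.comp_apply,
    fderiv_reduceMap]

/-- The reduction relates the two Hamiltonian fields. Conservation of `λ_{2n+1}` removes the term of
`reduceDiff` that would come from its variation. -/
lemma reduceDiff_hamVec (s : Phase (HI n)) : reduceDiff s (hamVec hamR s)
    = sharp (magField (pz s.2)) (reduceMap s) (fderiv ℝ hamRed (reduceMap s)) := by
  have hz : pz (hamVec hamR s).2 = 0 := by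
    change -fderiv ℝ hamR s (dirQ (Sum.inr ())) = 0
    rw [fderiv_hamR, reduceDiff_dirQ_z, map_zero, neg_zero]
  have e1 : ∀ a, bar (hamVec hamR s).1 a = fderiv ℝ hamRed (reduceMap s) (dirP a) := by
    intro a
    change fderiv ℝ hamR s (dirP (Sum.inl a)) = _
    rw [fderiv_hamR, reduceDiff_dirP]
  have e2 : ∀ k, px (bar (hamVec hamR s).2) k
      = -fderiv ℝ hamRed (reduceMap s) (dirQ (Sum.inl k)) := by
    intro k
    change -fderiv ℝ hamR s (dirQ (Sum.inl (Sum.inl k))) = _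
    rw [fderiv_hamR, reduceDiff_dirQ_inl]
  have e3 : ∀ k, py (bar (hamVec hamR s).2) k
      = -fderiv ℝ hamRed (reduceMap s) (dirQ (Sum.inr k))
        - pz s.2 * fderiv ℝ hamRed (reduceMap s) (dirP (Sum.inl k)) := by
    intro k
    change -fderiv ℝ hamR s (dirQ (Sum.inl (Sum.inr k))) = _
    rw [fderiv_hamR, reduceDiff_dirQ_inr, map_add, map_smul, smul_eq_mul]
    ring
  refine phase_BI_ext (fun k => e1 _) (fun k => e1 _) (fun k => ?_) fun k => ?_
  · rw [px_sharp_snd]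
    change px (bar (hamVec hamR s).2) k + pz s.2 * bar (hamVec hamR s).1 (Sum.inr k)
      + pz (hamVec hamR s).2 * _ = _
    rw [e1, e2, hz, zero_mul, add_zero]
  · rw [py_sharp_snd]
    exact e3 k

lemma isChargedMotionOn_reduce {C : ℝ} {c : ℝ → Phase (HI n)} {T : Set ℝ}
    (hc : IsNormalExtremalOn c T) (hC : ∀ t ∈ T, pz (c t).2 = C) :
    IsChargedMotionOn (magField C) hamRed (fun t => reduceMap (c t)) T := by
  rw [isNormalExtremalOn_iff] at hc
  intro t ht
  refine ⟨_, ((contDiff_reduceMap.differentiable omega_ne_zero' (c t)).hasFDerivAt.comp_hasDerivAt t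
    (hc t ht)), ?_⟩
  rw [magneticForm_eq_iff, fderiv_reduceMap, reduceDiff_hamVec, hC t ht]

/-- Order connectedness keeps the interval of integration inside `T`, where `φ` is known to be
continuous. -/
lemma exists_antiderivative {φ : ℝ → ℝ} {T : Set ℝ} (hT : IsOpen T) (hT' : T.OrdConnected)
    (hφ : ContinuousOn φ T) {t₀ : ℝ} (ht₀ : t₀ ∈ T) (z₀ : ℝ) :
    ∃ z : ℝ → ℝ, z t₀ = z₀ ∧ ∀ t ∈ T, HasDerivAt z (φ t) t := by
  refine ⟨fun t => z₀ + ∫ τ in t₀..t, φ τ, by simp, fun t ht => ?_⟩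
  refine HasDerivAt.const_add _ ?_
  have hsub : Set.uIcc t₀ t ⊆ T := hT'.uIcc_subset ht₀ ht
  refine intervalIntegral.integral_hasDerivAt_right
    ((hφ.mono hsub).intervalIntegrable) ?_ (hφ.continuousAt (hT.mem_nhds ht))
  exact hφ.stronglyMeasurableAtFilter hT t ht

/-- The reduced curve and `C` determine everything except `z`, and `z` is recovered by a quadrature.
-/
lemma exists_normalExtremal {C : ℝ} {b : ℝ → Phase (BI n)} {T : Set ℝ} (hT : IsOpen T)
    (hT' : T.OrdConnected) (hb : IsChargedMotionOn (magField C) hamRed b T) {t₀ : ℝ} (ht₀ : t₀ ∈ T)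
    (z₀ : ℝ) : ∃ c : ℝ → Phase (HI n), IsNormalExtremalOn c T ∧
      (∀ t ∈ T, pz (c t).2 = C ∧ reduceMap (c t) = b t) ∧ pz (c t₀).1 = z₀ := by
  have hb' : ∀ t ∈ T, HasDerivAt b (sharp (magField C) (b t) (fderiv ℝ hamRed (b t))) t := by
    intro t ht
    obtain ⟨v, hv, h⟩ := hb t ht
    rwa [(magneticForm_eq_iff C _ _ _).1 h] at hv
  -- This is `∂H/∂λ_{2n+1}` along the curve: varying `λ_{2n+1}` moves `p` in the direction `(y, 0)`.
  let φ : ℝ → ℝ := fun t => fderiv ℝ hamRed (b t) (0, Sum.elim (py (b t).1) 0)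
  have hbc : ContinuousOn b T := fun t ht => (hb' t ht).continuousAt.continuousWithinAt
  have hφ : ContinuousOn φ T := by
    have h1 : Continuous (fderiv ℝ (hamRed (n := n))) :=
      contDiff_hamRed.continuous_fderiv omega_ne_zero'
    have h2 : Continuous fun s : Phase (BI n) =>
        fderiv ℝ hamRed s ((0, Sum.elim (py s.1) 0) : Phase (BI n)) := by
      refine h1.clm_apply (continuous_const.prodMk (continuous_pi ?_))
      rintro (k | k)
      · simp only [Sum.elim_inl, py]; fun_prop
      · simp only [Sum.elim_inr, Pi.zero_apply]; fun_prop
    exact h2.comp_continuousOn hbc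
  obtain ⟨z, hz0, hz⟩ := exists_antiderivative hT hT' hφ ht₀ z₀
  refine ⟨fun t => sectionMap C (z t) (b t), ?_,
    fun t _ => ⟨rfl, reduceMap_sectionMap _ _ _⟩, hz0⟩
  rw [isNormalExtremalOn_iff]
  intro t ht
  have h := hb' t ht
  have hq : ∀ a, HasDerivAt (fun t => (b t).1 a) (fderiv ℝ hamRed (b t) (dirP a)) t :=
    fun a => hasDerivAt_pi.1 h.fst a
  have hp : ∀ a, HasDerivAt (fun t => (b t).2 a)
      ((sharp (magField C) (b t) (fderiv ℝ hamRed (b t))).2 a) t :=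
    fun a => hasDerivAt_pi.1 h.snd a
  set s := sectionMap C (z t) (b t) with hs
  have hsr : reduceMap s = b t := reduceMap_sectionMap _ _ _
  have hsz : pz s.2 = C := rfl
  refine HasDerivAt.prodMk (hasDerivAt_pi.2 ?_) (hasDerivAt_pi.2 ?_)
  · rintro (a | ⟨⟩)
    · change HasDerivAt (fun t => (b t).1 a) (fderiv ℝ hamR s (dirP (Sum.inl a))) t
      rw [fderiv_hamR, reduceDiff_dirP, hsr]
      exact hq a
    · change HasDerivAt z (fderiv ℝ hamR s (dirP (Sum.inr ()))) t
      rw [fderiv_hamR, reduceDiff_dirP_z, hsr]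
      exact hz t ht
  · rintro ((k | k) | ⟨⟩)
    · change HasDerivAt (fun t => (b t).2 (Sum.inl k) - C * (b t).1 (Sum.inr k))
        (-fderiv ℝ hamR s (dirQ (Sum.inl (Sum.inl k)))) t
      rw [fderiv_hamR, reduceDiff_dirQ_inl, hsr]
      refine ((hp (Sum.inl k)).sub ((hq (Sum.inr k)).const_mul C)).congr_deriv ?_
      rw [sharp_mag_inl]
      ring
    · change HasDerivAt (fun t => (b t).2 (Sum.inr k))
        (-fderiv ℝ hamR s (dirQ (Sum.inl (Sum.inr k)))) t
      rw [fderiv_hamR, reduceDiff_dirQ_inr, hsr, hsz]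
      refine (hp (Sum.inr k)).congr_deriv ?_
      rw [sharp_mag_inr, map_add, map_smul, smul_eq_mul]
      ring
    · change HasDerivAt (fun _ => C) (-fderiv ℝ hamR s (dirQ (Sum.inr ()))) t
      rw [fderiv_hamR, reduceDiff_dirQ_z, map_zero, neg_zero]
      exact hasDerivAt_const _ _

end Geodesics
end

/-! ### Hyperspherical coordinates: partial norms and plane radii. -/

noncomputable section

section Hyperspherical

variable {n : ℕ}

lemma ent_of_lt (a : Fin (2 * n) → ℝ) {j : ℕ} (h : j < 2 * n) : ent a j = a ⟨j, h⟩ := dif_pos h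

lemma ent_line (a v : Fin (2 * n) → ℝ) (t : ℝ) (j : ℕ) :
    ent (a + t • v) j = ent a j + t * ent v j := by
  unfold ent
  split_ifs <;> simp

lemma ent_single {i : ℕ} (hi : i < 2 * n) (j : ℕ) :
    ent (Pi.single ⟨i, hi⟩ 1 : Fin (2 * n) → ℝ) j = if j = i then 1 else 0 := by
  unfold ent
  by_cases h : j < 2 * n
  · simp [h, Pi.single_apply]
  · rw [dif_neg h, if_neg (by omega)]

lemma contDiff_ent (j : ℕ) : ContDiff ℝ ω fun a : Fin (2 * n) → ℝ => ent a j := by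
  unfold ent
  split_ifs <;> fun_prop

/-- The norm of the first `i` pairs of coordinates. -/
def hypNorm (a : Fin (2 * n) → ℝ) (i : ℕ) : ℝ :=
  ent a 0 * ∏ j ∈ Icc 1 (n - i), Real.cos (ent a j)

lemma hypNorm_top (a : Fin (2 * n) → ℝ) : hypNorm a n = ent a 0 := by simp [hypNorm]

/-- The partial norms are nested right triangles: the angle `θ_{n-i}` splits the hypotenuse `hypNorm
a (i + 1)` into `hypNorm a i` and the radius of the plane with zero-based index `i`. -/
lemma hypNorm_succ (a : Fin (2 * n) → ℝ) {i : ℕ} (hi : i < n) :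
    hypNorm a i = hypNorm a (i + 1) * Real.cos (ent a (n - i)) := by
  obtain ⟨d, hd⟩ : ∃ d, n - i = d + 1 := ⟨n - i - 1, by omega⟩
  have hd' : n - (i + 1) = d := by omega
  rw [hypNorm, hypNorm, hd, hd', Finset.prod_Icc_succ_top (by omega)]
  ring

lemma hypRad_zero (a : Fin (2 * n) → ℝ) (m : Fin n) (hm : (m : ℕ) = 0) :
    hypRad a m = hypNorm a 1 := by
  rw [hypRad, hypNorm, if_pos hm, hm, Nat.sub_zero, mul_one]

lemma hypRad_pos_idx (a : Fin (2 * n) → ℝ) (m : Fin n) (hm : (m : ℕ) ≠ 0) :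
    hypRad a m = hypNorm a (m + 1) * Real.sin (ent a (n - m)) := by
  rw [hypRad, hypNorm, if_neg hm, show n - 1 - (m : ℕ) = n - (m + 1) by omega]

lemma contDiff_hypRad (m : Fin n) : ContDiff ℝ ω fun a : Fin (2 * n) → ℝ => hypRad a m := by
  have h := contDiff_ent (n := n)
  unfold hypRad
  refine ((h 0).mul (contDiff_prod fun j _ => Real.contDiff_cos.comp (h j))).mul ?_
  split_ifs
  · exact contDiff_const
  · exact Real.contDiff_sin.comp (h _)

lemma contDiff_hyp : ContDiff ℝ ω (hyp (n := n)) := by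
  have h := contDiff_ent (n := n)
  rw [contDiff_pi]
  rintro (m | m)
  · exact (contDiff_hypRad m).mul (Real.contDiff_cos.comp (h _))
  · exact (contDiff_hypRad m).mul (Real.contDiff_sin.comp (h _))

section Domain

variable {a : Fin (2 * n) → ℝ}

lemma cos_pos_of_mem (ha : a ∈ hypDomain n) {j : ℕ} (h1 : 1 ≤ j) (h2 : j < n) : 0 < Real.cos (ent a j) := by
  obtain ⟨h3, h4⟩ := ha.2.1 j h1 h2
  exact Real.cos_pos_of_mem_Ioo ⟨by linarith [Real.pi_pos], h4⟩

lemma sin_pos_of_mem (ha : a ∈ hypDomain n) {j : ℕ} (h1 : 1 ≤ j) (h2 : j < n) : 0 < Real.sin (ent a j) := by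
  obtain ⟨h3, h4⟩ := ha.2.1 j h1 h2
  exact Real.sin_pos_of_mem_Ioo ⟨h3, by linarith [Real.pi_pos]⟩

lemma hypNorm_pos (ha : a ∈ hypDomain n) {i : ℕ} (hi : 1 ≤ i) : 0 < hypNorm a i := by
  refine mul_pos ha.1 (Finset.prod_pos fun j hj => ?_)
  rw [Finset.mem_Icc] at hj
  exact cos_pos_of_mem ha hj.1 (by omega)

lemma hypRad_pos (ha : a ∈ hypDomain n) (m : Fin n) : 0 < hypRad a m := by
  by_cases hm : (m : ℕ) = 0
  · rw [hypRad_zero a m hm]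
    exact hypNorm_pos ha le_rfl
  · rw [hypRad_pos_idx a m hm]
    exact mul_pos (hypNorm_pos ha (by omega)) (sin_pos_of_mem ha (by omega) (by omega))

end Domain

end Hyperspherical
end

/-! ### Momenta conjugate to the hyperspherical coordinates. -/

noncomputable section

section HypersphericalMomenta

variable {n : ℕ}

lemma fderiv_apply_of_line' {E W : Type*} [NormedAddCommGroup E] [NormedSpace ℝ E]
    [NormedAddCommGroup W] [NormedSpace ℝ W] {f : E → W} {s v : E} {d : W}
    (hf : DifferentiableAt ℝ f s) (h : HasDerivAt (fun t : ℝ => f (s + t • v)) d 0) :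
    fderiv ℝ f s v = d := by
  have h1 : HasLineDerivAt ℝ f (fderiv ℝ f s v) s v := hf.hasFDerivAt.hasLineDerivAt v
  exact HasDerivAt.unique h1 h

/-- The radial component of the momentum in the `m`-th coordinate plane. -/
def radMom (a : Fin (2 * n) → ℝ) (p : BI n → ℝ) (m : Fin n) : ℝ :=
  px p m * Real.cos (ent a (n + m)) + py p m * Real.sin (ent a (n + m))

/-- The angular component of the momentum in the `m`-th coordinate plane. -/
def angMom (a : Fin (2 * n) → ℝ) (p : BI n → ℝ) (m : Fin n) : ℝ :=
  py p m * Real.cos (ent a (n + m)) - px p m * Real.sin (ent a (n + m))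

lemma px_eq_radMom (a : Fin (2 * n) → ℝ) (p : BI n → ℝ) (m : Fin n) :
    px p m = radMom a p m * Real.cos (ent a (n + m)) - angMom a p m * Real.sin (ent a (n + m)) := by
  have h := Real.sin_sq_add_cos_sq (ent a (n + m))
  simp only [radMom, angMom]
  linear_combination (-px p m) * h

lemma py_eq_radMom (a : Fin (2 * n) → ℝ) (p : BI n → ℝ) (m : Fin n) :
    py p m = radMom a p m * Real.sin (ent a (n + m)) + angMom a p m * Real.cos (ent a (n + m)) := by
  have h := Real.sin_sq_add_cos_sq (ent a (n + m))
  simp only [radMom, angMom]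
  linear_combination (-py p m) * h

/-- In the polar frame of each plane a displacement has the radial part `dR` and the angular part `R
dφ`; the covector is decomposed in the same frame. -/
lemma dot_fderiv_hyp (a v : Fin (2 * n) → ℝ) (p : BI n → ℝ) {dR : Fin n → ℝ}
    (h : ∀ m, HasDerivAt (fun t : ℝ => hypRad (a + t • v) m) (dR m) 0) :
    p ⬝ᵥ fderiv ℝ hyp a v
      = ∑ m : Fin n, (radMom a p m * dR m + angMom a p m * hypRad a m * ent v (n + m)) := by
  have hφ : ∀ j, HasDerivAt (fun t : ℝ => ent (a + t • v) j) (ent v j) 0 := by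
    intro j
    simp only [ent_line]
    simpa using ((hasDerivAt_id (0 : ℝ)).mul_const (ent v j)).const_add (ent a j)
  have hd : fderiv ℝ hyp a v = Sum.elim
      (fun m : Fin n => dR m * Real.cos (ent a (n + m))
        + hypRad a m * (-Real.sin (ent a (n + m)) * ent v (n + m)))
      (fun m : Fin n => dR m * Real.sin (ent a (n + m))
        + hypRad a m * (Real.cos (ent a (n + m)) * ent v (n + m))) := by
    refine fderiv_apply_of_line' (contDiff_hyp.differentiable omega_ne_zero' a)
      (hasDerivAt_pi.2 ?_)
    rintro (m | m)
    · exact ((h m).mul (hφ (n + m)).cos).congr_deriv (by simp)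
    · exact ((h m).mul (hφ (n + m)).sin).congr_deriv (by simp)
  rw [hd, dot_BI]
  refine Finset.sum_congr rfl fun m _ => ?_
  simp only [px, py, Sum.elim_inl, Sum.elim_inr, radMom, angMom]
  ring

lemma hypRad_line_zero (a : Fin (2 * n) → ℝ) (hn : 0 < 2 * n) (t : ℝ) (m : Fin n) :
    hypRad (a + t • Pi.single ⟨0, hn⟩ 1) m * ent a 0 = hypRad a m * (ent a 0 + t) := by
  have h1 : ∏ j ∈ Icc 1 (n - 1 - m), Real.cos (ent (a + t • Pi.single ⟨0, hn⟩ 1) j)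
      = ∏ j ∈ Icc 1 (n - 1 - m), Real.cos (ent a j) := by
    refine Finset.prod_congr rfl fun j hj => ?_
    rw [Finset.mem_Icc] at hj
    rw [ent_line, ent_single, if_neg (by omega), mul_zero, add_zero]
  have h2 : ent (a + t • Pi.single ⟨0, hn⟩ 1) (n - m) = ent a (n - m) := by
    rw [ent_line, ent_single, if_neg (by omega), mul_zero, add_zero]
  rw [hypRad, hypRad, h1, h2, ent_line, ent_single, if_pos rfl]
  ring

lemma hypRad_line_ang (a : Fin (2 * n) → ℝ) {i : ℕ} (hi : n ≤ i) (hi' : i < 2 * n) (t : ℝ)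
    (m : Fin n) : hypRad (a + t • Pi.single ⟨i, hi'⟩ 1) m = hypRad a m := by
  have key : ∀ j, j < n → ent (a + t • Pi.single ⟨i, hi'⟩ 1) j = ent a j := by
    intro j hj
    rw [ent_line, ent_single, if_neg (by omega), mul_zero, add_zero]
  have h1 : ∏ j ∈ Icc 1 (n - 1 - m), Real.cos (ent (a + t • Pi.single ⟨i, hi'⟩ 1) j)
      = ∏ j ∈ Icc 1 (n - 1 - m), Real.cos (ent a j) := by
    refine Finset.prod_congr rfl fun j hj => ?_
    rw [Finset.mem_Icc] at hj
    rw [key j (by omega)]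
  rw [hypRad, hypRad, h1, key 0 (by omega)]
  congr 1
  split_ifs with h
  · rfl
  · rw [key _ (by omega)]

/-- Multiplying by `cos θ_j` states the change of a single factor without a division. -/
lemma prod_cos_line (a : Fin (2 * n) → ℝ) {j : ℕ} (hj1 : 1 ≤ j) (hj : j < 2 * n) (t : ℝ) (N : ℕ) :
    (∏ k ∈ Icc 1 N, Real.cos (ent (a + t • Pi.single ⟨j, hj⟩ 1) k)) * Real.cos (ent a j)
      = (∏ k ∈ Icc 1 N, Real.cos (ent a k))
        * if j ≤ N then Real.cos (ent a j + t) else Real.cos (ent a j) := by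
  split_ifs with h
  · have hmem : j ∈ Icc 1 N := Finset.mem_Icc.2 ⟨hj1, h⟩
    rw [← Finset.mul_prod_erase _ _ hmem, ← Finset.mul_prod_erase _ _ hmem]
    have : ∏ k ∈ (Icc 1 N).erase j, Real.cos (ent (a + t • Pi.single ⟨j, hj⟩ 1) k)
        = ∏ k ∈ (Icc 1 N).erase j, Real.cos (ent a k) := by
      refine Finset.prod_congr rfl fun k hk => ?_
      rw [ent_line, ent_single, if_neg (Finset.ne_of_mem_erase hk), mul_zero, add_zero]
    rw [this, ent_line, ent_single, if_pos rfl, mul_one]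
    ring
  · congr 1
    refine Finset.prod_congr rfl fun k hk => ?_
    rw [Finset.mem_Icc] at hk
    rw [ent_line, ent_single, if_neg (by omega), mul_zero, add_zero]

/-- The derivative of the radius in the `m`-th coordinate plane in the direction of the angle
`θ_{n-i}`. -/
def dHypRad (a : Fin (2 * n) → ℝ) (i : ℕ) (m : Fin n) : ℝ :=
  if (m : ℕ) < i then -(Real.sin (ent a (n - i)) / Real.cos (ent a (n - i))) * hypRad a m
  else if (m : ℕ) = i then Real.cos (ent a (n - i)) / Real.sin (ent a (n - i)) * hypRad a m
  else 0

/-- The angle `θ_{n-i}` enters the radii of the planes below `i` through a cosine, that of plane `i`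
through a sine, and the later ones not at all. -/
lemma hasDerivAt_hypRad_theta {a : Fin (2 * n) → ℝ} (ha : a ∈ hypDomain n) {i : ℕ} (hi : 1 ≤ i)
    (hin : i < n) (m : Fin n) :
    HasDerivAt (fun t : ℝ => hypRad (a + t • Pi.single ⟨n - i, by omega⟩ 1) m)
      (dHypRad a i m) 0 := by
  have hc := (cos_pos_of_mem ha (j := n - i) (by omega) (by omega)).ne'
  have hs := (sin_pos_of_mem ha (j := n - i) (by omega) (by omega)).ne'
  have h0 : ∀ t : ℝ, ent (a + t • Pi.single (⟨n - i, by omega⟩ : Fin (2 * n)) 1) 0 = ent a 0 := by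
    intro t
    rw [ent_line, ent_single, if_neg (by omega), mul_zero, add_zero]
  have hp := fun t => prod_cos_line a (j := n - i) (by omega) (by omega) t (n - 1 - m)
  have hadd : HasDerivAt (fun t : ℝ => ent a (n - i) + t) 1 0 :=
    (hasDerivAt_id (0 : ℝ)).const_add _
  rcases lt_trichotomy (m : ℕ) i with h | h | h
  · have e : (fun t : ℝ => hypRad (a + t • Pi.single ⟨n - i, by omega⟩ 1) m)
        = fun t => hypRad a m / Real.cos (ent a (n - i)) * Real.cos (ent a (n - i) + t) := by
      funext t
      have h1 := hp t
      rw [if_pos (by omega)] at h1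
      have h2 : (if (m : ℕ) = 0 then 1
          else Real.sin (ent (a + t • Pi.single (⟨n - i, by omega⟩ : Fin (2 * n)) 1) (n - m)))
          = if (m : ℕ) = 0 then 1 else Real.sin (ent a (n - m)) := by
        rw [ent_line, ent_single, if_neg (by omega : ¬ n - (m : ℕ) = n - i), mul_zero, add_zero]
      rw [hypRad, hypRad, h0, h2]
      field_simp
      linear_combination (ent a 0 * if (m : ℕ) = 0 then 1 else Real.sin (ent a (n - m))) * h1
    rw [e, dHypRad, if_pos h]
    refine (hadd.cos.const_mul _).congr_deriv ?_
    rw [add_zero]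
    field_simp
  · have e : (fun t : ℝ => hypRad (a + t • Pi.single ⟨n - i, by omega⟩ 1) m)
        = fun t => hypRad a m / Real.sin (ent a (n - i)) * Real.sin (ent a (n - i) + t) := by
      funext t
      have h1 := hp t
      rw [if_neg (by omega)] at h1
      have h1' := mul_right_cancel₀ hc h1
      rw [hypRad, hypRad, h0, h1', if_neg (by omega), if_neg (by omega), h, ent_line, ent_single,
        if_pos rfl, mul_one]
      field_simp
    rw [e, dHypRad, if_neg (by omega), if_pos h]
    refine (hadd.sin.const_mul _).congr_deriv ?_
    rw [add_zero]
    field_simp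
  · have e : (fun t : ℝ => hypRad (a + t • Pi.single ⟨n - i, by omega⟩ 1) m)
        = fun t => hypRad a m := by
      funext t
      have h1 := hp t
      rw [if_neg (by omega)] at h1
      have h1' := mul_right_cancel₀ hc h1
      rw [hypRad, hypRad, h0, h1', ent_line, ent_single,
        if_neg (by omega : ¬ n - (m : ℕ) = n - i), mul_zero, add_zero]
    rw [e, dHypRad, if_neg (by omega), if_neg (by omega)]
    exact hasDerivAt_const _ _

lemma ent_hypMom (a : Fin (2 * n) → ℝ) (p : BI n → ℝ) {j : ℕ} (hj : j < 2 * n) :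
    ent (hypMom a p) j = p ⬝ᵥ fderiv ℝ hyp a (Pi.single ⟨j, hj⟩ 1) := by
  rw [ent_of_lt _ hj, hypMom]

lemma hypMom_zero {a : Fin (2 * n) → ℝ} (ha : a ∈ hypDomain n) (hn : 1 ≤ n) (p : BI n → ℝ) :
    ent (hypMom a p) 0 = (∑ m, radMom a p m * hypRad a m) / ent a 0 := by
  have hr : ent a 0 ≠ 0 := ha.1.ne'
  rw [ent_hypMom a p (by omega : 0 < 2 * n),
    dot_fderiv_hyp a _ p (dR := fun m => hypRad a m / ent a 0), Finset.sum_div]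
  · refine Finset.sum_congr rfl fun m _ => ?_
    rw [ent_single, if_neg (by omega)]
    ring
  · intro m
    have e : (fun t : ℝ => hypRad (a + t • Pi.single ⟨0, by omega⟩ 1) m)
        = fun t => hypRad a m / ent a 0 * (ent a 0 + t) := by
      funext t
      have := hypRad_line_zero a (by omega) t m
      field_simp
      linarith
    rw [e]
    exact (((hasDerivAt_id (0 : ℝ)).const_add (ent a 0)).const_mul _).congr_deriv (mul_one _)

lemma hypMom_ang (a : Fin (2 * n) → ℝ) (p : BI n → ℝ) (m : Fin n) :
    ent (hypMom a p) (n + m) = angMom a p m * hypRad a m := by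
  rw [ent_hypMom a p (by omega : n + (m : ℕ) < 2 * n), dot_fderiv_hyp a _ p (dR := fun m => 0),
    Finset.sum_eq_single m]
  · rw [ent_single, if_pos rfl]
    ring
  · intro k _ hk
    have : (k : ℕ) ≠ m := fun h => hk (Fin.ext h)
    rw [ent_single, if_neg (by omega)]
    ring
  · simp
  · intro k
    simp only [hypRad_line_ang a (by omega : n ≤ n + (m : ℕ))]
    exact hasDerivAt_const _ _

/-- The extension by zero of a function on `Fin n`. -/
def natExt (f : Fin n → ℝ) (m : ℕ) : ℝ := if h : m < n then f ⟨m, h⟩ else 0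

lemma natExt_coe (f : Fin n → ℝ) (m : Fin n) : natExt f m = f m := dif_pos m.2

lemma sum_natExt (f : Fin n → ℝ) : ∑ m, f m = ∑ m ∈ range n, natExt f m := by
  rw [Finset.sum_range]
  exact Finset.sum_congr rfl fun m _ => (natExt_coe f m).symm

/-- The pairing of position and momentum in the first `i` coordinate planes. -/
def radDot (a : Fin (2 * n) → ℝ) (p : BI n → ℝ) (i : ℕ) : ℝ :=
  ∑ m ∈ range i, natExt (radMom a p) m * natExt (hypRad a) m

lemma hypMom_theta {a : Fin (2 * n) → ℝ} (ha : a ∈ hypDomain n) (p : BI n → ℝ) {i : ℕ}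
    (hi : 1 ≤ i) (hin : i < n) :
    ent (hypMom a p) (n - i) = natExt (radMom a p) i *
        (Real.cos (ent a (n - i)) / Real.sin (ent a (n - i)) * natExt (hypRad a) i)
      - Real.sin (ent a (n - i)) / Real.cos (ent a (n - i)) * radDot a p i := by
  rw [ent_hypMom a p (by omega : n - i < 2 * n),
    dot_fderiv_hyp a _ p (hasDerivAt_hypRad_theta ha hi hin)]
  obtain ⟨g, hg⟩ : ∃ g : ℕ → ℝ, g = fun m => natExt (radMom a p) m *
      (if m < i then -(Real.sin (ent a (n - i)) / Real.cos (ent a (n - i))) * natExt (hypRad a) m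
      else if m = i then Real.cos (ent a (n - i)) / Real.sin (ent a (n - i)) * natExt (hypRad a) m
      else 0) := ⟨_, rfl⟩
  have e1 : ∀ m : Fin n, radMom a p m * dHypRad a i m + angMom a p m * hypRad a m *
      ent (Pi.single (⟨n - i, by omega⟩ : Fin (2 * n)) 1) (n + m) = g m := by
    intro m
    rw [ent_single, if_neg (by omega), mul_zero, add_zero, dHypRad, hg]
    simp only [natExt_coe]
  rw [Finset.sum_congr rfl fun m _ => e1 m, Fin.sum_univ_eq_sum_range g n, hg]
  have hsub : range (i + 1) ⊆ range n := Finset.range_subset_range.2 (by omega)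
  rw [← Finset.sum_subset hsub, Finset.sum_range_succ, radDot, Finset.mul_sum]
  · have : ∀ m ∈ range i, natExt (radMom a p) m * (if m < i then
          -(Real.sin (ent a (n - i)) / Real.cos (ent a (n - i))) * natExt (hypRad a) m
        else if m = i then Real.cos (ent a (n - i)) / Real.sin (ent a (n - i)) * natExt (hypRad a) m
        else 0) = -(Real.sin (ent a (n - i)) / Real.cos (ent a (n - i)) *
          (natExt (radMom a p) m * natExt (hypRad a) m)) := by
      intro m hm
      rw [if_pos (Finset.mem_range.1 hm)]
      ring
    rw [Finset.sum_congr rfl this, Finset.sum_neg_distrib, if_neg (lt_irrefl i), if_pos rfl]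
    ring
  · intro m _ hm
    rw [Finset.mem_range, not_lt] at hm
    rw [if_neg (by omega), if_neg (by omega), mul_zero]

end HypersphericalMomenta
end

/-! ### The integrals in hyperspherical coordinates. -/

noncomputable section

section HypersphericalIntegrals

variable {n : ℕ} {a : Fin (2 * n) → ℝ}

lemma natExt_hypRad_zero (hn : 1 ≤ n) (a : Fin (2 * n) → ℝ) :
    natExt (hypRad a) 0 = hypNorm a 1 := by
  rw [natExt, dif_pos (by omega)]
  exact hypRad_zero a _ rfl

lemma natExt_hypRad {i : ℕ} (hi : 1 ≤ i) (hin : i < n) (a : Fin (2 * n) → ℝ) :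
    natExt (hypRad a) i = hypNorm a (i + 1) * Real.sin (ent a (n - i)) := by
  rw [natExt, dif_pos hin]
  exact hypRad_pos_idx a ⟨i, hin⟩ (by simp; omega)

lemma natExt_hypRad_pos (ha : a ∈ hypDomain n) {i : ℕ} (hin : i < n) :
    0 < natExt (hypRad a) i := by
  rw [natExt, dif_pos hin]
  exact hypRad_pos ha _

lemma hypNorm_sq_succ {i : ℕ} (hi : 1 ≤ i) (hin : i < n) (a : Fin (2 * n) → ℝ) :
    hypNorm a (i + 1) ^ 2 = hypNorm a i ^ 2 + natExt (hypRad a) i ^ 2 := by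
  rw [natExt_hypRad hi hin, hypNorm_succ a hin]
  linear_combination (-hypNorm a (i + 1) ^ 2) * Real.sin_sq_add_cos_sq (ent a (n - i))

lemma hypNorm_sq (a : Fin (2 * n) → ℝ) {i : ℕ} (hin : i < n) :
    hypNorm a (i + 1) ^ 2 = ∑ m ∈ range (i + 1), natExt (hypRad a) m ^ 2 := by
  induction i with
  | zero => simp [natExt_hypRad_zero (by omega : 1 ≤ n)]
  | succ i ih =>
    rw [hypNorm_sq_succ (by omega) hin, ih (by omega), Finset.sum_range_succ _ (i + 1)]

lemma sum_hypRad_sq (hn : 1 ≤ n) (a : Fin (2 * n) → ℝ) :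
    ∑ m, hypRad a m ^ 2 = ent a 0 ^ 2 := by
  obtain ⟨k, rfl⟩ : ∃ k, n = k + 1 := ⟨n - 1, by omega⟩
  rw [← hypNorm_top, hypNorm_sq a (Nat.lt_succ_self k), sum_natExt]
  refine Finset.sum_congr rfl fun m hm => ?_
  rw [Finset.mem_range] at hm
  simp [natExt, hm]

lemma tan_theta_eq (ha : a ∈ hypDomain n) {i : ℕ} (hi : 1 ≤ i) (hin : i < n) :
    Real.sin (ent a (n - i)) / Real.cos (ent a (n - i)) = natExt (hypRad a) i / hypNorm a i := by
  have hc := (cos_pos_of_mem ha (j := n - i) (by omega) (by omega)).ne'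
  have hN := (hypNorm_pos ha (i := i + 1) (by omega)).ne'
  rw [natExt_hypRad hi hin, hypNorm_succ a hin]
  field_simp

lemma cot_theta_eq (ha : a ∈ hypDomain n) {i : ℕ} (hi : 1 ≤ i) (hin : i < n) :
    Real.cos (ent a (n - i)) / Real.sin (ent a (n - i)) = hypNorm a i / natExt (hypRad a) i := by
  rw [← inv_div, tan_theta_eq ha hi hin, inv_div]

/-- This is the angular momentum of the rotation in the plane with the coordinates `(hypNorm a i,
R_i)`, where `radDot a p i / hypNorm a i` is the momentum along the first axis. -/
lemma hypMom_theta' (ha : a ∈ hypDomain n) (p : BI n → ℝ) {i : ℕ} (hi : 1 ≤ i) (hin : i < n) :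
    ent (hypMom a p) (n - i) = natExt (radMom a p) i * hypNorm a i
      - natExt (hypRad a) i / hypNorm a i * radDot a p i := by
  have hR := (natExt_hypRad_pos ha hin).ne'
  rw [hypMom_theta ha p hi hin, tan_theta_eq ha hi hin, cot_theta_eq ha hi hin,
    div_mul_cancel₀ _ hR]

lemma hypMom_ang' (a : Fin (2 * n) → ℝ) (p : BI n → ℝ) {m : ℕ} (hm : m < n) :
    ent (hypMom a p) (n + m) = natExt (angMom a p) m * natExt (hypRad a) m := by
  rw [natExt, dif_pos hm, natExt, dif_pos hm]
  exact hypMom_ang a p ⟨m, hm⟩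

lemma hypMom_zero' (ha : a ∈ hypDomain n) (hn : 1 ≤ n) (p : BI n → ℝ) :
    ent (hypMom a p) 0 = radDot a p n / hypNorm a n := by
  rw [hypMom_zero ha hn, hypNorm_top, radDot, sum_natExt]
  congr 1
  refine Finset.sum_congr rfl fun m hm => ?_
  rw [Finset.mem_range] at hm
  simp [natExt, hm]

lemma radDot_succ (a : Fin (2 * n) → ℝ) (p : BI n → ℝ) (i : ℕ) :
    radDot a p (i + 1) = radDot a p i + natExt (radMom a p) i * natExt (hypRad a) i :=
  Finset.sum_range_succ _ _

lemma radDot_one (a : Fin (2 * n) → ℝ) (p : BI n → ℝ) :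
    radDot a p 1 = natExt (radMom a p) 0 * natExt (hypRad a) 0 := by
  simp [radDot]

lemma hypRho_eq (ha : a ∈ hypDomain n) (p : BI n → ℝ) {k : ℕ} (hk : k < n) :
    hypRho (a, hypMom a p) k
      = hypNorm a (k + 1) ^ 2 * ∑ m ∈ range (k + 1), natExt (angMom a p) m ^ 2 := by
  induction k with
  | zero =>
    have h := hypMom_ang' a p hk
    rw [add_zero] at h
    simp only [hypRho, h, natExt_hypRad_zero (by omega : 1 ≤ n)]
    simp
    ring
  | succ k ih =>
    have hc := (cos_pos_of_mem ha (j := n - (k + 1)) (by omega) (by omega)).ne'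
    have hs := (sin_pos_of_mem ha (j := n - (k + 1)) (by omega) (by omega)).ne'
    rw [Finset.sum_range_succ _ (k + 1)]
    simp only [hypRho, ih (by omega), hypMom_ang' a p hk]
    rw [natExt_hypRad (by omega) hk, hypNorm_succ a hk]
    field_simp

lemma prod_cos_eq (ha : a ∈ hypDomain n) {i : ℕ} (hi : i < n) :
    ∏ k ∈ Icc 1 i, Real.cos (ent a (n - k)) = natExt (hypRad a) 0 / hypNorm a (i + 1) := by
  have hN := fun i => (hypNorm_pos ha (i := i + 1) (by omega)).ne'
  induction i with
  | zero =>
    rw [natExt_hypRad_zero (by omega : 1 ≤ n), div_self (hN 0)]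
    simp
  | succ i ih =>
    have h1 := hN i
    have h2 := hN (i + 1)
    rw [Finset.prod_Icc_succ_top (by omega), ih (by omega)]
    rw [hypNorm_succ a hi] at h1 ⊢
    have hc := right_ne_zero_of_mul h1
    field_simp

/-- Closed form of the recursion. Multiplied by `tan θ` and added to the momentum term, it makes the
terms with `radDot` cancel, leaving `R_0 P_i - R_i P_0` for the radial momenta `P`. -/
lemma hypVarrho_eq (ha : a ∈ hypDomain n) (p : BI n → ℝ) {i : ℕ} (hi : i < n) :
    hypVarrho (a, hypMom a p) i = natExt (hypRad a) 0 * radDot a p (i + 1) / hypNorm a (i + 1)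
      - natExt (radMom a p) 0 * hypNorm a (i + 1) := by
  have hN := fun i => (hypNorm_pos ha (i := i + 1) (by omega)).ne'
  induction i with
  | zero =>
    have h1 := hN 0
    rw [radDot_one, natExt_hypRad_zero (by omega : 1 ≤ n)]
    simp only [hypVarrho, zero_add] at h1 ⊢
    field_simp
    ring
  | succ i ih =>
    have h1 := hN i
    have h2 := hN (i + 1)
    have hc := (cos_pos_of_mem ha (j := n - (i + 1)) (by omega) (by omega)).ne'
    have hsq := hypNorm_sq_succ (by omega : 1 ≤ i + 1) hi a
    have hcos : Real.cos (ent a (n - (i + 1))) = hypNorm a (i + 1) / hypNorm a (i + 1 + 1) := by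
      rw [hypNorm_succ a hi]; field_simp
    have hsin : Real.sin (ent a (n - (i + 1))) = natExt (hypRad a) (i + 1) / hypNorm a (i + 1 + 1) := by
      rw [natExt_hypRad (by omega) hi]; field_simp
    simp only [hypVarrho, ih (by omega), hypMom_theta' ha p (by omega : 1 ≤ i + 1) hi,
      prod_cos_eq ha (by omega : i < n), hcos, hsin]
    rw [radDot_succ a p (i + 1)]
    field_simp
    -- The only relation needed is Pythagoras for consecutive partial norms.
    linear_combination (natExt (hypRad a) 0 * radDot a p (i + 1)) * hsq

/-- Each step is a rotation of the pair formed by the momentum along the partial position vector and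
the radial momentum of the next plane. It yields the momentum along the longer vector and the
normalized `p_θ`, with the same sum of squares. -/
lemma sum_radMom_sq (ha : a ∈ hypDomain n) (p : BI n → ℝ) {i : ℕ} (hi : i < n) :
    ∑ m ∈ range (i + 1), natExt (radMom a p) m ^ 2
      = (radDot a p (i + 1) / hypNorm a (i + 1)) ^ 2
        + ∑ j ∈ Icc 1 i, (ent (hypMom a p) (n - j) / hypNorm a (j + 1)) ^ 2 := by
  have hN := fun i => (hypNorm_pos ha (i := i + 1) (by omega)).ne'
  induction i with
  | zero =>
    have h1 := hN 0
    rw [radDot_one, natExt_hypRad_zero (by omega : 1 ≤ n)]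
    simp only [zero_add] at h1 ⊢
    simp [h1]
  | succ i ih =>
    have h1 := hN i
    have h2 := hN (i + 1)
    have hsq := hypNorm_sq_succ (by omega : 1 ≤ i + 1) hi a
    rw [Finset.sum_range_succ _ (i + 1), ih (by omega), Finset.sum_Icc_succ_top (by omega),
      hypMom_theta' ha p (by omega : 1 ≤ i + 1) hi, radDot_succ a p (i + 1)]
    have key : (radDot a p (i + 1) / hypNorm a (i + 1)) ^ 2 + natExt (radMom a p) (i + 1) ^ 2
        = ((radDot a p (i + 1) + natExt (radMom a p) (i + 1) * natExt (hypRad a) (i + 1))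
            / hypNorm a (i + 1 + 1)) ^ 2
          + ((natExt (radMom a p) (i + 1) * hypNorm a (i + 1)
            - natExt (hypRad a) (i + 1) / hypNorm a (i + 1) * radDot a p (i + 1))
            / hypNorm a (i + 1 + 1)) ^ 2 := by
      field_simp
      linear_combination (radDot a p (i + 1) ^ 2
        + natExt (radMom a p) (i + 1) ^ 2 * hypNorm a (i + 1) ^ 2) * hsq
    linear_combination key

lemma dot_self_eq_radMom (a : Fin (2 * n) → ℝ) (p : BI n → ℝ) :
    p ⬝ᵥ p = ∑ m ∈ range n, natExt (radMom a p) m ^ 2 + ∑ m ∈ range n, natExt (angMom a p) m ^ 2 := by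
  rw [dot_BI, ← Finset.sum_add_distrib, Finset.sum_range]
  refine Finset.sum_congr rfl fun m _ => ?_
  rw [natExt_coe, natExt_coe, radMom, angMom]
  linear_combination (-(px p m ^ 2 + py p m ^ 2)) * Real.sin_sq_add_cos_sq (ent a (n + m))

/-- The squared norm of the momentum in hyperspherical coordinates. -/
lemma dot_self_eq_hypMom (hn : 1 ≤ n) (ha : a ∈ hypDomain n) (p : BI n → ℝ) :
    p ⬝ᵥ p = ent (hypMom a p) 0 ^ 2
      + ∑ j ∈ Icc 1 (n - 1), (ent (hypMom a p) (n - j) / hypNorm a (j + 1)) ^ 2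
      + ∑ m ∈ range n, natExt (angMom a p) m ^ 2 := by
  have h := sum_radMom_sq ha p (i := n - 1) (by omega)
  rw [Nat.sub_add_cancel hn] at h
  rw [dot_self_eq_radMom a, h, hypMom_zero' ha hn]

/-- The squared norm of `p` is a combination of squares of quantities that vanish with the
hyperspherical momenta. -/
lemma hypMom_injective (hn : 1 ≤ n) (ha : a ∈ hypDomain n) {p : BI n → ℝ} (h : hypMom a p = 0) :
    p = 0 := by
  have h0 : ∀ j, ent (hypMom a p) j = 0 := by
    intro j
    rw [h, ent]
    split_ifs <;> rfl
  have hγ : ∀ m ∈ range n, natExt (angMom a p) m ^ 2 = 0 := by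
    intro m hm
    rw [Finset.mem_range] at hm
    have h1 := hypMom_ang' a p hm
    rw [h0] at h1
    have := (mul_eq_zero.1 h1.symm).resolve_right (natExt_hypRad_pos ha hm).ne'
    rw [this]; ring
  apply dotProduct_self_eq_zero.1
  rw [dot_self_eq_hypMom hn ha p, Finset.sum_eq_zero hγ]
  simp [h0]

lemma omQP_hyp (a : Fin (2 * n) → ℝ) (p : BI n → ℝ) :
    omQP (hyp a, p) = -∑ m : Fin n, angMom a p m * hypRad a m := by
  rw [omQP_eq, ← Finset.sum_neg_distrib]
  refine Finset.sum_congr rfl fun m _ => ?_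
  simp only [hyp, px, py, Sum.elim_inl, Sum.elim_inr, angMom]
  ring

lemma sqQ_hyp (hn : 1 ≤ n) (a : Fin (2 * n) → ℝ) (p : BI n → ℝ) :
    sqQ (hyp a, p) = ent a 0 ^ 2 := by
  rw [sqQ, dot_BI, ← sum_hypRad_sq hn]
  refine Finset.sum_congr rfl fun m _ => ?_
  simp only [hyp, px, py, Sum.elim_inl, Sum.elim_inr]
  linear_combination hypRad a m ^ 2 * Real.sin_sq_add_cos_sq (ent a (n + m))

lemma hypHam_eq (hn : 1 ≤ n) (ha : a ∈ hypDomain n) (p : BI n → ℝ) :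
    hypHam (a, hypMom a p) = hamRed (hyp a, p) := by
  have hr : ent a 0 ≠ 0 := ha.1.ne'
  have e1 : ∑ k ∈ Icc n (2 * n - 1), ent (hypMom a p) k
      = ∑ m : Fin n, angMom a p m * hypRad a m := by
    have : Icc n (2 * n - 1) = (range n).image (fun m => n + m) := by
      ext k
      simp only [Finset.mem_Icc, Finset.mem_image, Finset.mem_range]
      exact ⟨fun h => ⟨k - n, by omega, by omega⟩, by rintro ⟨m, h1, rfl⟩; omega⟩
    rw [this, Finset.sum_image (fun x _ y _ h => by simpa using h), Finset.sum_range]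
    exact Finset.sum_congr rfl fun m _ => hypMom_ang a p m
  have e2 : 1 / ent a 0 ^ 2 * ∑ k ∈ Icc 1 (n - 1),
        ent (hypMom a p) k ^ 2 / ∏ j ∈ Icc 1 (k - 1), Real.cos (ent a j) ^ 2
      = ∑ j ∈ Icc 1 (n - 1), (ent (hypMom a p) (n - j) / hypNorm a (j + 1)) ^ 2 := by
    rw [Finset.mul_sum]
    -- The angles are numbered from the outermost triangle inwards and the planes from the inside
    -- outwards, hence the reversal `j ↦ n - j`.
    refine Finset.sum_nbij' (fun j => n - j) (fun j => n - j) ?_ ?_ ?_ ?_ ?_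
    · intro j hj; rw [Finset.mem_Icc] at *; omega
    · intro j hj; rw [Finset.mem_Icc] at *; omega
    · intro j hj; rw [Finset.mem_Icc] at hj; omega
    · intro j hj; rw [Finset.mem_Icc] at hj; omega
    · intro j hj
      rw [Finset.mem_Icc] at hj
      rw [hypNorm, show n - (n - j + 1) = j - 1 by omega, show n - (n - j) = j by omega,
        Finset.prod_pow, div_pow, mul_pow]
      rw [div_mul_div_comm, one_mul]
  have e3 : hypRho (a, hypMom a p) (n - 1)
      = ent a 0 ^ 2 * ∑ m ∈ range n, natExt (angMom a p) m ^ 2 := by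
    rw [hypRho_eq ha p (by omega), Nat.sub_add_cancel hn, hypNorm_top]
  rw [hamRed_eq, omQP_hyp, sqQ_hyp hn, sqP, dot_self_eq_hypMom hn ha p, hypHam]
  simp only [e1, e2, e3]
  field_simp

lemma hypAng_eq (C : ℝ) (a : Fin (2 * n) → ℝ) (p : BI n → ℝ) (m : Fin n) :
    hypAng C m (a, hypMom a p) = redAng C m (hyp a, p) := by
  have h1 : hypRad a m ^ 2 = ent a 0 ^ 2 * (∏ k ∈ Icc 1 (n - 1 - m), Real.cos (ent a k) ^ 2)
      * (if (m : ℕ) = 0 then 1 else Real.sin (ent a (n - m)) ^ 2) := by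
    rw [hypRad, mul_pow, mul_pow, Finset.prod_pow]
    congr 1
    split_ifs <;> simp
  have h2 : hypAng C m (a, hypMom a p)
      = ent (hypMom a p) (n + m) + 1 / 2 * hypRad a m ^ 2 * C := by
    rw [h1, hypAng]
    ring
  rw [h2, hypMom_ang]
  simp only [redAng, hyp, px, py, Sum.elim_inl, Sum.elim_inr, angMom]
  linear_combination (-(1 / 2 * C * hypRad a m ^ 2)) * Real.sin_sq_add_cos_sq (ent a (n + m))

/-- Removing the polar phases multiplies the minor by a number of modulus one. -/
lemma redQuad_hyp (a : Fin (2 * n) → ℝ) (p : BI n → ℝ) (k : Fin (n - 1)) :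
    redQuad k (hyp a, p)
      = (hypRad a (firstPos k) * angMom a p (nextPos k)
          - hypRad a (nextPos k) * angMom a p (firstPos k)) ^ 2
        + (hypRad a (firstPos k) * radMom a p (nextPos k)
          - hypRad a (nextPos k) * radMom a p (firstPos k)) ^ 2 := by
  have h1 := Real.cos_sq_add_sin_sq (ent a (n + (firstPos k : Fin n)))
  have h2 := Real.cos_sq_add_sin_sq (ent a (n + (nextPos k : Fin n)))
  have e : ∀ m, px (hyp a) m = hypRad a m * Real.cos (ent a (n + m)) := fun _ => rfl
  have e' : ∀ m, py (hyp a) m = hypRad a m * Real.sin (ent a (n + m)) := fun _ => rfl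
  simp only [redQuad, e, e', px_eq_radMom a p, py_eq_radMom a p]
  generalize Real.cos (ent a (n + (firstPos k : Fin n))) = c₁ at *
  generalize Real.sin (ent a (n + (firstPos k : Fin n))) = s₁ at *
  generalize Real.cos (ent a (n + (nextPos k : Fin n))) = c₂ at *
  generalize Real.sin (ent a (n + (nextPos k : Fin n))) = s₂ at *
  generalize hypRad a (firstPos k) = r₁
  generalize hypRad a (nextPos k) = r₂
  generalize radMom a p (firstPos k) = R₁
  generalize radMom a p (nextPos k) = R₂
  generalize angMom a p (firstPos k) = T₁
  generalize angMom a p (nextPos k) = T₂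
  -- Inserting the two factors equal to one turns the claim into a polynomial identity.
  trans ((r₁ * T₂ - r₂ * T₁) ^ 2 + (r₁ * R₂ - r₂ * R₁) ^ 2)
      * ((c₁ ^ 2 + s₁ ^ 2) * (c₂ ^ 2 + s₂ ^ 2))
  · ring
  · rw [h1, h2]
    ring

lemma hypQuad_eq (ha : a ∈ hypDomain n) (p : BI n → ℝ) (k : Fin (n - 1)) :
    hypQuad k (a, hypMom a p) = redQuad k (hyp a, p) := by
  have hk : (k : ℕ) + 1 < n := by omega
  have hc := (cos_pos_of_mem ha (j := n - (k + 1)) (by omega) (by omega)).ne'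
  have hs := (sin_pos_of_mem ha (j := n - (k + 1)) (by omega) (by omega)).ne'
  have hN := (hypNorm_pos ha (i := (k : ℕ) + 1) (by omega)).ne'
  have hR := (natExt_hypRad_pos ha hk).ne'
  have hR0 := (natExt_hypRad_pos ha (by omega : 0 < n)).ne'
  have hpn : ent (hypMom a p) n = natExt (angMom a p) 0 * natExt (hypRad a) 0 :=
    hypMom_ang' a p (by omega : 0 < n)
  -- The separate formula for the first quadratic integral is the general one with empty products;
  -- this uses `1/cos² = 1 + tan²` and `1/sin² = 1 + cot²`.
  have hgen : hypQuad k (a, hypMom a p)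
      = (ent (hypMom a p) n * (∏ j ∈ Icc 1 (k : ℕ), (Real.cos (ent a (n - j)))⁻¹)
            * Real.tan (ent a (n - (k + 1)))
          - ent (hypMom a p) (n + (k + 1)) * (∏ j ∈ Icc 1 (k : ℕ), Real.cos (ent a (n - j)))
            * Real.cot (ent a (n - (k + 1)))) ^ 2
        + (ent (hypMom a p) (n - (k + 1)) * (∏ j ∈ Icc 1 (k : ℕ), Real.cos (ent a (n - j)))
          + hypVarrho (a, hypMom a p) k * Real.tan (ent a (n - (k + 1)))) ^ 2 := by
    rw [hypQuad]
    simp only [Nat.add_sub_cancel]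
    split_ifs with h
    · have h0 : (k : ℕ) = 0 := by omega
      rw [h0] at hc hs ⊢
      simp only [zero_add] at hc hs ⊢
      rw [Real.tan_eq_sin_div_cos, Real.cot_eq_cos_div_sin]
      simp only [hypVarrho, Finset.Icc_eq_empty_of_lt zero_lt_one, Finset.prod_empty, mul_one,
        zero_mul, add_zero]
      have h1 : Real.sin (ent a (n - 1)) ^ 2 = 1 - Real.cos (ent a (n - 1)) ^ 2 :=
        Real.sin_sq _
      have h2 : ∀ A B p c s : ℝ, c ≠ 0 → s ≠ 0 → s ^ 2 = 1 - c ^ 2 →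
          p ^ 2 - (A + B) ^ 2 + A ^ 2 / c ^ 2 + B ^ 2 / s ^ 2
            = (A * (s / c) - B * (c / s)) ^ 2 + p ^ 2 := by
        intro A B p c s hc hs h
        have e1 : A ^ 2 / c ^ 2 = A ^ 2 + (A * (s / c)) ^ 2 := by
          field_simp
          linear_combination (-A ^ 2) * h
        have e2 : B ^ 2 / s ^ 2 = B ^ 2 + (B * (c / s)) ^ 2 := by
          field_simp
          linear_combination (-B ^ 2) * h
        have e3 : (A * (s / c)) * (B * (c / s)) = A * B := by
          field_simp
        rw [e1, e2]
        linear_combination 2 * e3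
      exact h2 _ _ _ _ _ hc hs h1
    · rfl
  have e0 : natExt (hypRad a) 0 = hypRad a (firstPos k) := natExt_coe _ (firstPos k)
  have e1 : natExt (hypRad a) (k + 1) = hypRad a (nextPos k) := natExt_coe _ (nextPos k)
  have e2 : natExt (radMom a p) 0 = radMom a p (firstPos k) := natExt_coe _ (firstPos k)
  have e3 : natExt (radMom a p) (k + 1) = radMom a p (nextPos k) := natExt_coe _ (nextPos k)
  have e4 : natExt (angMom a p) 0 = angMom a p (firstPos k) := natExt_coe _ (firstPos k)
  have e5 : natExt (angMom a p) (k + 1) = angMom a p (nextPos k) := natExt_coe _ (nextPos k)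
  rw [hgen, redQuad_hyp, Finset.prod_inv_distrib, prod_cos_eq ha (by omega : (k : ℕ) < n),
    Real.tan_eq_sin_div_cos, Real.cot_eq_cos_div_sin, tan_theta_eq ha (by omega) hk,
    cot_theta_eq ha (by omega) hk, hypVarrho_eq ha p (by omega), hypMom_theta' ha p (by omega) hk,
    hypMom_ang' a p hk, hpn, ← e0, ← e1, ← e2, ← e3, ← e4, ← e5]
  field_simp
  ring

end HypersphericalIntegrals
end

/-! ### Transport of the bracket by the cotangent lift of the chart. -/

noncomputable section
section HypersphericalBracket

variable {n : ℕ} {a : Fin (2 * n) → ℝ}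

lemma isOpen_hypDomain (n : ℕ) : IsOpen (hypDomain n) := by
  have hc : ∀ j, Continuous fun a : Fin (2 * n) → ℝ => ent a j := fun j =>
    (contDiff_ent j).continuous
  have : hypDomain n = {a | 0 < ent a 0} ∩
      ((⋂ j ∈ Finset.Ico 1 n, {a | ent a j ∈ Set.Ioo 0 (Real.pi / 2)}) ∩
        ⋂ j ∈ Finset.Ico n (2 * n), {a | ent a j ∈ Set.Ioo (-Real.pi) Real.pi}) := by
    ext a
    simp [hypDomain]
  rw [this]
  exact (isOpen_lt continuous_const (hc 0)).inter
    ((isOpen_biInter_finset fun j _ => isOpen_Ioo.preimage (hc j)).inter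
      (isOpen_biInter_finset fun j _ => isOpen_Ioo.preimage (hc j)))

/-- The momenta of a point, as a linear map. -/
def hypMomCLM (a : Fin (2 * n) → ℝ) : (BI n → ℝ) →L[ℝ] (Fin (2 * n) → ℝ) :=
  LinearMap.toContinuousLinearMap
    { toFun := hypMom a
      map_add' := fun p p' => by ext i; simp [hypMom, add_dotProduct]
      map_smul' := fun t p => by ext i; simp [hypMom, smul_dotProduct] }

lemma hypMomCLM_apply (a : Fin (2 * n) → ℝ) (p : BI n → ℝ) : hypMomCLM a p = hypMom a p := rfl

lemma hypMom_bijective (hn : 1 ≤ n) (ha : a ∈ hypDomain n) : Function.Bijective (hypMom a) := by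
  have hinj : Function.Injective (hypMomCLM a : (BI n → ℝ) →ₗ[ℝ] (Fin (2 * n) → ℝ)) :=
    (injective_iff_map_eq_zero _).2 fun p hp => hypMom_injective hn ha hp
  have hcard : Module.finrank ℝ (BI n → ℝ) = Module.finrank ℝ (Fin (2 * n) → ℝ) := by
    simp [two_mul]
  exact ⟨hinj, (LinearMap.injective_iff_surjective_of_finrank_eq_finrank hcard).1 hinj⟩

lemma contDiff_hypMom (p : BI n → ℝ) :
    ContDiff ℝ ω fun a : Fin (2 * n) → ℝ => hypMom a p := by
  rw [contDiff_pi]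
  intro i
  unfold hypMom dotProduct
  refine ContDiff.sum fun b _ => contDiff_const.mul ?_
  exact (contDiff_apply (𝕜 := ℝ) (E := ℝ) b).comp
    ((contDiff_hyp.fderiv_right (m := ω) (by simp)).clm_apply contDiff_const)

lemma contDiff_hypMomCLM : ContDiff ℝ ω (hypMomCLM (n := n)) :=
  contDiff_clm_apply_iff.2 contDiff_hypMom

lemma fderiv_hypMom (a : Fin (2 * n) → ℝ) (p : BI n → ℝ) (w : Fin (2 * n) → ℝ) (i : Fin (2 * n)) :
    fderiv ℝ (fun a' => hypMom a' p) a w i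
      = p ⬝ᵥ fderiv ℝ (fderiv ℝ (hyp (n := n))) a w (Pi.single i 1) := by
  have h1 : HasFDerivAt (fderiv ℝ (hyp (n := n))) (fderiv ℝ (fderiv ℝ (hyp (n := n))) a) a :=
    ((contDiff_hyp.fderiv_right (m := ω) (by simp)).differentiable (by simp) a).hasFDerivAt
  have h2 := (contDiff_hypMom p).differentiable (by simp) a
  have h3 : HasFDerivAt (fun a' => hypMom a' p i) _ a :=
    HasFDerivAt.fun_sum (u := Finset.univ) fun b _ => (((hasFDerivAt_pi'.1
      (h1.clm_apply (hasFDerivAt_const (Pi.single i (1 : ℝ)) a))) b).const_mul (p b))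
  have h4 := (hasFDerivAt_pi'.1 h2.hasFDerivAt) i
  have h5 := congrArg (fun L => L w) (h4.unique h3)
  simpa [dotProduct] using h5

/-- `F`, in hyperspherical coordinates, represents the function `f` of the coordinates `(q, p)`. -/
def IsHypForm (F : Phase (Fin (2 * n)) → ℝ) (f : Phase (BI n) → ℝ) : Prop :=
  ∀ a ∈ hypDomain n, ∀ p : BI n → ℝ, F (a, hypMom a p) = f (hyp a, p)

/-- Near the point, `F` is `f` composed with the chart and the inverse of the momentum isomorphism,
and inversion of linear maps is smooth. -/
lemma IsHypForm.differentiableAt (hn : 1 ≤ n) {F : Phase (Fin (2 * n)) → ℝ}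
    {f : Phase (BI n) → ℝ} (h : IsHypForm F f) (hf : Differentiable ℝ f) (ha : a ∈ hypDomain n)
    (P : Fin (2 * n) → ℝ) : DifferentiableAt ℝ F (a, P) := by
  have he : ∀ a' ∈ hypDomain n, ∃ e : (BI n → ℝ) ≃L[ℝ] (Fin (2 * n) → ℝ),
      (e : (BI n → ℝ) →L[ℝ] (Fin (2 * n) → ℝ)) = hypMomCLM a' := fun a' ha' =>
    ⟨(LinearEquiv.ofBijective (hypMomCLM a' : (BI n → ℝ) →ₗ[ℝ] (Fin (2 * n) → ℝ))
      (hypMom_bijective hn ha')).toContinuousLinearEquiv, by ext; rfl⟩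
  have hinv : DifferentiableAt ℝ (fun a' => (hypMomCLM a').inverse) a := by
    obtain ⟨e, he⟩ := he a ha
    have h1 : ContDiffAt ℝ ω ContinuousLinearMap.inverse (hypMomCLM a) :=
      he ▸ contDiffAt_map_inverse e
    exact (h1.comp a contDiff_hypMomCLM.contDiffAt).differentiableAt (by simp)
  have hloc : F =ᶠ[nhds (a, P)]
      fun s => f (hyp s.1, (hypMomCLM s.1).inverse s.2) := by
    have h1 : ∀ᶠ s : Phase (Fin (2 * n)) in nhds (a, P), s.1 ∈ hypDomain n :=
      continuous_fst.continuousAt.eventually ((isOpen_hypDomain n).mem_nhds ha)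
    filter_upwards [h1] with s hs
    obtain ⟨e, he⟩ := he s.1 hs
    rw [← h s.1 hs, ← hypMomCLM_apply, ← he, ContinuousLinearMap.inverse_equiv]
    simp
  refine DifferentiableAt.congr_of_eventuallyEq ?_ hloc
  have h2 : DifferentiableAt ℝ (fun s : Phase (Fin (2 * n)) => (hypMomCLM s.1).inverse) (a, P) :=
    DifferentiableAt.comp (g := fun a' => (hypMomCLM a').inverse) (a, P) hinv differentiableAt_fst
  exact (hf _).comp (a, P) (DifferentiableAt.prodMk
    (DifferentiableAt.comp (g := hyp) (a, P) (contDiff_hyp.differentiable (by simp) a)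
      differentiableAt_fst)
    (h2.clm_apply differentiableAt_snd))

lemma IsHypForm.fderiv_momentum {F : Phase (Fin (2 * n)) → ℝ} {f : Phase (BI n) → ℝ}
    (h : IsHypForm F f) (hf : Differentiable ℝ f) (ha : a ∈ hypDomain n) (p : BI n → ℝ)
    (hF : DifferentiableAt ℝ F (a, hypMom a p)) (v : BI n → ℝ) :
    fderiv ℝ F (a, hypMom a p) (0, hypMom a v) = fderiv ℝ f (hyp a, p) (0, v) := by
  have h1 : HasFDerivAt (fun p' => F (a, hypMomCLM a p')) _ p :=
    HasFDerivAt.comp p (g := F) (f := fun p' => (a, hypMomCLM a p')) hF.hasFDerivAt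
      ((hasFDerivAt_const a p).prodMk (hypMomCLM a).hasFDerivAt)
  have h2 : HasFDerivAt (fun p' => f (hyp a, p')) _ p :=
    HasFDerivAt.comp p (g := f) (f := fun p' => (hyp a, p')) (hf _).hasFDerivAt
      ((hasFDerivAt_const _ p).prodMk (hasFDerivAt_id p))
  have h3 : (fun p' => F (a, hypMomCLM a p')) = fun p' => f (hyp a, p') := funext (h a ha)
  rw [h3] at h1
  simpa [hypMomCLM_apply] using congrArg (fun L => L v) (h1.unique h2)

/-- Moving `a` with the Cartesian covector `p` fixed also moves the hyperspherical momenta, so a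
second derivative of the chart enters. -/
lemma IsHypForm.fderiv_position {F : Phase (Fin (2 * n)) → ℝ} {f : Phase (BI n) → ℝ}
    (h : IsHypForm F f) (hf : Differentiable ℝ f) (ha : a ∈ hypDomain n) (p : BI n → ℝ)
    (hF : DifferentiableAt ℝ F (a, hypMom a p)) (w : Fin (2 * n) → ℝ) :
    fderiv ℝ F (a, hypMom a p) (w, fderiv ℝ (fun a' => hypMom a' p) a w)
      = fderiv ℝ f (hyp a, p) (fderiv ℝ hyp a w, 0) := by
  have hm := ((contDiff_hypMom p).differentiable (by simp) a).hasFDerivAt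
  have hh := (contDiff_hyp.differentiable (by simp) a).hasFDerivAt
  have h1 : HasFDerivAt (fun a' => F (a', hypMom a' p)) _ a :=
    HasFDerivAt.comp a (g := F) (f := fun a' => (a', hypMom a' p)) hF.hasFDerivAt
      ((hasFDerivAt_id a).prodMk hm)
  have h2 : HasFDerivAt (fun a' => f (hyp a', p)) _ a :=
    HasFDerivAt.comp a (g := f) (f := fun a' => (hyp a', p)) (hf _).hasFDerivAt
      (hh.prodMk (hasFDerivAt_const p a))
  have h3 : (fun a' => F (a', hypMom a' p)) =ᶠ[nhds a] fun a' => f (hyp a', p) := by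
    filter_upwards [(isOpen_hypDomain n).mem_nhds ha] with a' ha' using h a' ha' p
  simpa using congrArg (fun L => L w) ((h1.congr_of_eventuallyEq h3.symm).unique h2)

lemma magField_sum_sum {ι : Type*} [Fintype ι] (C : ℝ) (q : BI n → ℝ) (e : ι → BI n → ℝ)
    (u v : ι → ℝ) :
    ∑ i, ∑ j, magField C q (e i) (e j) * u i * v j
      = magField C q (∑ i, u i • e i) (∑ j, v j • e j) := by
  let B : LinearMap.BilinForm ℝ (BI n → ℝ) := LinearMap.mk₂ ℝ (magField C q)
    (fun v v' w => by
      simp only [magField, ← mul_add, ← Finset.sum_add_distrib]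
      exact congrArg _ (Finset.sum_congr rfl fun k _ => by simp [px, py]; ring))
    (fun t v w => by
      simp only [magField, smul_eq_mul, mul_left_comm t, Finset.mul_sum]
      exact Finset.sum_congr rfl fun k _ => by
        simp only [px, py, Pi.smul_apply, smul_eq_mul]
        ring)
    (fun v w w' => by
      simp only [magField, ← mul_add, ← Finset.sum_add_distrib]
      exact congrArg _ (Finset.sum_congr rfl fun k _ => by simp [px, py]; ring))
    (fun t v w => by
      simp only [magField, smul_eq_mul, mul_left_comm t, Finset.mul_sum]
      exact Finset.sum_congr rfl fun k _ => by
        simp only [px, py, Pi.smul_apply, smul_eq_mul]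
        ring)
  change ∑ i, ∑ j, B (e i) (e j) * u i * v j = B (∑ i, u i • e i) (∑ j, v j • e j)
  simp only [map_sum, map_smul, LinearMap.sum_apply, LinearMap.smul_apply, smul_eq_mul,
    Finset.mul_sum]
  rw [Finset.sum_comm]
  refine Finset.sum_congr rfl fun j _ => Finset.sum_congr rfl fun i _ => by ring

lemma bracket_eq_dot {ι : Type} [Fintype ι] [DecidableEq ι] (F : FormField ι) (f g : Phase ι → ℝ)
    (s : Phase ι) :
    bracket F f g s
      = fderiv ℝ f s (fun i => fderiv ℝ g s (dirP i), 0)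
        - fderiv ℝ g s (fun i => fderiv ℝ f s (dirP i), 0)
        + ∑ i, ∑ j, F s.1 (Pi.single i 1) (Pi.single j 1)
            * fderiv ℝ f s (dirP i) * fderiv ℝ g s (dirP j) := by
  rw [clm_apply_phase (fderiv ℝ f s), clm_apply_phase (fderiv ℝ g s), bracket, poissonTensor,
    ← Finset.sum_sub_distrib]
  congr 1
  exact Finset.sum_congr rfl fun i _ => by simp; ring

lemma pi_eq_sum_single {ι : Type*} [Fintype ι] [DecidableEq ι] (u : ι → ℝ) :
    ∑ i, u i • (Pi.single i 1 : ι → ℝ) = u := by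
  ext j
  simp [Finset.sum_apply, Pi.single_apply]

/-- The bracket of `hypField` represents that of `magField`. -/
lemma IsHypForm.bracket (hn : 1 ≤ n) (C : ℝ) {F G : Phase (Fin (2 * n)) → ℝ}
    {f g : Phase (BI n) → ℝ} (hFf : IsHypForm F f) (hGg : IsHypForm G g)
    (hf : Differentiable ℝ f) (hg : Differentiable ℝ g) :
    IsHypForm (bracket (hypField n C) F G) (bracket (magField C) f g) := by
  intro a ha p
  have hF := hFf.differentiableAt hn hf ha (hypMom a p)
  have hG := hGg.differentiableAt hn hg ha (hypMom a p)
  set A := fderiv ℝ (hyp (n := n)) a with hA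
  set D := fderiv ℝ (fderiv ℝ (hyp (n := n))) a with hD
  have hsym : ∀ v w, D v w = D w v := fun v w =>
    (contDiff_hyp.contDiffAt.isSymmSndFDerivAt (by simp)) v w
  -- Derivatives in the momenta are vectors, and the differential of the chart pushes them forward.
  have key : ∀ {F : Phase (Fin (2 * n)) → ℝ} {f : Phase (BI n) → ℝ}, IsHypForm F f →
      Differentiable ℝ f → DifferentiableAt ℝ F (a, hypMom a p) →
      (fun b => fderiv ℝ f (hyp a, p) (dirP b))
        = A (fun i => fderiv ℝ F (a, hypMom a p) (dirP i)) := by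
    intro F f h hf hF
    ext b
    rw [dirP, ← h.fderiv_momentum hf ha p hF, clm_apply_phase]
    conv_rhs => rw [← pi_eq_sum_single fun i => fderiv ℝ F (a, hypMom a p) (dirP i)]
    simp [hypMom, hA, mul_comm]
  have key2 : ∀ {F : Phase (Fin (2 * n)) → ℝ} {f : Phase (BI n) → ℝ}, IsHypForm F f →
      Differentiable ℝ f → DifferentiableAt ℝ F (a, hypMom a p) → ∀ w,
      fderiv ℝ f (hyp a, p) (A w, 0) = fderiv ℝ F (a, hypMom a p) (w, 0)
        + p ⬝ᵥ D w (fun i => fderiv ℝ F (a, hypMom a p) (dirP i)) := by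
    intro F f h hf hF w
    rw [← h.fderiv_position hf ha p hF, show (w, fderiv ℝ (fun a' => hypMom a' p) a w)
      = (w, 0) + ((0, fderiv ℝ (fun a' => hypMom a' p) a w) : Phase (Fin (2 * n))) by simp, map_add,
      clm_apply_phase _ (0, _)]
    congr 1
    conv_rhs => rw [← pi_eq_sum_single fun i => fderiv ℝ F (a, hypMom a p) (dirP i)]
    simp only [map_sum, map_smul, dotProduct_sum, dotProduct_smul, fderiv_hypMom, Pi.zero_apply,
      zero_mul, zero_add, smul_eq_mul]
    exact Finset.sum_congr rfl fun i _ => mul_comm _ _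
  -- The second-derivative corrections contributed by `f` and `g` are equal by symmetry and cancel
  -- in the difference.
  rw [bracket_eq_dot, bracket_eq_dot, key hFf hf hF, key hGg hg hG, key2 hFf hf hF, key2 hGg hg hG,
    hsym (fun i => fderiv ℝ F (a, hypMom a p) (dirP i))]
  have e1 := magField_sum_sum C (hyp a) (fun b : BI n => Pi.single b (1 : ℝ))
    (fun b => fderiv ℝ f (hyp a, p) (dirP b)) (fun b => fderiv ℝ g (hyp a, p) (dirP b))
  rw [pi_eq_sum_single, pi_eq_sum_single, key hFf hf hF, key hGg hg hG] at e1
  have e2 := magField_sum_sum C (hyp a) (fun i => A (Pi.single i (1 : ℝ)))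
    (fun b => fderiv ℝ F (a, hypMom a p) (dirP b)) (fun b => fderiv ℝ G (a, hypMom a p) (dirP b))
  simp only [← map_smul, ← map_sum, pi_eq_sum_single] at e2
  simp only [hypField, ← hA]
  rw [e1, e2]
  ring

lemma isHypForm_intHyp (hn : 1 ≤ n) (C : ℝ) (i : RedIdx n) :
    IsHypForm (intHyp C i) (intRed C i) := by
  have hq : ∀ k : Fin (n - 1), IsHypForm (hypQuad k) (redQuad k) := fun k a ha p =>
    hypQuad_eq ha p k
  have hd : ∀ k : Fin (n - 1), Differentiable ℝ (redQuad (n := n) k) := fun k =>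
    (contDiff_intRed C (.quad k)).differentiable (by simp)
  cases i with
  | ham => exact fun a ha p => hypHam_eq hn ha p
  | ang m => exact fun a _ p => hypAng_eq C a p m
  | quad k => exact hq k
  | brk l => exact (hq _).bracket hn C (hq _) (hd _) (hd _)

lemma bracket_intHyp_hypHam (hn : 1 ≤ n) (C : ℝ) (i : RedIdx n) (ha : a ∈ hypDomain n)
    (P : Fin (2 * n) → ℝ) : bracket (hypField n C) (intHyp C i) hypHam (a, P) = 0 := by
  obtain ⟨p, rfl⟩ := (hypMom_bijective hn ha).2 P
  have h := (isHypForm_intHyp hn C i).bracket hn C (isHypForm_intHyp hn C .ham)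
    ((contDiff_intRed C i).differentiable (by simp))
    ((contDiff_intRed C .ham).differentiable (by simp)) a ha p
  exact h.trans (intRed_hamRed C _ i)

end HypersphericalBracket
end

/-! ### Bijectivity of the hyperspherical chart. -/

noncomputable section
section HypersphericalChart

variable {n : ℕ} {a : Fin (2 * n) → ℝ}

lemma px_hyp (a : Fin (2 * n) → ℝ) (m : Fin n) :
    px (hyp a) m = hypRad a m * Real.cos (ent a (n + m)) := rfl

lemma py_hyp (a : Fin (2 * n) → ℝ) (m : Fin n) :
    py (hyp a) m = hypRad a m * Real.sin (ent a (n + m)) := rfl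

/-- The radii are positive and the polar angles avoid `±π`, so no planar component lies on the
closed negative half-axis. -/
lemma hyp_mapsTo : Set.MapsTo hyp (hypDomain n) {q | ∀ k, 0 < px q k ∨ py q k ≠ 0} := by
  intro a ha m
  have hR := hypRad_pos ha m
  obtain ⟨h1, h2⟩ := ha.2.2 (n + m) (by omega) (by omega)
  rw [or_iff_not_imp_right]
  intro h
  rw [not_not, py_hyp, mul_eq_zero, or_iff_right hR.ne', Real.sin_eq_zero_iff_of_lt_of_lt h1 h2] at h
  rw [px_hyp, h, Real.cos_zero, mul_one]
  exact hR

lemma hypRad_sq_eq (a : Fin (2 * n) → ℝ) (m : Fin n) :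
    hypRad a m ^ 2 = px (hyp a) m ^ 2 + py (hyp a) m ^ 2 := by
  rw [px_hyp, py_hyp]
  linear_combination (-hypRad a m ^ 2) * Real.sin_sq_add_cos_sq (ent a (n + m))

lemma arg_hyp (ha : a ∈ hypDomain n) (m : Fin n) :
    Complex.arg ⟨px (hyp a) m, py (hyp a) m⟩ = ent a (n + m) := by
  obtain ⟨h1, h2⟩ := ha.2.2 (n + m) (by omega) (by omega)
  rw [← Complex.arg_mul_cos_add_sin_mul_I (hypRad_pos ha m) ⟨h1, h2.le⟩]
  congr 1
  apply Complex.ext <;> simp [px_hyp, py_hyp, ← Complex.ofReal_cos, ← Complex.ofReal_sin]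

/-- A point determines its plane radii, hence all partial norms. Their ratios give the cosines of
the `θ_j`, and `Complex.arg` gives the polar angles. -/
lemma hyp_injOn (hn : 1 ≤ n) : Set.InjOn hyp (hypDomain n) := by
  intro a ha a' ha' h
  have hR : hypRad a = hypRad a' := by
    ext m
    rw [← sq_eq_sq₀ (hypRad_pos ha m).le (hypRad_pos ha' m).le, hypRad_sq_eq, hypRad_sq_eq, h]
  have hN : ∀ i, 1 ≤ i → i ≤ n → hypNorm a i = hypNorm a' i := by
    intro i h1 h2
    obtain ⟨j, rfl⟩ : ∃ j, i = j + 1 := ⟨i - 1, by omega⟩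
    rw [← sq_eq_sq₀ (hypNorm_pos ha h1).le (hypNorm_pos ha' h1).le, hypNorm_sq a (by omega),
      hypNorm_sq a' (by omega), hR]
  ext j
  obtain ⟨j, hj⟩ := j
  rw [← ent_of_lt a hj, ← ent_of_lt a' hj]
  rcases Nat.eq_zero_or_pos j with rfl | h0
  · rw [← hypNorm_top, ← hypNorm_top, hN n hn le_rfl]
  rcases lt_or_ge j n with h1 | h1
  · have h2 := hypNorm_succ a (i := n - j) (by omega)
    have h3 := hypNorm_succ a' (i := n - j) (by omega)
    rw [hN _ (by omega) (by omega), hN (n - j + 1) (by omega) (by omega), h3,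
      show n - (n - j) = j by omega] at h2
    have h4 := mul_left_cancel₀ (hypNorm_pos ha' (by omega)).ne' h2
    obtain ⟨h5, h6⟩ := ha.2.1 j h0 h1
    obtain ⟨h7, h8⟩ := ha'.2.1 j h0 h1
    exact Real.injOn_cos ⟨h5.le, by linarith⟩ ⟨h7.le, by linarith⟩ h4.symm
  · have h2 := arg_hyp ha ⟨j - n, by omega⟩
    have h3 := arg_hyp ha' ⟨j - n, by omega⟩
    rw [h, h3] at h2
    simpa [Nat.add_sub_cancel' h1] using h2.symm

/-- The norm of the first `i` planar components of `q`. -/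
def partNorm (q : BI n → ℝ) (i : ℕ) : ℝ :=
  √(∑ m ∈ range i, natExt (fun m => px q m ^ 2 + py q m ^ 2) m)

/-- The hyperspherical coordinates of `q`. -/
def hypInv (q : BI n → ℝ) : Fin (2 * n) → ℝ := fun j =>
  if (j : ℕ) = 0 then partNorm q n
  else if (j : ℕ) < n then Real.arccos (partNorm q (n - j) / partNorm q (n - j + 1))
  else Complex.arg ⟨natExt (px q) (j - n), natExt (py q) (j - n)⟩

lemma ent_hypInv_zero (hn : 1 ≤ n) (q : BI n → ℝ) : ent (hypInv q) 0 = partNorm q n := by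
  rw [ent_of_lt _ (by omega), hypInv, if_pos rfl]

lemma ent_hypInv_of_lt (q : BI n → ℝ) {j : ℕ} (h1 : 1 ≤ j) (h2 : j < n) :
    ent (hypInv q) j = Real.arccos (partNorm q (n - j) / partNorm q (n - j + 1)) := by
  rw [ent_of_lt _ (by omega), hypInv]
  simp only
  rw [if_neg (by omega), if_pos h2]

lemma ent_hypInv_ang (hn : 1 ≤ n) (q : BI n → ℝ) (m : Fin n) :
    ent (hypInv q) (n + m) = Complex.arg ⟨px q m, py q m⟩ := by
  rw [ent_of_lt _ (by omega), hypInv]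
  simp only
  rw [if_neg (by omega), if_neg (by omega), Nat.add_sub_cancel_left, natExt_coe, natExt_coe]

lemma hyp_surjOn (hn : 1 ≤ n) :
    Set.SurjOn hyp (hypDomain n) {q | ∀ k, 0 < px q k ∨ py q k ≠ 0} := by
  intro q hq
  have hpos : ∀ m : ℕ, m < n → 0 < natExt (fun m => px q m ^ 2 + py q m ^ 2) m := by
    intro m hm
    rw [natExt, dif_pos hm]
    rcases hq ⟨m, hm⟩ with h | h <;> positivity
  have hS : ∀ i, i ≤ n → 1 ≤ i →
      0 < ∑ m ∈ range i, natExt (fun m => px q m ^ 2 + py q m ^ 2) m := fun i hi h1 =>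
    Finset.sum_pos (fun m hm => hpos m (by rw [Finset.mem_range] at hm; omega)) ⟨0, by simp; omega⟩
  have hP : ∀ i, i ≤ n → 1 ≤ i → 0 < partNorm q i := fun i hi h1 => Real.sqrt_pos.2 (hS i hi h1)
  have hPs : ∀ i, i < n → 1 ≤ i → partNorm q (i + 1) ^ 2
      = partNorm q i ^ 2 + natExt (fun m => px q m ^ 2 + py q m ^ 2) i := by
    intro i hi h1
    rw [partNorm, partNorm, Real.sq_sqrt (hS _ hi (by omega)).le, Real.sq_sqrt (hS _ hi.le h1).le,
      Finset.sum_range_succ]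
  have hlt : ∀ i, i < n → 1 ≤ i → partNorm q i / partNorm q (i + 1) < 1 := by
    intro i hi h1
    rw [div_lt_one (hP _ hi (by omega))]
    exact lt_of_pow_lt_pow_left₀ 2 (hP _ hi (by omega)).le (by
      rw [hPs i hi h1]; linarith [hpos i hi])
  have hmem : hypInv q ∈ hypDomain n := by
    refine ⟨by rw [ent_hypInv_zero hn]; exact hP n le_rfl hn, fun j h1 h2 => ?_, fun j h1 h2 => ?_⟩
    · rw [ent_hypInv_of_lt q h1 h2]
      exact ⟨Real.arccos_pos.2 (hlt _ (by omega) (by omega)), Real.arccos_lt_pi_div_two.2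
        (div_pos (hP _ (by omega) (by omega)) (hP _ (by omega) (by omega)))⟩
    · have h := ent_hypInv_ang hn q ⟨j - n, by omega⟩
      rw [show n + ((⟨j - n, by omega⟩ : Fin n) : ℕ) = j by simp; omega] at h
      rw [h]
      exact ⟨Complex.neg_pi_lt_arg _, Complex.arg_lt_pi_iff.2 ((hq _).imp le_of_lt id)⟩
  -- Descending induction from the full norm `r`, since each angle is defined by the ratio of a
  -- partial norm to the next larger one.
  have hN : ∀ d, d < n → hypNorm (hypInv q) (n - d) = partNorm q (n - d) := by
    intro d
    induction d with
    | zero => intro _; rw [Nat.sub_zero, hypNorm_top, ent_hypInv_zero hn]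
    | succ d ih =>
      intro hd
      have h1 := hP (n - (d + 1)) (by omega) (by omega)
      have h2 := hP (n - (d + 1) + 1) (by omega) (by omega)
      rw [hypNorm_succ _ (by omega : n - (d + 1) < n), show n - (d + 1) + 1 = n - d by omega,
        ih (by omega), ent_hypInv_of_lt q (by omega) (by omega),
        show n - (n - (n - (d + 1))) = n - (d + 1) by omega, Real.cos_arccos]
      · rw [show n - (d + 1) + 1 = n - d by omega] at h2 ⊢
        field_simp
      · linarith [div_pos h1 h2]
      · exact (hlt _ (by omega) (by omega)).le
  have hN' : ∀ i, 1 ≤ i → i ≤ n → hypNorm (hypInv q) i = partNorm q i := by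
    intro i h1 h2
    have := hN (n - i) (by omega)
    rwa [Nat.sub_sub_self h2] at this
  -- A plane radius squared is the difference of two consecutive squared partial norms, except for
  -- the first one, which is a partial norm itself.
  have hR : ∀ m : Fin n, hypRad (hypInv q) m = ‖(⟨px q m, py q m⟩ : ℂ)‖ := by
    intro m
    rw [← sq_eq_sq₀ (hypRad_pos hmem m).le (norm_nonneg _), ← Complex.normSq_eq_norm_sq,
      Complex.normSq_mk, ← natExt_coe (hypRad (hypInv q))]
    have e : natExt (fun m => px q m ^ 2 + py q m ^ 2) m = px q m * px q m + py q m * py q m := by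
      rw [natExt_coe]
      ring
    rcases Nat.eq_zero_or_pos (m : ℕ) with h0 | h0
    · rw [h0, natExt_hypRad_zero hn, hN' 1 le_rfl hn, partNorm, Real.sq_sqrt (hS 1 hn le_rfl).le,
        Finset.sum_range_one, ← h0, e]
    · have h1 := hypNorm_sq_succ h0 m.2 (hypInv q)
      rw [hN' _ (by omega) (by omega), hN' _ h0 m.2.le, hPs _ m.2 h0, e] at h1
      linarith
  refine ⟨hypInv q, hmem, ?_⟩
  ext b
  rcases b with m | m
  · change px (hyp (hypInv q)) m = px q m
    rw [px_hyp, hR, ent_hypInv_ang hn, Complex.norm_mul_cos_arg]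
  · change py (hyp (hypInv q)) m = py q m
    rw [py_hyp, hR, ent_hypInv_ang hn, Complex.norm_mul_sin_arg]

lemma hyp_bijOn (hn : 1 ≤ n) :
    Set.BijOn hyp (hypDomain n) {q | ∀ k, 0 < px q k ∨ py q k ≠ 0} :=
  ⟨hyp_mapsTo, hyp_injOn hn, hyp_surjOn hn⟩

end HypersphericalChart
end

/-! ### Fibres of the reduction and assembly of the theorem. -/

noncomputable section
section Main

variable {n : ℕ}

lemma eq_of_reduceMap_eq {C : ℝ} {s s' : Phase (HI n)} (hs : pz s.2 = C) (hs' : pz s'.2 = C)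
    (h : reduceMap s = reduceMap s') : bar s.1 = bar s'.1 ∧ s.2 = s'.2 := by
  have h1 : bar s.1 = bar s'.1 := congrArg Prod.fst h
  have h2 := congrArg Prod.snd h
  refine ⟨h1, ?_⟩
  ext b
  rcases b with (k | k) | u
  · have h3 := congrFun h2 (Sum.inl k)
    simp only [reduceMap, hs, hs', h1, Sum.elim_inl, Pi.add_apply] at h3
    exact add_right_cancel h3
  · exact congrFun h2 (Sum.inr k)
  · exact hs.trans hs'.symm

lemma bracket_comp_reduceMap (f g : Phase (BI n) → ℝ) (s : Phase (HI n))
    (hf : DifferentiableAt ℝ f (reduceMap s)) (hg : DifferentiableAt ℝ g (reduceMap s)) :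
    bracket 0 (f ∘ reduceMap) (g ∘ reduceMap) s
      = bracket (magField (pz s.2)) f g (reduceMap s) := by
  have h := contDiff_reduceMap.differentiable omega_ne_zero' s
  exact bracket_of_eq_on_level (hf.comp s h) hf (hg.comp s h) hg (fun _ _ => rfl) fun _ _ => rfl

end Main

theorem theorem3p3 (n : ℕ) (hn : 1 ≤ n) :
    -- (a) the normal geodesic flow is the Hamiltonian flow of `hamR`
    ((∃! β, IsCometricMap (n := n) distR leftMetric β) ∧
      (∀ β, IsCometricMap (n := n) distR leftMetric β →
        ∀ s : Phase (HI n), 1 / 2 * (s.2 ⬝ᵥ β s.1 s.2) = hamR s) ∧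
      (∀ (c : ℝ → Phase (HI n)) (T : Set ℝ),
        IsNormalExtremalOn c T ↔ IsHamTrajectoryOn hamR c T) ∧
      -- first integrals and integrability
      (∀ i, IsFirstIntegral 0 hamR (intFull (n := n) i)) ∧
      IndependentAE (intFull (n := n)) ∧
      (n ≤ 2 →
        InInvolution 0 (lieAlg 0 (Set.range (intFull (n := n)))) ∧
        IsCompleteAlgebra 0 hamR (lieAlg 0 (Set.range (intFull (n := n))))
          (2 * n + 1) (2 * n + 1)) ∧
      (2 < n →
        ¬ InInvolution 0 (Set.range (intFull (n := n))) ∧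
        IsCompleteAlgebra 0 hamR (lieAlg 0 (Set.range (intFull (n := n))))
          (3 * n - 1) (n + 3))) ∧
    -- (b) the reduced system on the level `λ_{2n+1} = C`
    ∀ C : ℝ,
      -- reduction of the phase space, of the Hamiltonian, of the metric and of the bracket
      ((∀ b : Phase (BI n), ∃ s : Phase (HI n), pz s.2 = C ∧ reduceMap s = b) ∧
        (∀ s s' : Phase (HI n), pz s.2 = C → pz s'.2 = C → reduceMap s = reduceMap s' →
          bar s.1 = bar s'.1 ∧ s.2 = s'.2) ∧
        (∀ s : Phase (HI n), pz s.2 = C → hamR s = hamRed (reduceMap s)) ∧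
        (∀ (g : HI n → ℝ) (v w : BI n → ℝ),
          bar (rightField v g) = v ∧
          leftMetric g (rightField v g) (rightField w g) = redMetric (bar g) v w) ∧
        (∀ q v p : BI n → ℝ, (∀ w, redMetric q v w = p ⬝ᵥ w) →
          hamRed (q, p) = 1 / 2 * redMetric q v v) ∧
        (∀ (f g : Phase (BI n) → ℝ) (s : Phase (HI n)), pz s.2 = C →
          DifferentiableAt ℝ f (reduceMap s) → DifferentiableAt ℝ g (reduceMap s) →
          bracket 0 (f ∘ reduceMap) (g ∘ reduceMap) s
            = bracket (magField C) f g (reduceMap s)) ∧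
        (∀ (i : RedIdx n) (s : Phase (HI n)), pz s.2 = C →
          intFull i.toFull s = intRed C i (reduceMap s))) ∧
      -- the projected flow is the motion of a charged particle in the magnetic field
      ((∀ (c : ℝ → Phase (HI n)) (T : Set ℝ), IsNormalExtremalOn c T →
          (∀ t ∈ T, pz (c t).2 = C) →
          IsChargedMotionOn (magField C) hamRed (fun t => reduceMap (c t)) T) ∧
        (∀ (b : ℝ → Phase (BI n)) (T : Set ℝ), IsOpen T → T.OrdConnected →
          IsChargedMotionOn (magField C) hamRed b T → ∀ t₀ ∈ T, ∀ z₀ : ℝ,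
          ∃ c : ℝ → Phase (HI n), IsNormalExtremalOn c T ∧
            (∀ t ∈ T, pz (c t).2 = C ∧ reduceMap (c t) = b t) ∧ pz (c t₀).1 = z₀)) ∧
      -- its complete integrability
      ((∀ i, IsFirstIntegral (magField C) hamRed (intRed (n := n) C i)) ∧
        IndependentAE (intRed (n := n) C) ∧
        (n ≤ 2 →
          InInvolution (magField C) (lieAlg (magField C) (Set.range (intRed (n := n) C))) ∧
          IsCompleteAlgebra (magField C) hamRed
            (lieAlg (magField C) (Set.range (intRed (n := n) C))) (2 * n) (2 * n)) ∧
        (2 < n →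
          ¬ InInvolution (magField C) (Set.range (intRed (n := n) C)) ∧
          IsCompleteAlgebra (magField C) hamRed
            (lieAlg (magField C) (Set.range (intRed (n := n) C))) (3 * n - 2) (n + 2))) ∧
      -- the integrals in hyperspherical coordinates
      (Set.BijOn hyp (hypDomain n) {q | ∀ k, 0 < px q k ∨ py q k ≠ 0} ∧
        (∀ a ∈ hypDomain n, Function.Bijective (hypMom a)) ∧
        (∀ a ∈ hypDomain n, ∀ (p : BI n → ℝ) (i : RedIdx n),
          intHyp C i (a, hypMom a p) = intRed C i (hyp a, p)) ∧
        (∀ a ∈ hypDomain n, ∀ (P : Fin (2 * n) → ℝ) (i : RedIdx n),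
          bracket (hypField n C) (intHyp C i) hypHam (a, P) = 0)) := by
  refine ⟨⟨⟨cometricMap, isCometricMap_iff.2 rfl, fun β hβ => isCometricMap_iff.1 hβ⟩, ?_,
    isNormalExtremalOn_iff, isFirstIntegral_intFull, independentAE_intFull hn,
    full_integrable_of_le_two hn, full_integrable_of_two_lt⟩, fun C => ⟨⟨?_, ?_, ?_, ?_, ?_, ?_, ?_⟩,
    ⟨?_, ?_⟩, ⟨isFirstIntegral_intRed C, independentAE_intRed hn C,
      fun h => reduced_integrable_of_le_two hn h C, fun h => reduced_integrable_of_two_lt h C⟩,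
    hyp_bijOn hn, fun a ha => hypMom_bijective hn ha, fun a ha p i => isHypForm_intHyp hn C i a ha p,
    fun a ha P i => bracket_intHyp_hypHam hn C i ha P⟩⟩
  · intro β hβ s
    rw [isCometricMap_iff.1 hβ, half_dot_cometricMap]
  · exact fun b => ⟨sectionMap C 0 b, pz_sectionMap C 0 b, reduceMap_sectionMap C 0 b⟩
  · exact fun s s' hs hs' h => eq_of_reduceMap_eq hs hs' h
  · exact fun s _ => hamR_eq s
  · exact fun g v w => ⟨bar_rightField v g, leftMetric_rightField g v w⟩
  · exact fun q v p h => hamRed_of_dual h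
  · rintro f g s rfl hf hg
    exact bracket_comp_reduceMap f g s hf hg
  · rintro i s rfl
    exact (isLift_intFull i).eq s
  · exact fun c T hc hC => isChargedMotionOn_reduce hc hC
  · exact fun b T hT hT' hb t₀ ht₀ z₀ => exists_normalExtremal hT hT' hb ht₀ z₀

end
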